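/- Let $L,\nu,T>0$ and consider the three-dimensional Navier--Stokes equations on the periodic cell $Q=[0,L]^3$ with zero spatial average, in the functional form $$\frac{du}{dt}+\nu Au+B(u,u)=f(t),\qquad u(0)=u_0 .$$ Here $H$ is the closure in $[L^2(Q)]^3$ of the smooth periodic divergence-free vector fields with zero average, $\Pi$ is the orthogonal projection of $[L^2(Q)]^3$ onto $H$, $A=-\Pi\Delta$ is the Stokes operator, $B(u,v)=\Pi[(u\cdot\nabla)v]$, and $V^m=D(A^{m/2})$ with the norm $\|u\|_m=|A^{m/2}u|$, where $|\cdot|$ is the norm of $[L^2(Q)]^3$; $V=V^1$. A strong solution on $[0,T]$ is a function $u\in L^\infty(0,T;V)\cap L^2(0,T;V^2)$, absolutely continuous on $[0,T]$ with values in $H$, that satisfies the equation in $H$ for almost every $t\in[0,T]$ and has $u(0)=u_0$. Let $w_1,w_2,\dots$ be an orthonormal basis of $H$ consisting of eigenfunctions of $A$ with eigenvalues $0<\lambda_1\le\lambda_2\le\cdots$, and let $P_n$ be the orthogonal projection of $H$ onto the span of $w_1,\dots,w_n$. The Galerkin solution $u_n:[0,T]\to P_nH$ is the absolutely continuous solution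 of $$\frac{du_n}{dt}+\nu Au_n+P_nB(u_n,u_n)=P_nf\quad\text{for a.e. }t\in[0,T],\qquad u_n(0)=P_nu_0 .$$ Theorem (verification in finite time). Let $m\ge 3$ be an integer, $u_0\in V^m$ and $f\in L^1(0,T;V^m)\cap L^2(0,T;V^{m-1})$, and suppose that a strong solution $u$ with data $(u_0,f)$ exists on $[0,T]$. Let $c_m>0$ be any constant. Then there is an $N$ such that for every $n\ge N$ the Galerkin solution $u_n$ exists on $[0,T]$ and passes the a posteriori test for the existence of a strong solution with data $(u_0,f)$, i.e. $$u_n\in C^0([0,T];V^m)\cap L^2(0,T;V^{m+1}),\qquad \frac{du_n}{dt}+\nu Au_n+B(u_n,u_n)\in L^1(0,T;V^m)\cap L^2(0,T;V^{m-1}),$$ and $$\|u_n(0)-u_0\|_m+\int_0^T\Big\|\frac{du_n}{dt}(s)+\nu Au_n(s)+B(u_n(s),u_n(s))-f(s)\Big\|_m\,ds<\frac{1}{c_mT}\exp\Big[-c_m\int_0^T\big(\|u_n(s)\|_m+\|u_n(s)\|_{m+1}\big)\,ds\Big].$$ -/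

import Mathlib

open MeasureTheory Set Filter Topology
open scoped ENNReal RealInnerProductSpace ContDiff

noncomputable section

namespace NavierStokes

/-! ## The periodic cell and the function spaces -/

/-- Three-dimensional Euclidean space. -/
abbrev E3 : Type := EuclideanSpace ℝ (Fin 3)

/-- The `i`-th standard basis vector. -/
def e (i : Fin 3) : E3 := EuclideanSpace.single i 1

/-- The cell `Q = [0, L]³`. -/
def cell (L : ℝ) : Set E3 := {x | ∀ i, x i ∈ Icc 0 L}

/-- Lebesgue measure on `Q`. -/
abbrev μQ (L : ℝ) : Measure E3 := volume.restrict (cell L)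

/-- The space `[L²(Q)]³`. -/
abbrev L2 (L : ℝ) : Type := Lp E3 2 (μQ L)

/-- `L`-periodicity in each coordinate direction. -/
def IsPeriodic (L : ℝ) (φ : E3 → E3) : Prop := ∀ (i : Fin 3) (x : E3), φ (x + L • e i) = φ x

/-- The collection `𝓗` of smooth periodic divergence-free vector fields with zero average. -/
structure IsTestField (L : ℝ) (φ : E3 → E3) : Prop where
  smooth : ContDiff ℝ ∞ φ
  periodic : IsPeriodic L φ
  div_free : ∀ x, ∑ i, (fderiv ℝ φ x (e i)) i = 0
  mean_zero : ∫ x in cell L, φ x = 0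

/-- `H`, the closure of `𝓗` in `[L²(Q)]³` (`𝓗` is a linear space, so the span changes nothing). -/
abbrev H (L : ℝ) : Submodule ℝ (L2 L) :=
  (Submodule.span ℝ {v : L2 L | ∃ φ, IsTestField L φ ∧ v =ᵐ[μQ L] φ}).topologicalClosure

/-- `Π`, the orthogonal projection of `[L²(Q)]³` onto `H`. -/
def lerayProj (L : ℝ) : L2 L →L[ℝ] L2 L := (H L).starProjection

/-- `k`-th Fourier coefficient of the `i`-th component,
`L⁻³ ∫_Q uᵢ(x) exp (-2πi k·x / L) dx`. -/
def fourierCoeff (L : ℝ) (u : L2 L) (k : Fin 3 → ℤ) (i : Fin 3) : ℂ :=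
  ((L ^ 3)⁻¹ : ℝ) * ∫ x in cell L,
    (u x i : ℂ) * Complex.exp (-(2 * Real.pi / L * ∑ j, (k j : ℝ) * x j : ℝ) * Complex.I)

/-- The contribution of the wave vector `2πk/L` to `|A^{m/2} u|²`: here `A` acts on the `k`-th
Fourier coefficient as multiplication by `|2πk/L|²`, and Parseval gives
`|u|² = L³ ∑ₖ |û(k)|²`. -/
def vTerm (L : ℝ) (m : ℕ) (u : L2 L) (k : Fin 3 → ℤ) : ℝ :=
  L ^ 3 * (∑ j, (2 * Real.pi * (k j : ℝ) / L) ^ 2) ^ m * ∑ i, ‖fourierCoeff L u k i‖ ^ 2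

/-- Membership in `V^m = D(A^{m/2}) = H^m ∩ V`. In particular `V = V^1`. -/
def MemV (L : ℝ) (m : ℕ) (u : L2 L) : Prop := u ∈ H L ∧ Summable (vTerm L m u)

/-- The norm `‖u‖_m = |A^{m/2} u|` (meaningful for `u ∈ V^m`). -/
def vNorm (L : ℝ) (m : ℕ) (u : L2 L) : ℝ := Real.sqrt (∑' k, vTerm L m u k)

/-! ## The Stokes operator and the nonlinear term -/

/-- `g` is the weak derivative `∂v/∂xᵢ` on the torus. -/
def IsWeakPartial (L : ℝ) (i : Fin 3) (v g : L2 L) : Prop :=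
  ∀ ψ : E3 → E3, ContDiff ℝ ∞ ψ → IsPeriodic L ψ →
    ∫ x in cell L, ⟪v x, fderiv ℝ ψ x (e i)⟫ = -∫ x in cell L, ⟪g x, ψ x⟫

open Classical in
/-- The weak derivative `∂v/∂xᵢ ∈ [L²(Q)]³` if it exists, and `0` otherwise. -/
def weakPartial (L : ℝ) (i : Fin 3) (v : L2 L) : L2 L :=
  if h : ∃ g, IsWeakPartial L i v g then h.choose else 0

/-- The Stokes operator `A u = -ΠΔu`, with domain `V²`. -/
def stokes (L : ℝ) (u : L2 L) : L2 L :=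
  -lerayProj L (∑ i, weakPartial L i (weakPartial L i u))

/-- `(u · ∇)v`. -/
def advection (L : ℝ) (u v : L2 L) : E3 → E3 := fun x => ∑ i, u x i • weakPartial L i v x

open Classical in
/-- `B(u, v) = Π[(u · ∇)v]`, for `u`, `v` with `(u · ∇)v ∈ [L²(Q)]³` (as for `u, v ∈ V²`). -/
def B (L : ℝ) (u v : L2 L) : L2 L :=
  if h : MemLp (advection L u v) 2 (μQ L) then lerayProj L h.toLp else 0

/-! ## Functions of time with values in `V^m` -/

/-- `u ∈ L^p(0, T; V^m)`. Strong measurability into `H` of a function with values in the separable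
Hilbert space `V^m ⊆ H` is the same as strong measurability into `V^m`. -/
structure MemLpV (L T : ℝ) (p : ℝ≥0∞) (m : ℕ) (u : ℝ → L2 L) : Prop where
  aestronglyMeasurable : AEStronglyMeasurable u (volume.restrict (Ioc 0 T))
  memV : ∀ᵐ t ∂volume.restrict (Ioc 0 T), MemV L m (u t)
  memLp : MemLp (fun t => vNorm L m (u t)) p (volume.restrict (Ioc 0 T))

/-- `u ∈ C⁰([0, T]; V^m)`. -/
def MemC0V (L T : ℝ) (m : ℕ) (u : ℝ → L2 L) : Prop :=
  (∀ t ∈ Icc 0 T, MemV L m (u t)) ∧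
    ∀ t ∈ Icc 0 T, Tendsto (fun s => vNorm L m (u s - u t)) (𝓝[Icc 0 T] t) (𝓝 0)

/-- `u` is absolutely continuous on `[0, T]` with values in `[L²(Q)]³`, and `u' = du/dt` is its
(weak, almost everywhere) time derivative. -/
def IsTimeDeriv (L T : ℝ) (u u' : ℝ → L2 L) : Prop :=
  IntervalIntegrable u' volume 0 T ∧ ∀ t ∈ Icc 0 T, u t = u 0 + ∫ s in (0 : ℝ)..t, u' s

/-- `u` is a strong solution on `[0, T]` of `du/dt + νAu + B(u,u) = f`, `u(0) = u₀`. -/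
structure IsStrongSolution (L ν T : ℝ) (u₀ : L2 L) (f u : ℝ → L2 L) : Prop where
  memLp_top : MemLpV L T ∞ 1 u
  memLp_two : MemLpV L T 2 2 u
  initial : u 0 = u₀
  equation : ∃ u', IsTimeDeriv L T u u' ∧ ∀ᵐ t ∂volume.restrict (Ioc 0 T),
    u' t + ν • stokes L (u t) + B L (u t) (u t) = f t

/-! ## Galerkin approximations -/

/-- `w₀, w₁, …` is an orthonormal basis of `H` consisting of eigenfunctions of the Stokes operator,
ordered so that the eigenvalues `0 < lam 0 ≤ lam 1 ≤ …` do not decrease. -/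
structure IsStokesEigenbasis (L : ℝ) (w : ℕ → L2 L) (lam : ℕ → ℝ) : Prop where
  orthonormal : Orthonormal ℝ w
  memV : ∀ j, MemV L 2 (w j)
  eigen : ∀ j, stokes L (w j) = lam j • w j
  complete : H L ≤ (Submodule.span ℝ (range w)).topologicalClosure
  pos : ∀ j, 0 < lam j
  mono : Monotone lam

/-- `Pₙ u = ∑_{j < n} (u, wⱼ) wⱼ`, the projection onto the first `n` eigenfunctions. -/
def galerkinProj {L : ℝ} (w : ℕ → L2 L) (n : ℕ) (u : L2 L) : L2 L :=
  ∑ j ∈ Finset.range n, ⟪u, w j⟫ • w j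

/-- `v : [0, T] → Pₙ H` solves the Galerkin approximation
`dv/dt + νAv + PₙB(v,v) = Pₙf`, `v(0) = Pₙu₀`. -/
structure IsGalerkinSolution (L ν T : ℝ) (w : ℕ → L2 L) (n : ℕ) (u₀ : L2 L) (f v : ℝ → L2 L) :
    Prop where
  mem : ∀ t ∈ Icc 0 T, galerkinProj w n (v t) = v t
  initial : v 0 = galerkinProj w n u₀
  equation : ∃ v', IsTimeDeriv L T v v' ∧ ∀ᵐ t ∂volume.restrict (Ioc 0 T),
    v' t + ν • stokes L (v t) + galerkinProj w n (B L (v t) (v t)) = galerkinProj w n (f t)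

/-! ## The a posteriori test -/

/-- The function `v` passes the a posteriori test (with constant `c`) for the existence of a strong
solution with data `(u₀, f)`: it has the regularity that the test requires, and
`‖v(0) - u₀‖_m + ∫₀ᵀ ‖dv/dt + νAv + B(v,v) - f‖_m ds
  < (cT)⁻¹ exp (-c ∫₀ᵀ (‖v‖_m + ‖v‖_{m+1}) ds)`. -/
def PassesTest (L ν T : ℝ) (m : ℕ) (c : ℝ) (u₀ : L2 L) (f v : ℝ → L2 L) : Prop :=
  MemC0V L T m v ∧ MemLpV L T 2 (m + 1) v ∧
  ∃ v', IsTimeDeriv L T v v' ∧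
    MemLpV L T 1 m (fun s => v' s + ν • stokes L (v s) + B L (v s) (v s)) ∧
    MemLpV L T 2 (m - 1) (fun s => v' s + ν • stokes L (v s) + B L (v s) (v s)) ∧
    vNorm L m (v 0 - u₀)
        + ∫ s in (0 : ℝ)..T,
            vNorm L m (v' s + ν • stokes L (v s) + B L (v s) (v s) - f s)
      < 1 / (c * T) *
          Real.exp (-c * ∫ s in (0 : ℝ)..T, (vNorm L m (v s) + vNorm L (m + 1) (v s)))

end NavierStokes

end

open NavierStokes

/-!
Write `Pₙ` for the projection onto the first `n` eigenfunctions and `Qₙ = 1 - Pₙ`.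

The residual of a Galerkin solution `v` is explicit: the equation for `v` leaves exactly
`dv/dt + νAv + B(v, v) - f = Qₙ (B(v, v) - f)`. So the left-hand side of the test is
`‖Qₙ u₀‖_m + ∫ ‖Qₙ (B(v, v) - f)‖_m`, and it tends to zero as soon as `v` tends to the strong
solution `u` in `L² V^{m+1}`: then `B(v, v) → B(u, u)` in `L¹ V^m`, while the tails `Qₙ` of the fixed
functions `u₀`, `f` and `B(u, u)` vanish by dominated convergence. The same convergence bounds
`∫ (‖v‖_m + ‖v‖_{m+1})`, and thus keeps the right-hand side of the test away from zero.

Convergence rests on the finite system `φ' + νAφ + Pₙ [B(v, v) - B(u, u)] = 0`, `φ(0) = 0`, for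
`φ = v - Pₙ u`. In the eigenbasis it is diagonal apart from the nonlinear term, and
`‖B(u, u) - B(v, v)‖_{m-1}² ≤ K (‖φ‖_m² + ‖Qₙ u‖_m²)` as long as `‖φ‖_m ≤ 1`. A Grönwall and
continuation argument (`diagonal_comparison`) shows that `φ` is small in `L^∞ V^m ∩ L² V^{m+1}` when
`∫ ‖Qₙ u‖_m²` is small (`IsStrongSolution.exists_galerkin_bound`). Since it uses the system only
while `‖φ‖_m ≤ 1`, it applies equally to a truncated Galerkin system, which has a global solution by
the Picard–Lindelöf theorem; hence the truncation is inactive and the Galerkin solution exists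
(`exists_isGalerkinSolution`).

The argument needs `u ∈ L^∞ V^m ∩ L² V^{m+1}` (`IsStrongSolution.regularity`). This is reached from
`L^∞ V ∩ L² V²` in steps of a quarter of a derivative, by the diagonal energy estimate
(`diagonal_energy`) and `‖B(u, u)‖_{s-3/4} ≤ C ‖u‖_s ‖u‖_{s+1}`, a case of the product estimate
`exists_sobSq_B_le`.

All norms are computed in two ways. The coefficients `⟪u, w j⟫` make the equation diagonal
(`sobSq`); the Fourier coefficients turn products into convolutions (`fourierSobSq`). A Stokes
eigenfunction contains only Fourier modes with `|2πk/L|²` equal to its eigenvalue, so Bessel's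
inequality on each eigenspace together with Parseval's identity for the whole of `H` shows that the
two agree on `H` (`sobSq_eq_fourierSobSq`).
-/

open scoped ComplexConjugate

noncomputable section

namespace NavierStokes

/-! ### Fourier series on the periodic cell -/

section

attribute [local instance] instMeasureSpaceUnitAddCircle

variable {L : ℝ}

/-- The character `x ↦ exp (2πi k·x / L)` of the periodic cell. -/
def char (L : ℝ) (k : Fin 3 → ℤ) (x : E3) : ℂ :=
  Complex.exp ((2 * Real.pi / L * ∑ j, (k j : ℝ) * x j : ℝ) * Complex.I)

/-- The `k`-th Fourier coefficient of a complex-valued function on the cell. -/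
def coef (L : ℝ) (g : E3 → ℂ) (k : Fin 3 → ℤ) : ℂ :=
  ((L ^ 3)⁻¹ : ℝ) * ∫ x in cell L, g x *
    Complex.exp (-(2 * Real.pi / L * ∑ j, (k j : ℝ) * x j : ℝ) * Complex.I)

lemma fourierCoeff_eq_coef (u : L2 L) (k : Fin 3 → ℤ) (i : Fin 3) :
    fourierCoeff L u k i = coef L (fun x => (u x i : ℂ)) k := rfl

lemma char_neg (k : Fin 3 → ℤ) (x : E3) : char L (-k) x = conj (char L k x) := by
  rw [char, char, ← Complex.exp_conj, map_mul, Complex.conj_ofReal, Complex.conj_I]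
  congr 1
  simp only [Pi.neg_apply, Fin.sum_univ_three]
  push_cast; ring

lemma exp_neg_eq_conj_char (k : Fin 3 → ℤ) (x : E3) :
    Complex.exp (-(2 * Real.pi / L * ∑ j, (k j : ℝ) * x j : ℝ) * Complex.I)
      = conj (char L k x) := by
  rw [char, ← Complex.exp_conj, map_mul, Complex.conj_ofReal, Complex.conj_I]
  congr 1
  ring

lemma coef_eq (g : E3 → ℂ) (k : Fin 3 → ℤ) :
    coef L g k = ((L ^ 3)⁻¹ : ℝ) * ∫ x in cell L, g x * conj (char L k x) := by
  simp only [coef, exp_neg_eq_conj_char]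

lemma char_add (k l : Fin 3 → ℤ) (x : E3) : char L (k + l) x = char L k x * char L l x := by
  simp only [char, ← Complex.exp_add]
  congr 1
  simp only [Pi.add_apply, Fin.sum_univ_three]
  push_cast; ring

lemma norm_char (k : Fin 3 → ℤ) (x : E3) : ‖char L k x‖ = 1 := by
  rw [char, Complex.norm_exp_ofReal_mul_I]

lemma continuous_char (k : Fin 3 → ℤ) : Continuous (char L k) := by
  unfold char; fun_prop

lemma isCompact_cell : IsCompact (cell L) := by
  have h : cell L = (WithLp.toLp 2) '' (Set.pi univ fun _ : Fin 3 => Icc (0 : ℝ) L) := by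
    ext x
    constructor
    · intro hx
      exact ⟨WithLp.ofLp x, fun i _ => hx i, rfl⟩
    · rintro ⟨y, hy, rfl⟩ i
      exact hy i (mem_univ i)
  rw [h]
  exact (isCompact_univ_pi fun _ => isCompact_Icc).image (PiLp.continuous_toLp 2 _)

lemma measurableSet_cell : MeasurableSet (cell L) := isCompact_cell.isClosed.measurableSet

instance : IsFiniteMeasure (μQ L) := ⟨by
  rw [Measure.restrict_apply_univ]; exact isCompact_cell.measure_lt_top⟩

/-- The parametrization of the cell by the unit torus. -/
def ofTorus (L : ℝ) (t : UnitAddTorus (Fin 3)) : E3 :=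
  L • WithLp.toLp 2 ((UnitAddTorus.measurableEquivPiIoc (fun _ => (0 : ℝ)) t).1)

/-- The projection of space onto the unit torus that inverts `ofTorus` on the cell. -/
def toTorus (L : ℝ) (x : E3) : UnitAddTorus (Fin 3) := fun i => ((L⁻¹ * x i : ℝ) : UnitAddCircle)

lemma toTorus_ofTorus (hL : 0 < L) (t : UnitAddTorus (Fin 3)) : toTorus L (ofTorus L t) = t := by
  have h := (UnitAddTorus.measurableEquivPiIoc (fun _ : Fin 3 => (0 : ℝ))).symm_apply_apply t
  conv_rhs => rw [← h]
  funext i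
  rw [UnitAddTorus.coe_symm_measurableEquivPiIoc_apply]
  simp only [toTorus, ofTorus, PiLp.smul_apply, smul_eq_mul]
  rw [inv_mul_cancel_left₀ hL.ne']

lemma measurable_toTorus : Measurable (toTorus L) := by
  refine measurable_pi_lambda _ fun i => ?_
  exact AddCircle.measurable_mk'.comp (by fun_prop)

lemma char_eq_mFourier_toTorus (k : Fin 3 → ℤ) (x : E3) :
    char L k x = UnitAddTorus.mFourier k (toTorus L x) := by
  simp only [char, UnitAddTorus.mFourier, ContinuousMap.coe_mk, toTorus, fourier_coe_apply,
    ← Complex.exp_sum]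
  congr 1
  simp only [Fin.sum_univ_three]
  push_cast
  ring

lemma ae_eq_cell : {x : E3 | ∀ i, x i ∈ Ioc 0 L} =ᵐ[volume] cell L := by
  have h := Measure.univ_pi_Ioc_ae_eq_Icc (μ := fun _ : Fin 3 => (volume : Measure ℝ))
    (f := fun _ => 0) (g := fun _ => L)
  have h2 := (PiLp.volume_preserving_ofLp (Fin 3)).quasiMeasurePreserving.preimage_ae_eq h
  have e1 : {x : E3 | ∀ i, x i ∈ Ioc 0 L} = WithLp.ofLp ⁻¹' univ.pi fun _ => Ioc 0 L := by
    ext x; simp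
  have e2 : cell L = WithLp.ofLp ⁻¹' Icc (fun _ : Fin 3 => (0 : ℝ)) fun _ => L := by
    ext x; simp [cell, Set.mem_Icc, Pi.le_def, forall_and]
  rw [e1, e2]
  exact h2

/-- `ofTorus` carries the normalized measure of the torus to the normalized Lebesgue measure of the
cell. -/
lemma measurePreserving_ofTorus (hL : 0 < L) :
    MeasurePreserving (ofTorus L) volume (ENNReal.ofReal ((L ^ 3)⁻¹) • μQ L) := by
  have h1 := UnitAddTorus.measurePreserving_equivPiIoc (fun _ : Fin 3 => (0 : ℝ))
  have hB : MeasurableSet {x : Fin 3 → ℝ | ∀ i, x i ∈ Ioc (0 : ℝ) (0 + 1)} :=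
    MeasurableSet.univ_pi' fun _ => measurableSet_Ioc
  have h2 : MeasurePreserving (Subtype.val : {x : Fin 3 → ℝ // ∀ i, x i ∈ Ioc (0 : ℝ) (0 + 1)} → _)
      (Measure.comap Subtype.val volume)
      (volume.restrict {x : Fin 3 → ℝ | ∀ i, x i ∈ Ioc (0 : ℝ) (0 + 1)}) :=
    ⟨measurable_subtype_coe, map_comap_subtype_coe hB volume⟩
  have h3 : MeasurePreserving (fun x : E3 => L • x) volume
      (ENNReal.ofReal ((L ^ 3)⁻¹) • volume) := by
    refine ⟨measurable_const_smul L, ?_⟩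
    rw [Measure.map_addHaar_smul _ hL.ne']
    simp [abs_of_pos hL]
  have h4 := h3.comp (PiLp.volume_preserving_toLp (Fin 3))
  have hA : MeasurableSet {x : E3 | ∀ i, x i ∈ Ioc 0 L} := by
    have : MeasurableSet ((WithLp.ofLp : E3 → Fin 3 → ℝ) ⁻¹' (Set.pi univ fun _ => Ioc 0 L)) :=
      (MeasurableSet.univ_pi fun _ => measurableSet_Ioc).preimage (by fun_prop)
    convert this using 1
    ext x; simp
  have h5 := h4.restrict_preimage hA
  have h6 : ((fun x : E3 => L • x) ∘ WithLp.toLp 2) ⁻¹' {x : E3 | ∀ i, x i ∈ Ioc 0 L}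
      = {x : Fin 3 → ℝ | ∀ i, x i ∈ Ioc (0 : ℝ) (0 + 1)} := by
    ext x
    simp [hL]
  rw [h6] at h5
  have h7 := h5.comp (h2.comp h1)
  have h8 : (ENNReal.ofReal ((L ^ 3)⁻¹) • (volume : Measure E3)).restrict
      {x : E3 | ∀ i, x i ∈ Ioc 0 L} = ENNReal.ofReal ((L ^ 3)⁻¹) • μQ L := by
    rw [Measure.restrict_smul, Measure.restrict_congr_set ae_eq_cell]
  rw [h8] at h7
  exact h7

lemma aestronglyMeasurable_smul_measure {E : Type*} [NormedAddCommGroup E] {F : E3 → E}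
    (hF : AEStronglyMeasurable F (μQ L)) :
    AEStronglyMeasurable F (ENNReal.ofReal ((L ^ 3)⁻¹) • μQ L) :=
  hF.mono_ac Measure.smul_absolutelyContinuous

lemma integral_ofTorus (hL : 0 < L) {F : E3 → ℂ} (hF : AEStronglyMeasurable F (μQ L)) :
    ∫ t, F (ofTorus L t) = ((L ^ 3)⁻¹ : ℝ) * ∫ x in cell L, F x := by
  have h := measurePreserving_ofTorus hL
  have h1 := integral_map (φ := ofTorus L) (f := F) h.measurable.aemeasurable
    (by rw [h.map_eq]; exact aestronglyMeasurable_smul_measure hF)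
  rw [← h1, h.map_eq, integral_smul_measure, ENNReal.toReal_ofReal (by positivity)]
  exact Complex.real_smul

lemma memLp_ofTorus (hL : 0 < L) {g : E3 → ℂ} {p : ℝ≥0∞} (hg : MemLp g p (μQ L)) :
    MemLp (g ∘ ofTorus L) p volume :=
  (hg.smul_measure ENNReal.ofReal_ne_top).comp_measurePreserving (measurePreserving_ofTorus hL)

lemma mFourierCoeff_ofTorus (hL : 0 < L) {g : E3 → ℂ} (hg : AEStronglyMeasurable g (μQ L))
    (k : Fin 3 → ℤ) : UnitAddTorus.mFourierCoeff (g ∘ ofTorus L) k = coef L g k := by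
  have h2 : ∀ t, (UnitAddTorus.mFourier (-k)) t • (g ∘ ofTorus L) t =
      (fun x => g x * conj (char L k x)) (ofTorus L t) := fun t => by
    simp only [Function.comp_apply, ← char_neg]
    rw [char_eq_mFourier_toTorus, toTorus_ofTorus hL, smul_eq_mul, mul_comm]
  have h3 : AEStronglyMeasurable (fun x => g x * conj (char L k x)) (μQ L) :=
    hg.mul (Complex.continuous_conj.comp (continuous_char k)).aestronglyMeasurable
  rw [UnitAddTorus.mFourierCoeff, integral_congr_ae (Eventually.of_forall h2),
    integral_ofTorus hL h3, coef_eq]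

/-- Parseval's identity on the cell. -/
theorem hasSum_coef (hL : 0 < L) {g h : E3 → ℂ} (hg : MemLp g 2 (μQ L)) (hh : MemLp h 2 (μQ L)) :
    HasSum (fun k => conj (coef L g k) * coef L h k)
      (((L ^ 3)⁻¹ : ℝ) * ∫ x in cell L, conj (g x) * h x) := by
  have hG := memLp_ofTorus hL hg
  have hH := memLp_ofTorus hL hh
  have h1 := UnitAddTorus.hasSum_prod_mFourierCoeff hG.toLp hH.toLp
  have e1 : ∀ k, UnitAddTorus.mFourierCoeff hG.toLp k = coef L g k := fun k => by
    rw [← mFourierCoeff_ofTorus hL hg.1]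
    refine integral_congr_ae ?_
    filter_upwards [hG.coeFn_toLp] with t ht
    rw [ht]
  have e2 : ∀ k, UnitAddTorus.mFourierCoeff hH.toLp k = coef L h k := fun k => by
    rw [← mFourierCoeff_ofTorus hL hh.1]
    refine integral_congr_ae ?_
    filter_upwards [hH.coeFn_toLp] with t ht
    rw [ht]
  simp only [e1, e2] at h1
  convert h1 using 1
  rw [← integral_ofTorus hL (F := fun x => conj (g x) * h x)
    ((Complex.continuous_conj.comp_aestronglyMeasurable hg.1).mul hh.1)]
  refine integral_congr_ae ?_
  filter_upwards [hG.coeFn_toLp, hH.coeFn_toLp] with t ht ht2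
  rw [ht, ht2]; rfl

/-- An `L²` function on the torus with an absolutely summable Fourier series is essentially
bounded. -/
lemma memLp_top_of_hasSum_mFourierLp {c : (Fin 3 → ℤ) → ℂ} (hs : Summable fun k => ‖c k‖)
    {G : Lp ℂ 2 (volume : Measure (UnitAddTorus (Fin 3)))}
    (hG : HasSum (fun k => c k • UnitAddTorus.mFourierLp 2 k) G) : MemLp G ∞ volume := by
  have h2 : Summable fun k => c k • UnitAddTorus.mFourier (d := Fin 3) k := by
    refine Summable.of_norm ?_
    simpa [norm_smul, UnitAddTorus.mFourier_norm] using hs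
  obtain ⟨F, hF⟩ := h2
  have : IsProbabilityMeasure (volume : Measure UnitAddCircle) :=
    inferInstanceAs (IsProbabilityMeasure AddCircle.haarAddCircle)
  have h3 := hF.mapL (ContinuousMap.toLp (E := ℂ) 2
    (volume : Measure (UnitAddTorus (Fin 3))) ℂ)
  have h3' : HasSum (fun k => c k • UnitAddTorus.mFourierLp 2 k) (ContinuousMap.toLp (E := ℂ) 2
    (volume : Measure (UnitAddTorus (Fin 3))) ℂ F) := by
    refine h3.congr_fun fun k => ?_
    exact (map_smul _ _ _).symm
  have h4 := hG.unique h3'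
  rw [h4]
  refine MemLp.ae_eq (ContinuousMap.coeFn_toLp _ F).symm ?_
  exact memLp_top_of_bound F.continuous.aestronglyMeasurable ‖F‖
    (Eventually.of_forall fun t => F.norm_coe_le_norm t)

/-- A function with absolutely summable Fourier coefficients is bounded. -/
theorem memLp_top_of_summable_coef (hL : 0 < L) {g : E3 → ℂ} (hg : MemLp g 2 (μQ L))
    (hs : Summable fun k => ‖coef L g k‖) : MemLp g ∞ (μQ L) := by
  have hG := memLp_ofTorus hL hg
  have e1 : ∀ k, UnitAddTorus.mFourierCoeff hG.toLp k = coef L g k := fun k => by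
    rw [← mFourierCoeff_ofTorus hL hg.1]
    refine integral_congr_ae ?_
    filter_upwards [hG.coeFn_toLp] with t ht
    rw [ht]
  have h1 := UnitAddTorus.hasSum_mFourier_series_L2 hG.toLp
  simp only [e1] at h1
  have h6 : MemLp (g ∘ ofTorus L) ∞ volume :=
    MemLp.ae_eq hG.coeFn_toLp (memLp_top_of_hasSum_mFourierLp hs h1)
  refine ⟨hg.1, ?_⟩
  have h7 := eLpNorm_comp_measurePreserving (p := ∞) (aestronglyMeasurable_smul_measure hg.1) (measurePreserving_ofTorus hL)
  have h8 := h6.2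
  rw [h7, eLpNorm_exponent_top] at h8
  rw [eLpNorm_exponent_top]
  exact lt_of_le_of_lt (eLpNormEssSup_mono_measure g
    (Measure.absolutelyContinuous_smul (by simpa using pow_pos hL 3))) h8

/-- The Riesz–Fischer theorem on the cell. -/
theorem exists_coef_eq (hL : 0 < L) {c : (Fin 3 → ℤ) → ℂ} (hc : Summable fun k => ‖c k‖ ^ 2) :
    ∃ g : E3 → ℂ, MemLp g 2 (μQ L) ∧ ∀ k, coef L g k = c k := by
  have hc' : Memℓp c 2 := by
    rw [memℓp_gen_iff (by norm_num)]
    simpa using hc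
  obtain ⟨G, hG⟩ := (UnitAddTorus.mFourierBasis (d := Fin 3)).repr.surjective ⟨c, hc'⟩
  have hMP := measurePreserving_ofTorus hL
  -- `toTorus` is measure preserving since it inverts `ofTorus`
  have hT : MeasurePreserving (toTorus L) (ENNReal.ofReal ((L ^ 3)⁻¹) • μQ L) volume := by
    refine ⟨measurable_toTorus, ?_⟩
    rw [← hMP.map_eq, Measure.map_map measurable_toTorus hMP.measurable]
    have : toTorus L ∘ ofTorus L = id := funext fun t => toTorus_ofTorus hL t
    rw [this, Measure.map_id]
  have h1 : MemLp (G ∘ toTorus L) 2 (ENNReal.ofReal ((L ^ 3)⁻¹) • μQ L) :=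
    (Lp.memLp G).comp_measurePreserving hT
  have hac : μQ L ≪ ENNReal.ofReal ((L ^ 3)⁻¹) • μQ L :=
    Measure.absolutelyContinuous_smul (by simpa using pow_pos hL 3)
  have hle : μQ L = ENNReal.ofReal (L ^ 3) • (ENNReal.ofReal ((L ^ 3)⁻¹) • μQ L) := by
    rw [smul_smul, ← ENNReal.ofReal_mul (by positivity), mul_inv_cancel₀ (by positivity)]
    simp
  have h2 : MemLp (G ∘ toTorus L) 2 (μQ L) := by
    rw [hle]; exact h1.smul_measure ENNReal.ofReal_ne_top
  refine ⟨_, h2, fun k => ?_⟩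
  rw [← mFourierCoeff_ofTorus hL h2.1, Function.comp_assoc]
  have : toTorus L ∘ ofTorus L = id := funext fun t => toTorus_ofTorus hL t
  rw [this, Function.comp_id, ← UnitAddTorus.mFourierBasis_repr, hG]

end

/-! ### Products and derivatives in Fourier variables -/

section

variable {L : ℝ}

/-- The Fourier coefficients of a product are the convolution of the Fourier coefficients. -/
theorem hasSum_coef_mul (hL : 0 < L) {g h : E3 → ℂ} (hg : MemLp g 2 (μQ L))
    (hh : MemLp h 2 (μQ L)) (k : Fin 3 → ℤ) :
    HasSum (fun l => coef L g (k - l) * coef L h l) (coef L (fun x => g x * h x) k) := by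
  have hg' : MemLp (fun x => conj (g x) * char L k x) 2 (μQ L) := by
    refine MemLp.of_le hg ((Complex.continuous_conj.comp_aestronglyMeasurable hg.1).mul
      (continuous_char k).aestronglyMeasurable) (Eventually.of_forall fun x => ?_)
    simp [norm_char]
  -- Parseval's identity, applied to `conj g` times a character
  have h1 := hasSum_coef hL hg' hh
  have e1 : ∀ l, conj (coef L (fun x => conj (g x) * char L k x) l) = coef L g (k - l) := by
    intro l
    rw [coef_eq, coef_eq, map_mul, Complex.conj_ofReal, ← integral_conj]
    congr 2
    funext x
    simp only [map_mul, Complex.conj_conj]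
    rw [sub_eq_neg_add, char_add, char_neg, map_mul, Complex.conj_conj]
    ring
  simp only [e1] at h1
  convert h1 using 1
  rw [coef_eq]
  congr 2
  funext x
  simp only [map_mul, Complex.conj_conj]
  ring

/-- The wave vector `2πk / L`. -/
def wave (L : ℝ) (k : Fin 3 → ℤ) (i : Fin 3) : ℝ := 2 * Real.pi * (k i : ℝ) / L

lemma wave_neg (k : Fin 3 → ℤ) (i : Fin 3) : wave L (-k) i = -wave L k i := by
  simp [wave, neg_div]

lemma char_eq_exp_wave (k : Fin 3 → ℤ) (x : E3) :
    char L k x = Complex.exp ((∑ j, wave L k j * x j : ℝ) * Complex.I) := by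
  simp only [char, wave, Fin.sum_univ_three]
  congr 3; ring

lemma hasFDerivAt_phase (k : Fin 3 → ℤ) (x : E3) :
    HasFDerivAt (fun x : E3 => ∑ j, wave L k j * x j)
      (∑ j, wave L k j • (EuclideanSpace.proj j : E3 →L[ℝ] ℝ)) x := by
  refine HasFDerivAt.fun_sum fun j _ => ?_
  exact ((EuclideanSpace.proj j : E3 →L[ℝ] ℝ).hasFDerivAt).const_mul (wave L k j)

lemma phase_deriv_e (k : Fin 3 → ℤ) (i : Fin 3) :
    (∑ j, wave L k j • (EuclideanSpace.proj j : E3 →L[ℝ] ℝ)) (e i) = wave L k i := by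
  rw [sum_apply, Finset.sum_eq_single i]
  · simp [e]
  · intro j _ hj
    simp [e, hj]
  · simp

lemma contDiff_char (k : Fin 3 → ℤ) : ContDiff ℝ ∞ (char L k) := by
  have : char L k = fun x => Complex.exp ((∑ j, wave L k j * x j : ℝ) * Complex.I) :=
    funext fun x => char_eq_exp_wave k x
  rw [this]
  have h0 : ContDiff ℝ ∞ fun x : E3 => ∑ j, wave L k j * x j :=
    ContDiff.sum fun j _ => by fun_prop
  have h : ContDiff ℝ ∞ fun x : E3 => ((∑ j, wave L k j * x j : ℝ) : ℂ) :=
    Complex.ofRealCLM.contDiff.comp h0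
  exact (h.mul contDiff_const).cexp

lemma fderiv_char (k : Fin 3 → ℤ) (x : E3) (i : Fin 3) :
    fderiv ℝ (char L k) x (e i) = Complex.I * wave L k i * char L k x := by
  have : char L k = fun x => Complex.exp ((∑ j, wave L k j * x j : ℝ) * Complex.I) :=
    funext fun x => char_eq_exp_wave k x
  have h1 := ((Complex.ofRealCLM.hasFDerivAt (x := ∑ j, wave L k j * x j)).comp x
    (hasFDerivAt_phase (L := L) k x)).mul_const Complex.I
  have h2 : HasFDerivAt (fun x : E3 => Complex.exp ((∑ j, wave L k j * x j : ℝ) * Complex.I)) _ x :=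
    h1.cexp
  rw [this, h2.fderiv]
  have h3 := phase_deriv_e (L := L) k i
  simp only [smul_apply, ContinuousLinearMap.comp_apply, h3, smul_eq_mul,
    Complex.ofRealCLM_apply]
  simp
  ring

lemma char_periodic (hL : 0 < L) (k : Fin 3 → ℤ) (i : Fin 3) (x : E3) :
    char L k (x + L • e i) = char L k x := by
  rw [char_eq_exp_wave, char_eq_exp_wave]
  have : ∑ j, wave L k j * (x + L • e i) j = ∑ j, wave L k j * x j + wave L k i * L := by
    simp only [PiLp.add_apply, PiLp.smul_apply, smul_eq_mul, mul_add, Finset.sum_add_distrib]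
    congr 1
    rw [Finset.sum_eq_single i]
    · simp [e]
    · intro j _ hj
      simp [e, hj]
    · simp
  rw [this, wave, div_mul_cancel₀ _ hL.ne']
  push_cast
  rw [add_mul, Complex.exp_add]
  have : Complex.exp (2 * Real.pi * (k i : ℂ) * Complex.I) = 1 := by
    rw [← Complex.exp_int_mul_two_pi_mul_I (k i)]
    congr 1; ring
  rw [this, mul_one]

/-- The integral over the cell of a derivative of a periodic function vanishes. -/
theorem integral_fderiv_cell (hL : 0 < L) {φ : E3 → ℂ} (hφ : ContDiff ℝ 1 φ) (i : Fin 3)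
    (hp : ∀ x, φ (x + L • e i) = φ x) : ∫ x in cell L, fderiv ℝ φ x (e i) = 0 := by
  have hcont : Continuous fun x => fderiv ℝ φ x (e i) :=
    (hφ.continuous_fderiv one_ne_zero).clm_apply continuous_const
  have hpre : cell L = WithLp.ofLp ⁻¹' Icc (fun _ : Fin 3 => (0 : ℝ)) fun _ => L := by
    ext x; simp [cell, Set.mem_Icc, Pi.le_def, forall_and]
  have hpre' : Icc (fun _ : Fin 3 => (0 : ℝ)) (fun _ => L)
      = (WithLp.toLp 2) ⁻¹' cell L := by
    ext x; simp [cell, Set.mem_Icc, Pi.le_def, forall_and]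
  have h1 : ∫ x in cell L, fderiv ℝ φ x (e i)
      = ∫ y in Icc (fun _ : Fin 3 => (0 : ℝ)) (fun _ => L),
          fderiv ℝ φ (WithLp.toLp 2 y) (e i) := by
    rw [hpre']
    exact ((PiLp.volume_preserving_toLp (Fin 3)).setIntegral_preimage_emb
      (MeasurableEquiv.toLp 2 (Fin 3 → ℝ)).measurableEmbedding
      (fun x => fderiv ℝ φ x (e i)) (cell L)).symm
  rw [h1]
  let T : (Fin 3 → ℝ) →L[ℝ] E3 := (PiLp.continuousLinearEquiv 2 ℝ fun _ : Fin 3 => ℝ).symm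
  have hT : ∀ y, T y = WithLp.toLp 2 y := fun y => rfl
  have hd : ∀ y : Fin 3 → ℝ, HasFDerivAt (fun y => φ (WithLp.toLp 2 y))
      ((fderiv ℝ φ (WithLp.toLp 2 y)).comp T) y := fun y =>
    (((hφ.differentiable one_ne_zero) _).hasFDerivAt).comp y T.hasFDerivAt
  -- the divergence theorem for the field with `i`-th component `φ` and all others zero
  have h2 := integral_divergence_of_hasFDerivAt_off_countable'
    (fun _ : Fin 3 => (0 : ℝ)) (fun _ => L) (fun _ => hL.le)
    (fun j y => if j = i then φ (WithLp.toLp 2 y) else 0)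
    (fun j y => if j = i then (fderiv ℝ φ (WithLp.toLp 2 y)).comp T else 0) ∅ countable_empty
    (fun j => by
      by_cases hj : j = i
      · simp only [hj, if_true]
        exact (hφ.continuous.comp (PiLp.continuous_toLp 2 _)).continuousOn
      · simp only [hj, if_false]; exact continuousOn_const)
    (fun y _ j => by
      by_cases hj : j = i
      · simp only [hj, if_true]
        exact hd y
      · simp only [hj, if_false]; exact hasFDerivAt_const _ _)
  have hsum : ∀ y : Fin 3 → ℝ, ∑ j, (if j = i then (fderiv ℝ φ (WithLp.toLp 2 y)).comp T
      else 0 : (Fin 3 → ℝ) →L[ℝ] ℂ) (Pi.single j 1) = fderiv ℝ φ (WithLp.toLp 2 y) (e i) := by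
    intro y
    rw [Finset.sum_eq_single i]
    · simp [hT, e]
    · intro j _ hj
      simp [hj]
    · simp
  simp only [hsum] at h2
  rw [h2]
  · refine Finset.sum_eq_zero fun j _ => ?_
    by_cases hj : j = i
    · subst hj
      simp only [if_true]
      rw [sub_eq_zero]
      congr 1
      funext y
      rw [← hp (WithLp.toLp 2 (Fin.insertNth j 0 y))]
      congr 1
      ext l
      refine Fin.succAboveCases j ?_ (fun l => ?_) l
      · simp [e]
      · simp [e, Fin.succAbove_ne]
    · simp [hj]
  · exact (hcont.comp (PiLp.continuous_toLp 2 _)).continuousOn.integrableOn_compact isCompact_Icc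

/-- Differentiation of a smooth periodic function multiplies its Fourier coefficients by `iκ`. -/
theorem coef_fderiv (hL : 0 < L) {φ : E3 → ℂ} (hφ : ContDiff ℝ 1 φ) (i : Fin 3)
    (hp : ∀ x, φ (x + L • e i) = φ x) (k : Fin 3 → ℤ) :
    coef L (fun x => fderiv ℝ φ x (e i)) k = Complex.I * wave L k i * coef L φ k := by
  have hc : ContDiff ℝ 1 (char L (-k)) := (contDiff_char (-k)).of_le (by simp)
  have h0 := integral_fderiv_cell hL (hφ.mul hc) i fun x => by
    rw [hp, char_periodic hL]
  have h1 : ∀ x, fderiv ℝ (fun x => φ x * char L (-k) x) x (e i) =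
      fderiv ℝ φ x (e i) * char L (-k) x
        - Complex.I * wave L k i * (φ x * char L (-k) x) := by
    intro x
    rw [fderiv_fun_mul ((hφ.differentiable one_ne_zero) x) ((hc.differentiable one_ne_zero) x)]
    simp only [add_apply, smul_apply, fderiv_char,
      wave_neg, smul_eq_mul]
    push_cast; ring
  simp only [h1] at h0
  have i1 : IntegrableOn (fun x => fderiv ℝ φ x (e i) * char L (-k) x) (cell L) :=
    (((hφ.continuous_fderiv one_ne_zero).clm_apply continuous_const).mul
      (continuous_char _)).continuousOn.integrableOn_compact isCompact_cell
  have i2 : IntegrableOn (fun x => Complex.I * wave L k i * (φ x * char L (-k) x)) (cell L) :=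
    (continuous_const.mul (hφ.continuous.mul (continuous_char _))).continuousOn.integrableOn_compact
      isCompact_cell
  rw [integral_sub i1 i2, sub_eq_zero, integral_const_mul] at h0
  rw [coef_eq, coef_eq]
  simp only [← char_neg]
  rw [h0]; ring

end

/-! ### Fourier coefficients of vector fields -/

section

variable {L : ℝ}

lemma memLp_comp (u : L2 L) (i : Fin 3) : MemLp (fun x => (u x i : ℂ)) 2 (μQ L) :=
  ((Lp.memLp u).eval_piLp i).ofReal

lemma memLp_real_comp (u : L2 L) (i : Fin 3) : MemLp (fun x => u x i) 2 (μQ L) :=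
  (Lp.memLp u).eval_piLp i

lemma memLp_of_continuous {F : Type*} [NormedAddCommGroup F] {φ : E3 → F} {p : ℝ≥0∞}
    (hφ : Continuous φ) : MemLp φ p (μQ L) := by
  obtain ⟨C, hC⟩ := isCompact_cell.exists_bound_of_continuousOn (s := cell L) hφ.continuousOn
  exact MemLp.of_bound hφ.aestronglyMeasurable C
    ((ae_restrict_mem measurableSet_cell).mono fun x hx => hC x hx)

lemma integral_inner_eq_sum {u v : E3 → E3} (hu : MemLp u 2 (μQ L)) (hv : MemLp v 2 (μQ L)) :
    ((∫ x in cell L, ⟪u x, v x⟫ : ℝ) : ℂ)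
      = ∑ i, ∫ x in cell L, conj (u x i : ℂ) * (v x i : ℂ) := by
  have h : ∀ x, ((⟪u x, v x⟫ : ℝ) : ℂ) = ∑ i, conj (u x i : ℂ) * (v x i : ℂ) := fun x => by
    rw [PiLp.inner_apply]
    push_cast
    refine Finset.sum_congr rfl fun i _ => ?_
    simp [mul_comm]
  rw [← integral_complex_ofReal, ← integral_finsetSum]
  · exact integral_congr_ae (Eventually.of_forall h)
  · intro i _
    have h1 : MemLp (fun x => conj (u x i : ℂ)) 2 (μQ L) := by
      simpa using (hu.eval_piLp i).ofReal (K := ℂ)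
    exact h1.integrable_mul ((hv.eval_piLp i).ofReal)

/-- Parseval's identity for vector fields. -/
theorem hasSum_inner_field (hL : 0 < L) {u v : E3 → E3} (hu : MemLp u 2 (μQ L))
    (hv : MemLp v 2 (μQ L)) :
    HasSum (fun k => ∑ i, conj (coef L (fun x => (u x i : ℂ)) k) * coef L (fun x => (v x i : ℂ)) k)
      (((L ^ 3)⁻¹ * ∫ x in cell L, ⟪u x, v x⟫ : ℝ) : ℂ) := by
  rw [Complex.ofReal_mul, integral_inner_eq_sum hu hv, Finset.mul_sum]
  exact hasSum_sum fun i _ => hasSum_coef hL (hu.eval_piLp i).ofReal (hv.eval_piLp i).ofReal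

theorem hasSum_inner (hL : 0 < L) (u v : L2 L) :
    HasSum (fun k => ∑ i, conj (fourierCoeff L u k i) * fourierCoeff L v k i)
      (((L ^ 3)⁻¹ * ⟪u, v⟫ : ℝ) : ℂ) := by
  rw [L2.inner_def]
  exact hasSum_inner_field hL (Lp.memLp u) (Lp.memLp v)

/-- Parseval's identity for the norm of `[L²(Q)]³`. -/
theorem hasSum_norm_sq (hL : 0 < L) (u : L2 L) :
    HasSum (fun k => L ^ 3 * ∑ i, ‖fourierCoeff L u k i‖ ^ 2) (‖u‖ ^ 2) := by
  have h := (hasSum_inner hL u u)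
  have h2 : ∀ k, ∑ i, conj (fourierCoeff L u k i) * fourierCoeff L u k i
      = ((∑ i, ‖fourierCoeff L u k i‖ ^ 2 : ℝ) : ℂ) := fun k => by
    push_cast
    exact Finset.sum_congr rfl fun i _ => by rw [Complex.conj_mul']
  simp only [h2] at h
  have h3 := (Complex.hasSum_ofReal.mp h).mul_left (L ^ 3)
  rwa [mul_inv_cancel_left₀ (by positivity), real_inner_self_eq_norm_sq] at h3

/-- An `L²` vector field is determined by its Fourier coefficients. -/
theorem ext_fourierCoeff (hL : 0 < L) {u v : L2 L}
    (h : ∀ k i, fourierCoeff L u k i = fourierCoeff L v k i) : u = v := by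
  rw [← sub_eq_zero, ← inner_self_eq_zero (𝕜 := ℝ), inner_sub_left, sub_eq_zero]
  have h1 := hasSum_inner hL u (u - v)
  have h2 := hasSum_inner hL v (u - v)
  simp only [h] at h1
  have h3 := h1.unique h2
  norm_cast at h3
  exact mul_left_cancel₀ (by positivity) h3

lemma coef_congr_ae {g h : E3 → ℂ} (hgh : g =ᵐ[μQ L] h) (k : Fin 3 → ℤ) :
    coef L g k = coef L h k := by
  rw [coef_eq, coef_eq]
  congr 1
  refine integral_congr_ae ?_
  filter_upwards [hgh] with x hx
  rw [hx]

lemma fourierCoeff_congr_ae {u : L2 L} {φ : E3 → E3} (h : u =ᵐ[μQ L] φ) (k : Fin 3 → ℤ)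
    (i : Fin 3) : fourierCoeff L u k i = coef L (fun x => (φ x i : ℂ)) k := by
  rw [fourierCoeff_eq_coef]
  refine coef_congr_ae ?_ k
  filter_upwards [h] with x hx
  rw [hx]

lemma coef_neg (f : E3 → ℝ) (k : Fin 3 → ℤ) :
    coef L (fun x => (f x : ℂ)) (-k) = conj (coef L (fun x => (f x : ℂ)) k) := by
  rw [coef_eq, coef_eq, map_mul, Complex.conj_ofReal, ← integral_conj]
  congr 2
  funext x
  rw [char_neg]; simp

lemma integrable_mul_conj_char {g : E3 → ℂ} (hg : MemLp g 2 (μQ L)) (k : Fin 3 → ℤ) :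
    Integrable (fun x => g x * conj (char L k x)) (μQ L) := by
  refine (hg.integrable (by norm_num)).mul_bdd (c := 1)
    (Complex.continuous_conj.comp (continuous_char k)).aestronglyMeasurable
    (Eventually.of_forall fun x => ?_)
  simp [norm_char]

lemma coef_add {g h : E3 → ℂ} (hg : MemLp g 2 (μQ L)) (hh : MemLp h 2 (μQ L)) (k : Fin 3 → ℤ) :
    coef L (fun x => g x + h x) k = coef L g k + coef L h k := by
  simp only [coef_eq, add_mul]
  rw [integral_add (integrable_mul_conj_char hg k) (integrable_mul_conj_char hh k), mul_add]

lemma coef_const_mul (a : ℂ) (g : E3 → ℂ) (k : Fin 3 → ℤ) :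
    coef L (fun x => a * g x) k = a * coef L g k := by
  simp only [coef_eq, mul_assoc]
  rw [integral_const_mul]; ring

lemma coef_conj (g : E3 → ℂ) (k : Fin 3 → ℤ) :
    coef L (fun x => conj (g x)) k = conj (coef L g (-k)) := by
  rw [coef_eq, coef_eq, map_mul, Complex.conj_ofReal, ← integral_conj]
  congr 2
  funext x
  rw [char_neg]; simp

lemma coef_sum {ι : Type*} (s : Finset ι) {g : ι → E3 → ℂ} (hg : ∀ i ∈ s, MemLp (g i) 2 (μQ L))
    (k : Fin 3 → ℤ) : coef L (fun x => ∑ i ∈ s, g i x) k = ∑ i ∈ s, coef L (g i) k := by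
  simp only [coef_eq, Finset.sum_mul]
  rw [integral_finsetSum _ fun i hi => integrable_mul_conj_char (hg i hi) k, Finset.mul_sum]

lemma fourierCoeff_add (u v : L2 L) (k : Fin 3 → ℤ) (i : Fin 3) :
    fourierCoeff L (u + v) k i = fourierCoeff L u k i + fourierCoeff L v k i := by
  simp only [fourierCoeff_eq_coef]
  rw [← coef_add (memLp_comp u i) (memLp_comp v i)]
  refine coef_congr_ae ?_ k
  filter_upwards [Lp.coeFn_add u v] with x hx
  rw [hx]; simp

lemma fourierCoeff_smul (a : ℝ) (u : L2 L) (k : Fin 3 → ℤ) (i : Fin 3) :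
    fourierCoeff L (a • u) k i = a * fourierCoeff L u k i := by
  simp only [fourierCoeff_eq_coef]
  rw [← coef_const_mul]
  refine coef_congr_ae ?_ k
  filter_upwards [Lp.coeFn_smul a u] with x hx
  rw [hx]; simp

lemma fourierCoeff_neg (u : L2 L) (k : Fin 3 → ℤ) (i : Fin 3) :
    fourierCoeff L u (-k) i = conj (fourierCoeff L u k i) :=
  coef_neg (fun x => u x i) k

/-- The `k`-th Fourier coefficient of the `i`-th component, as a linear functional. -/
def fourierCoeffₗ (L : ℝ) (k : Fin 3 → ℤ) (i : Fin 3) : L2 L →ₗ[ℝ] ℂ where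
  toFun u := fourierCoeff L u k i
  map_add' u v := fourierCoeff_add u v k i
  map_smul' a u := by simp [fourierCoeff_smul]

lemma norm_fourierCoeff_sq_le (hL : 0 < L) (u : L2 L) (k : Fin 3 → ℤ) (i : Fin 3) :
    L ^ 3 * ‖fourierCoeff L u k i‖ ^ 2 ≤ ‖u‖ ^ 2 := by
  have h := hasSum_norm_sq hL u
  refine le_trans ?_ (le_hasSum h k fun j _ => by positivity)
  gcongr
  exact Finset.single_le_sum (f := fun i => ‖fourierCoeff L u k i‖ ^ 2)
    (fun j _ => by positivity) (Finset.mem_univ i)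

lemma continuous_fourierCoeff (hL : 0 < L) (k : Fin 3 → ℤ) (i : Fin 3) :
    Continuous fun u : L2 L => fourierCoeff L u k i := by
  refine AddMonoidHomClass.continuous_of_bound (fourierCoeffₗ L k i)
    (Real.sqrt (L ^ 3))⁻¹ fun u => ?_
  have h := norm_fourierCoeff_sq_le hL u k i
  have h1 : 0 < Real.sqrt (L ^ 3) := Real.sqrt_pos.mpr (by positivity)
  rw [← div_eq_inv_mul, le_div_iff₀ h1]
  refine le_of_sq_le_sq ?_ (norm_nonneg _)
  rw [mul_pow, Real.sq_sqrt (by positivity)]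
  simpa [fourierCoeffₗ, mul_comm] using h

/-! ### Weak derivatives -/

/-- Weak differentiation multiplies the Fourier coefficients by `iκ`. -/
theorem isWeakPartial_iff (hL : 0 < L) (i : Fin 3) (v g : L2 L) : IsWeakPartial L i v g ↔
    ∀ k l, fourierCoeff L g k l = Complex.I * wave L k i * fourierCoeff L v k l := by
  constructor
  · intro h k l
    -- test with the real and imaginary parts of the conjugate character
    have key : ∀ ρ : E3 → ℝ, ContDiff ℝ ∞ ρ → (∀ i x, ρ (x + L • e i) = ρ x) →
        ∫ x in cell L, v x l * fderiv ℝ ρ x (e i) = -∫ x in cell L, g x l * ρ x := by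
      intro ρ hρ hp
      have h1 := h (fun x => ρ x • e l) (hρ.smul contDiff_const) (fun j x => by simp only [hp])
      have h2 : ∀ x, fderiv ℝ (fun x => ρ x • e l) x (e i) = fderiv ℝ ρ x (e i) • e l := by
        intro x
        rw [fderiv_smul_const (hρ.differentiable (by simp) x)]
        simp
      have h3 : ∀ (a : E3) (b : ℝ), ⟪a, b • e l⟫ = a l * b := by
        intro a b
        rw [inner_smul_right, e, EuclideanSpace.inner_single_right]
        simp [mul_comm]
      simpa only [h2, h3] using h1
    have hsm := contDiff_char (L := L) (-k)
    have hre : ContDiff ℝ ∞ fun x => (char L (-k) x).re := Complex.reCLM.contDiff.comp hsm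
    have him : ContDiff ℝ ∞ fun x => (char L (-k) x).im := Complex.imCLM.contDiff.comp hsm
    have kre := key _ hre fun j x => by rw [char_periodic hL]
    have kim := key _ him fun j x => by rw [char_periodic hL]
    have dre : ∀ x, fderiv ℝ (fun x => (char L (-k) x).re) x (e i)
        = (Complex.I * wave L (-k) i * char L (-k) x).re := fun x => by
      have h1 := (Complex.reCLM.hasFDerivAt (x := char L (-k) x)).comp x
        (hsm.differentiable (by simp) x).hasFDerivAt
      have h2 : HasFDerivAt (fun x => (char L (-k) x).re) _ x := h1
      rw [h2.fderiv, ← fderiv_char]; rfl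
    have dim : ∀ x, fderiv ℝ (fun x => (char L (-k) x).im) x (e i)
        = (Complex.I * wave L (-k) i * char L (-k) x).im := fun x => by
      have h1 := (Complex.imCLM.hasFDerivAt (x := char L (-k) x)).comp x
        (hsm.differentiable (by simp) x).hasFDerivAt
      have h2 : HasFDerivAt (fun x => (char L (-k) x).im) _ x := h1
      rw [h2.fderiv, ← fderiv_char]; rfl
    simp only [dre] at kre
    simp only [dim] at kim
    have ig := integrable_mul_conj_char (memLp_comp g l) k
    have iv := integrable_mul_conj_char (memLp_comp v l) k
    have hcomb : ∫ x in cell L, (g x l : ℂ) * conj (char L k x)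
        = Complex.I * wave L k i * ∫ x in cell L, (v x l : ℂ) * conj (char L k x) := by
      apply Complex.ext
      · have e1 := integral_re ig
        have e2 := integral_re (iv.const_mul (Complex.I * wave L k i))
        rw [integral_const_mul] at e2
        simp only [RCLike.re_to_complex] at e1 e2
        rw [← e1, ← e2]
        have e3 : ∀ x, ((g x l : ℂ) * conj (char L k x)).re = g x l * (char L (-k) x).re := by
          intro x; rw [Complex.re_ofReal_mul, char_neg]
        have e4 : ∀ x, (Complex.I * wave L k i * ((v x l : ℂ) * conj (char L k x))).re
            = -(v x l * (Complex.I * wave L (-k) i * char L (-k) x).re) := by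
          intro x
          rw [char_neg, wave_neg]
          simp
          ring
        simp only [e3, e4]
        rw [integral_neg, kre, neg_neg]
      · have e1 := integral_im ig
        have e2 := integral_im (iv.const_mul (Complex.I * wave L k i))
        rw [integral_const_mul] at e2
        simp only [RCLike.im_to_complex] at e1 e2
        rw [← e1, ← e2]
        have e3 : ∀ x, ((g x l : ℂ) * conj (char L k x)).im = g x l * (char L (-k) x).im := by
          intro x; rw [Complex.im_ofReal_mul, char_neg]
        have e4 : ∀ x, (Complex.I * wave L k i * ((v x l : ℂ) * conj (char L k x))).im
            = -(v x l * (Complex.I * wave L (-k) i * char L (-k) x).im) := by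
          intro x
          rw [char_neg, wave_neg]
          simp
          ring
        simp only [e3, e4]
        rw [integral_neg, kim, neg_neg]
    rw [fourierCoeff_eq_coef, fourierCoeff_eq_coef, coef_eq, coef_eq, hcomb]
    ring
  · intro h ψ hψ hp
    have hψ2 : MemLp ψ 2 (μQ L) :=
      memLp_of_continuous hψ.continuous
    have hd : Continuous fun x => fderiv ℝ ψ x (e i) :=
      (hψ.continuous_fderiv (by simp)).clm_apply continuous_const
    have hdψ2 : MemLp (fun x => fderiv ℝ ψ x (e i)) 2 (μQ L) :=
      memLp_of_continuous hd
    have h1 := hasSum_inner_field hL (Lp.memLp v) hdψ2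
    have h2 := hasSum_inner_field hL (Lp.memLp g) hψ2
    have hc : ∀ k l, coef L (fun x => ((fderiv ℝ ψ x (e i)) l : ℂ)) k
        = Complex.I * wave L k i * coef L (fun x => (ψ x l : ℂ)) k := by
      intro k l
      let P : E3 →L[ℝ] ℂ := Complex.ofRealCLM.comp (EuclideanSpace.proj l)
      have hs : ContDiff ℝ 1 fun x => P (ψ x) := P.contDiff.comp (hψ.of_le (by simp))
      have := coef_fderiv hL hs i (fun x => by rw [hp]) k
      rw [← show (fun x => P (ψ x)) = fun x => (ψ x l : ℂ) from rfl, ← this]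
      congr 1
      funext x
      have h2 : HasFDerivAt (fun x => P (ψ x)) (P.comp (fderiv ℝ ψ x)) x :=
        P.hasFDerivAt.comp x (hψ.differentiable (by simp) x).hasFDerivAt
      rw [h2.fderiv]; rfl
    have h3 := h2.neg
    have h4 : ∀ k, -(∑ l, conj (coef L (fun x => (g x l : ℂ)) k) * coef L (fun x => (ψ x l : ℂ)) k)
        = ∑ l, conj (coef L (fun x => (v x l : ℂ)) k)
          * coef L (fun x => ((fderiv ℝ ψ x (e i)) l : ℂ)) k := by
      intro k
      rw [← Finset.sum_neg_distrib]
      refine Finset.sum_congr rfl fun l _ => ?_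
      have := h k l
      rw [fourierCoeff_eq_coef, fourierCoeff_eq_coef] at this
      rw [this, hc]
      simp
      ring
    simp only [h4] at h3
    have h5 := h1.unique h3
    norm_cast at h5
    rw [← mul_neg] at h5
    exact mul_left_cancel₀ (by positivity) h5

/-- A field all of whose Fourier coefficients `iκᵢ v̂(k)` are square summable has a weak partial
derivative. -/
theorem exists_isWeakPartial (hL : 0 < L) (i : Fin 3) (v : L2 L)
    (h : ∀ l, Summable fun k => (wave L k i * ‖fourierCoeff L v k l‖) ^ 2) :
    ∃ g, IsWeakPartial L i v g := by
  have h1 : ∀ l, ∃ g : E3 → ℂ, MemLp g 2 (μQ L) ∧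
      ∀ k, coef L g k = Complex.I * wave L k i * fourierCoeff L v k l := fun l => by
    refine exists_coef_eq hL ?_
    convert h l using 2 with k
    simp [mul_pow]
  choose G hG hGc using h1
  have hR : MemLp (fun x => WithLp.toLp 2 fun l => (G l x).re : E3 → E3) 2 (μQ L) :=
    MemLp.of_eval_piLp fun l => (hG l).re
  refine ⟨hR.toLp, (isWeakPartial_iff hL i v _).2 fun k l => ?_⟩
  rw [fourierCoeff_congr_ae hR.coeFn_toLp]
  -- the sequence `iκᵢ v̂(k)` is conjugate symmetric, so taking real parts changes nothing
  have e1 : ∀ x, (((WithLp.toLp 2 fun l => (G l x).re : E3) l : ℝ) : ℂ)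
      = (1 / 2 : ℂ) * (G l x + conj (G l x)) := fun x => by
    rw [Complex.add_conj]; simp
  have hc : MemLp (fun x => conj (G l x)) 2 (μQ L) := (hG l).star
  simp only [e1]
  rw [coef_const_mul, coef_add (hG l) hc, coef_conj, hGc, hGc, fourierCoeff_neg, wave_neg]
  simp
  ring

theorem fourierCoeff_weakPartial (hL : 0 < L) (i : Fin 3) (v : L2 L)
    (h : ∀ l, Summable fun k => (wave L k i * ‖fourierCoeff L v k l‖) ^ 2) (k : Fin 3 → ℤ)
    (l : Fin 3) : fourierCoeff L (weakPartial L i v) k l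
      = Complex.I * wave L k i * fourierCoeff L v k l := by
  have h1 := exists_isWeakPartial hL i v h
  rw [weakPartial, dif_pos h1]
  exact (isWeakPartial_iff hL i v _).1 h1.choose_spec k l

end

/-! ### The space `H` and the eigenfunctions of the Stokes operator in Fourier variables -/

section

variable {L : ℝ}

/-- The square `|2πk / L|²` of the length of the wave vector. -/
def waveSq (L : ℝ) (k : Fin 3 → ℤ) : ℝ := ∑ j, wave L k j ^ 2

lemma waveSq_nonneg (k : Fin 3 → ℤ) : 0 ≤ waveSq L k := Finset.sum_nonneg fun _ _ => sq_nonneg _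

lemma waveSq_zero : waveSq L 0 = 0 := by simp [waveSq, wave]

lemma wave_sq_le (k : Fin 3 → ℤ) (i : Fin 3) : wave L k i ^ 2 ≤ waveSq L k :=
  Finset.single_le_sum (f := fun i => wave L k i ^ 2) (fun _ _ => sq_nonneg _) (Finset.mem_univ i)

lemma exists_wave_ne_zero (hL : 0 < L) {k : Fin 3 → ℤ} (hk : k ≠ 0) : ∃ i, wave L k i ≠ 0 := by
  obtain ⟨i, hi⟩ := Function.ne_iff.mp hk
  refine ⟨i, ?_⟩
  have : (k i : ℝ) ≠ 0 := by exact_mod_cast hi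
  have := Real.pi_pos
  unfold wave
  positivity

lemma waveSq_ge {k : Fin 3 → ℤ} (hk : k ≠ 0) : (2 * Real.pi / L) ^ 2 ≤ waveSq L k := by
  obtain ⟨i, hi⟩ := Function.ne_iff.mp hk
  refine le_trans ?_ (wave_sq_le k i)
  have h1 : (1 : ℝ) ≤ (k i : ℝ) ^ 2 := by
    have : (1 : ℤ) ≤ (k i) ^ 2 := by
      have := sq_pos_of_ne_zero (show k i ≠ 0 from hi)
      omega
    exact_mod_cast this
  have h2 : wave L k i ^ 2 = (2 * Real.pi / L) ^ 2 * (k i : ℝ) ^ 2 := by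
    unfold wave; ring
  rw [h2]
  exact le_mul_of_one_le_right (sq_nonneg _) h1

lemma waveSq_pos (hL : 0 < L) {k : Fin 3 → ℤ} (hk : k ≠ 0) : 0 < waveSq L k :=
  lt_of_lt_of_le (by have := Real.pi_pos; positivity) (waveSq_ge hk)

lemma char_zero (x : E3) : char L 0 x = 1 := by simp [char]

/-- A bounded functional that vanishes on the test fields vanishes on `H`. -/
lemma H_le_ker {F : Type*} [NormedAddCommGroup F] [NormedSpace ℝ F] (f : L2 L →L[ℝ] F)
    (h : ∀ φ, IsTestField L φ → ∀ v : L2 L, v =ᵐ[μQ L] φ → f v = 0) {u : L2 L} (hu : u ∈ H L) :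
    f u = 0 := by
  have h1 : H L ≤ LinearMap.ker f.toLinearMap := by
    refine Submodule.topologicalClosure_minimal _ ?_ f.isClosed_ker
    rw [Submodule.span_le]
    rintro v ⟨φ, hφ, hv⟩
    exact h φ hφ v hv
  exact h1 hu

/-- Fourier coefficients as continuous linear functionals. -/
def fourierCoeffL (hL : 0 < L) (k : Fin 3 → ℤ) (i : Fin 3) : L2 L →L[ℝ] ℂ :=
  ⟨fourierCoeffₗ L k i, continuous_fourierCoeff hL k i⟩

lemma fourierCoeffL_apply (hL : 0 < L) (k : Fin 3 → ℤ) (i : Fin 3) (u : L2 L) :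
    fourierCoeffL hL k i u = fourierCoeff L u k i := rfl

/-- The elements of `H` have zero average. -/
lemma fourierCoeff_zero_of_mem (hL : 0 < L) {u : L2 L} (hu : u ∈ H L) (i : Fin 3) :
    fourierCoeff L u 0 i = 0 := by
  refine H_le_ker (fourierCoeffL hL 0 i) (fun φ hφ v hv => ?_) hu
  rw [fourierCoeffL_apply, fourierCoeff_congr_ae hv, coef_eq]
  simp only [char_zero, map_one, mul_one]
  have hi : Integrable φ (μQ L) :=
    (memLp_of_continuous (p := 1) hφ.smooth.continuous).integrable le_rfl
  have h1 := ContinuousLinearMap.integral_comp_comm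
    (Complex.ofRealCLM.comp (EuclideanSpace.proj i : E3 →L[ℝ] ℝ)) hi
  rw [hφ.mean_zero, map_zero] at h1
  simp only [ContinuousLinearMap.comp_apply] at h1
  rw [show (∫ x in cell L, ((φ x i : ℝ) : ℂ)) = 0 from h1, mul_zero]

/-- The elements of `H` are divergence free. -/
lemma fourierCoeff_div_of_mem (hL : 0 < L) {u : L2 L} (hu : u ∈ H L) (k : Fin 3 → ℤ) :
    ∑ i, (wave L k i : ℂ) * fourierCoeff L u k i = 0 := by
  have h1 := H_le_ker (∑ i, wave L k i • fourierCoeffL hL k i) (fun φ hφ v hv => ?_) hu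
  · simpa [fourierCoeffL_apply, sum_apply] using h1
  · simp only [sum_apply, smul_apply, fourierCoeffL_apply, fourierCoeff_congr_ae hv,
      Complex.real_smul]
    let P : Fin 3 → E3 →L[ℝ] ℂ := fun l => Complex.ofRealCLM.comp (EuclideanSpace.proj l)
    have hs : ∀ l, ContDiff ℝ 1 fun x => P l (φ x) := fun l =>
      (P l).contDiff.comp (hφ.smooth.of_le (by simp))
    have hc : ∀ i, Complex.I * wave L k i * coef L (fun x => (φ x i : ℂ)) k
        = coef L (fun x => ((fderiv ℝ φ x (e i)) i : ℂ)) k := by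
      intro i
      rw [← show (fun x => P i (φ x)) = fun x => (φ x i : ℂ) from rfl,
        ← coef_fderiv hL (hs i) i (fun x => by rw [hφ.periodic]) k]
      congr 1
      funext x
      have h2 : HasFDerivAt (fun x => P i (φ x)) ((P i).comp (fderiv ℝ φ x)) x :=
        (P i).hasFDerivAt.comp x (hφ.smooth.differentiable (by simp) x).hasFDerivAt
      rw [h2.fderiv]; rfl
    have hd : ∀ i, Continuous fun x => ((fderiv ℝ φ x (e i)) i : ℂ) := fun i =>
      (P i).continuous.comp ((hφ.smooth.continuous_fderiv (by simp)).clm_apply continuous_const)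
    have h3 : coef L (fun x => ∑ i, ((fderiv ℝ φ x (e i)) i : ℂ)) k = 0 := by
      have : (fun x => ∑ i, ((fderiv ℝ φ x (e i)) i : ℂ)) = fun _ => 0 := funext fun x => by
        exact_mod_cast hφ.div_free x
      rw [this, coef_eq]; simp
    rw [coef_sum _ fun i _ => memLp_of_continuous (hd i)] at h3
    simp only [← hc, mul_assoc, ← Finset.mul_sum] at h3
    exact (mul_eq_zero.mp h3).resolve_left Complex.I_ne_zero

/-- The real vector field `Re (a exp (2πi k·x / L))`; for `k ≠ 0` and `a ⟂ k` it is a test field, and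
pairing with it reads off the Fourier coefficients of an element of `H`. -/
def modeField (L : ℝ) (k : Fin 3 → ℤ) (a : Fin 3 → ℂ) (x : E3) : E3 :=
  WithLp.toLp 2 fun i => (a i * char L k x).re

lemma contDiff_modeField (k : Fin 3 → ℤ) (a : Fin 3 → ℂ) : ContDiff ℝ ∞ (modeField L k a) := by
  rw [contDiff_euclidean]
  intro i
  exact Complex.reCLM.contDiff.comp (contDiff_const.mul (contDiff_char k))

lemma integral_char (hL : 0 < L) {k : Fin 3 → ℤ} (hk : k ≠ 0) : ∫ x in cell L, char L k x = 0 := by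
  obtain ⟨i, hi⟩ := exists_wave_ne_zero hL hk
  have h := integral_fderiv_cell hL ((contDiff_char (L := L) k).of_le (by simp)) i
    fun x => char_periodic hL k i x
  simp only [fderiv_char] at h
  rw [integral_const_mul] at h
  refine (mul_eq_zero.mp h).resolve_left ?_
  exact mul_ne_zero Complex.I_ne_zero (by exact_mod_cast hi)

lemma isTestField_modeField (hL : 0 < L) {k : Fin 3 → ℤ} (hk : k ≠ 0) {a : Fin 3 → ℂ}
    (ha : ∑ i, (wave L k i : ℂ) * a i = 0) : IsTestField L (modeField L k a) where
  smooth := contDiff_modeField k a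
  periodic i x := by simp only [modeField, char_periodic hL]
  div_free x := by
    have h1 : ∀ i, (fderiv ℝ (modeField L k a) x (e i)) i
        = (Complex.I * char L k x * (wave L k i * a i)).re := by
      intro i
      have h2 : HasFDerivAt (fun x => modeField L k a x i)
          ((EuclideanSpace.proj i : E3 →L[ℝ] ℝ).comp (fderiv ℝ (modeField L k a) x)) x :=
        (EuclideanSpace.proj i : E3 →L[ℝ] ℝ).hasFDerivAt.comp x
          ((contDiff_modeField k a).differentiable (by simp) x).hasFDerivAt
      have h3 : HasFDerivAt (fun x => modeField L k a x i)
          (Complex.reCLM.comp (a i • fderiv ℝ (char L k) x)) x :=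
        Complex.reCLM.hasFDerivAt.comp x
          (((contDiff_char k).differentiable (by simp) x).hasFDerivAt.const_mul (a i))
      have h4 := congrArg (fun T : E3 →L[ℝ] ℝ => T (e i)) (h2.unique h3)
      simp only [ContinuousLinearMap.comp_apply, smul_apply, fderiv_char] at h4
      refine (show _ = _ from h4).trans ?_
      rw [Complex.reCLM_apply, smul_eq_mul]
      congr 1; ring
    simp only [h1, ← Complex.re_sum, ← Finset.mul_sum, ha]
    simp
  mean_zero := by
    have hi : Integrable (modeField L k a) (μQ L) :=
      (memLp_of_continuous (p := 1) (contDiff_modeField k a).continuous).integrable le_rfl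
    ext i
    have h1 := ContinuousLinearMap.integral_comp_comm (EuclideanSpace.proj i : E3 →L[ℝ] ℝ) hi
    refine (show _ = _ from h1.symm).trans ?_
    have hi2 : Integrable (fun x => a i * char L k x) (μQ L) :=
      (memLp_of_continuous (p := 1) (continuous_const.mul (continuous_char k))).integrable le_rfl
    have h2 := integral_re hi2
    rw [integral_const_mul, integral_char hL hk] at h2
    simpa [modeField] using h2

/-- The `L²` class of a mode field. -/
def modeLp (L : ℝ) (k : Fin 3 → ℤ) (a : Fin 3 → ℂ) : L2 L :=
  (memLp_of_continuous (p := 2) (contDiff_modeField (L := L) k a).continuous).toLp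

lemma modeLp_mem (hL : 0 < L) {k : Fin 3 → ℤ} (hk : k ≠ 0) {a : Fin 3 → ℂ}
    (ha : ∑ i, (wave L k i : ℂ) * a i = 0) : modeLp L k a ∈ H L :=
  Submodule.le_topologicalClosure _ (Submodule.subset_span
    ⟨_, isTestField_modeField hL hk ha, MemLp.coeFn_toLp _⟩)

lemma inner_modeLp (hL : 0 < L) (k : Fin 3 → ℤ) (a : Fin 3 → ℂ) (u : L2 L) :
    ⟪u, modeLp L k a⟫ = L ^ 3 * (∑ i, conj (fourierCoeff L u k i) * a i).re := by
  have h0 : ⟪u, modeLp L k a⟫ = ∫ x in cell L, ∑ i, ((u x i : ℂ) * (a i * char L k x)).re := by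
    rw [L2.inner_def]
    refine integral_congr_ae ?_
    filter_upwards [MemLp.coeFn_toLp
      (memLp_of_continuous (p := 2) (contDiff_modeField (L := L) k a).continuous)] with x hx
    rw [modeLp, hx, PiLp.inner_apply]
    refine Finset.sum_congr rfl fun i _ => ?_
    simp [modeField, mul_comm]
  have hint : ∀ i, Integrable (fun x => (u x i : ℂ) * (a i * char L k x)) (μQ L) := fun i => by
    have := (integrable_mul_conj_char (memLp_comp u i) (-k)).const_mul (a i)
    refine this.congr (Eventually.of_forall fun x => ?_)
    simp only [char_neg, Complex.conj_conj]; ring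
  have h1 : ∀ i, ∫ x in cell L, ((u x i : ℂ) * (a i * char L k x)).re
      = L ^ 3 * (conj (fourierCoeff L u k i) * a i).re := fun i => by
    refine (integral_re (hint i)).trans ?_
    have h2 : ∀ x, (u x i : ℂ) * (a i * char L k x)
        = a i * ((u x i : ℂ) * conj (char L (-k) x)) := fun x => by
      simp only [char_neg, Complex.conj_conj]; ring
    simp only [h2]
    rw [integral_const_mul, ← fourierCoeff_neg, fourierCoeff_eq_coef, coef_eq, mul_assoc,
      Complex.re_ofReal_mul, mul_inv_cancel_left₀ (by positivity), mul_comm]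
    rfl
  have hre : ∀ i, Integrable (fun x => ((u x i : ℂ) * (a i * char L k x)).re) (μQ L) :=
    fun i => (hint i).re
  rw [h0, integral_finsetSum _ fun i _ => hre i, Complex.re_sum, Finset.mul_sum]
  exact Finset.sum_congr rfl fun i _ => h1 i

lemma vTerm_eq (m : ℕ) (u : L2 L) (k : Fin 3 → ℤ) :
    vTerm L m u k = waveSq L k ^ m * (L ^ 3 * ∑ i, ‖fourierCoeff L u k i‖ ^ 2) := by
  unfold vTerm waveSq wave; ring

lemma vTerm_nonneg (hL : 0 < L) (m : ℕ) (u : L2 L) (k : Fin 3 → ℤ) : 0 ≤ vTerm L m u k := by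
  rw [vTerm_eq]; have := waveSq_nonneg (L := L) k; positivity

/-- `V^m ⊆ V^n` for `1 ≤ n ≤ m`. -/
lemma MemV.mono (hL : 0 < L) {m n : ℕ} (hn : 1 ≤ n) (hnm : n ≤ m) {u : L2 L} (hu : MemV L m u) :
    MemV L n u := by
  refine ⟨hu.1, Summable.of_nonneg_of_le (vTerm_nonneg hL n u) (fun k => ?_)
    (hu.2.mul_left (((2 * Real.pi / L) ^ 2) ^ (m - n))⁻¹)⟩
  have hp : 0 < (2 * Real.pi / L) ^ 2 := by have := Real.pi_pos; positivity
  rw [← div_eq_inv_mul, le_div_iff₀ (by positivity), vTerm_eq, vTerm_eq]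
  by_cases hk : k = 0
  · subst hk
    rw [waveSq_zero, zero_pow (by omega), zero_mul, zero_mul]
    rw [zero_pow (by omega), zero_mul]
  · have h1 := waveSq_ge (L := L) hk
    have h2 : ((2 * Real.pi / L) ^ 2) ^ (m - n) ≤ waveSq L k ^ (m - n) := by gcongr
    have h3 : waveSq L k ^ m = waveSq L k ^ n * waveSq L k ^ (m - n) := by
      rw [← pow_add]; congr 1; omega
    rw [h3]
    have h4 := waveSq_nonneg (L := L) k
    have h5 : 0 ≤ L ^ 3 * ∑ i, ‖fourierCoeff L u k i‖ ^ 2 := by positivity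
    nlinarith [mul_le_mul_of_nonneg_left h2 (mul_nonneg (pow_nonneg h4 n) h5)]

lemma MemV.summable_wave (hL : 0 < L) {m : ℕ} (hm : 1 ≤ m) {u : L2 L} (hu : MemV L m u)
    (i l : Fin 3) : Summable fun k => (wave L k i * ‖fourierCoeff L u k l‖) ^ 2 := by
  have h := (hu.mono hL le_rfl hm).2.mul_left (L ^ 3)⁻¹
  refine Summable.of_nonneg_of_le (fun k => sq_nonneg _) (fun k => ?_) h
  rw [vTerm_eq, pow_one, mul_left_comm, inv_mul_cancel_left₀ (by positivity), mul_pow]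
  gcongr
  · exact waveSq_nonneg k
  · exact wave_sq_le k i
  · exact Finset.single_le_sum (f := fun i => ‖fourierCoeff L u k i‖ ^ 2)
      (fun j _ => by positivity) (Finset.mem_univ l)

lemma MemV.fourierCoeff_weakPartial (hL : 0 < L) {m : ℕ} (hm : 1 ≤ m) {u : L2 L}
    (hu : MemV L m u) (i : Fin 3) (k : Fin 3 → ℤ) (l : Fin 3) :
    fourierCoeff L (weakPartial L i u) k l = Complex.I * wave L k i * fourierCoeff L u k l :=
  NavierStokes.fourierCoeff_weakPartial hL i u (hu.summable_wave hL hm i) k l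

/-- The Laplacian acts on Fourier coefficients as multiplication by `-|κ|²`. -/
lemma MemV.fourierCoeff_laplacian (hL : 0 < L) {u : L2 L} (hu : MemV L 2 u) (k : Fin 3 → ℤ)
    (l : Fin 3) : fourierCoeff L (∑ i, weakPartial L i (weakPartial L i u)) k l
      = -(waveSq L k * fourierCoeff L u k l) := by
  have h1 : ∀ i, fourierCoeff L (weakPartial L i (weakPartial L i u)) k l
      = Complex.I * wave L k i * (Complex.I * wave L k i * fourierCoeff L u k l) := by
    intro i
    rw [NavierStokes.fourierCoeff_weakPartial hL, hu.fourierCoeff_weakPartial hL one_le_two]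
    intro l
    have h := hu.2.mul_left (L ^ 3)⁻¹
    refine Summable.of_nonneg_of_le (fun k => sq_nonneg _) (fun k => ?_) h
    rw [vTerm_eq, mul_left_comm, inv_mul_cancel_left₀ (by positivity),
      hu.fourierCoeff_weakPartial hL one_le_two]
    have e1 : (wave L k i * ‖Complex.I * wave L k i * fourierCoeff L u k l‖) ^ 2
        = (wave L k i ^ 2) ^ 2 * ‖fourierCoeff L u k l‖ ^ 2 := by
      simp [mul_pow]; ring
    rw [e1]
    gcongr
    · exact wave_sq_le k i
    · exact Finset.single_le_sum (f := fun i => ‖fourierCoeff L u k i‖ ^ 2)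
        (fun j _ => by positivity) (Finset.mem_univ l)
  have h2 := map_sum (fourierCoeffₗ L k l) (fun i => weakPartial L i (weakPartial L i u))
    Finset.univ
  refine (show _ = _ from h2).trans ?_
  refine (Finset.sum_congr rfl fun i _ => h1 i).trans ?_
  simp only [waveSq, Complex.ofReal_sum, Complex.ofReal_pow, Finset.sum_mul,
    ← Finset.sum_neg_distrib]
  refine Finset.sum_congr rfl fun i _ => ?_
  linear_combination ((wave L k i : ℂ) ^ 2 * fourierCoeff L u k l) * Complex.I_sq

lemma inner_lerayProj {v : L2 L} (hv : v ∈ H L) (u : L2 L) : ⟪lerayProj L u, v⟫ = ⟪u, v⟫ := by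
  rw [lerayProj, Submodule.inner_starProjection_left_eq_right,
    Submodule.starProjection_eq_self_iff.mpr hv]

lemma lerayProj_mem (u : L2 L) : lerayProj L u ∈ H L := Submodule.starProjection_apply_mem _ _

lemma stokes_mem (u : L2 L) : stokes L u ∈ H L := (H L).neg_mem (lerayProj_mem _)

lemma inner_stokes {v : L2 L} (hv : v ∈ H L) (u : L2 L) :
    ⟪stokes L u, v⟫ = -⟪∑ i, weakPartial L i (weakPartial L i u), v⟫ := by
  rw [stokes, inner_neg_left, inner_lerayProj hv]

variable {w : ℕ → L2 L} {lam : ℕ → ℝ}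

/-- A Stokes eigenfunction has only Fourier modes with `|κ|²` equal to the eigenvalue. This is seen by
testing the eigenvalue equation with the eigenfunction's own mode at `k`. -/
theorem IsStokesEigenbasis.fourierCoeff_eq_zero (hL : 0 < L) (hw : IsStokesEigenbasis L w lam)
    {j : ℕ} {k : Fin 3 → ℤ} (hk : waveSq L k ≠ lam j) (i : Fin 3) :
    fourierCoeff L (w j) k i = 0 := by
  have hH := (hw.memV j).1
  by_cases hk0 : k = 0
  · subst hk0; exact fourierCoeff_zero_of_mem hL hH i
  set a := fun i => fourierCoeff L (w j) k i with ha
  have hm := modeLp_mem hL hk0 (a := a) (fourierCoeff_div_of_mem hL hH k)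
  have h1 := inner_stokes hm (w j)
  rw [hw.eigen, inner_smul_left, inner_modeLp hL, inner_modeLp hL] at h1
  simp only [(hw.memV j).fourierCoeff_laplacian hL] at h1
  have e1 : ∑ i, conj (a i) * a i = ((∑ i, ‖a i‖ ^ 2 : ℝ) : ℂ) := by
    push_cast
    exact Finset.sum_congr rfl fun i _ => by rw [Complex.conj_mul']
  have e2 : ∑ i, conj (-(waveSq L k * a i : ℂ)) * a i
      = ((-(waveSq L k * ∑ i, ‖a i‖ ^ 2) : ℝ) : ℂ) := by
    rw [Complex.ofReal_neg, Complex.ofReal_mul, ← e1, Finset.mul_sum, ← Finset.sum_neg_distrib]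
    refine Finset.sum_congr rfl fun i _ => ?_
    simp; ring
  change _ * (L ^ 3 * (∑ i, conj (a i) * a i).re)
    = -(L ^ 3 * (∑ i, conj (-(waveSq L k * a i : ℂ)) * a i).re) at h1
  rw [e1, e2, Complex.ofReal_re, Complex.ofReal_re] at h1
  have h2 : (waveSq L k - lam j) * (L ^ 3 * ∑ i, ‖a i‖ ^ 2) = 0 := by
    simp only [conj_trivial] at h1
    linarith
  have h3 := (mul_eq_zero.mp h2).resolve_left (sub_ne_zero.mpr hk)
  have h4 := (mul_eq_zero.mp h3).resolve_left (by positivity)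
  have h5 := (Finset.sum_eq_zero_iff_of_nonneg fun i _ => by positivity).mp h4 i (Finset.mem_univ i)
  simpa [ha] using h5

/-- The Stokes operator is diagonal in the eigenbasis, on all of `V²`. -/
theorem IsStokesEigenbasis.inner_stokes_eq (hL : 0 < L) (hw : IsStokesEigenbasis L w lam)
    {u : L2 L} (hu : MemV L 2 u) (j : ℕ) : ⟪stokes L u, w j⟫ = lam j * ⟪u, w j⟫ := by
  rw [inner_stokes (hw.memV j).1]
  have h1 := (hasSum_inner hL (∑ i, weakPartial L i (weakPartial L i u)) (w j)).neg
  have h2 := (hasSum_inner hL u (w j)).mul_left (lam j : ℂ)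
  have h3 : ∀ k, -∑ i, conj (fourierCoeff L (∑ i, weakPartial L i (weakPartial L i u)) k i)
      * fourierCoeff L (w j) k i
      = (lam j : ℂ) * ∑ i, conj (fourierCoeff L u k i) * fourierCoeff L (w j) k i := by
    intro k
    rw [← Finset.sum_neg_distrib, Finset.mul_sum]
    refine Finset.sum_congr rfl fun i _ => ?_
    rw [hu.fourierCoeff_laplacian hL]
    by_cases hk : waveSq L k = lam j
    · rw [hk]; simp; ring
    · rw [hw.fourierCoeff_eq_zero hL hk]; simp
  simp only [h3] at h1
  have h4 := h1.unique h2
  norm_cast at h4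
  have h5 : (L ^ 3)⁻¹ ≠ 0 := by positivity
  refine mul_left_cancel₀ h5 ?_
  linarith

end

/-! ### Sobolev norms in the eigenbasis and in Fourier variables -/

section

variable {L : ℝ} {w : ℕ → L2 L} {lam : ℕ → ℝ}

/-- The squared norm `|A^{s/2} u|²`, for real `s`, computed in the eigenbasis of the Stokes
operator; it takes the value `∞` outside `V^s`. -/
def sobSq (w : ℕ → L2 L) (lam : ℕ → ℝ) (s : ℝ) (u : L2 L) : ℝ≥0∞ :=
  ∑' j, ENNReal.ofReal (lam j ^ s * ⟪u, w j⟫ ^ 2)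

/-- The contribution of the wave number `k` to the squared `L²` norm. -/
def modeSq (L : ℝ) (u : L2 L) (k : Fin 3 → ℤ) : ℝ := L ^ 3 * ∑ i, ‖fourierCoeff L u k i‖ ^ 2

/-- The squared homogeneous Sobolev norm of order `s` computed from the Fourier coefficients. -/
def fourierSobSq (L : ℝ) (s : ℝ) (u : L2 L) : ℝ≥0∞ :=
  ∑' k, ENNReal.ofReal (waveSq L k ^ s * modeSq L u k)

lemma modeSq_nonneg (hL : 0 < L) (u : L2 L) (k : Fin 3 → ℤ) : 0 ≤ modeSq L u k := by
  unfold modeSq; positivity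

lemma ext_of_inner_eigenbasis (hw : IsStokesEigenbasis L w lam) {u v : L2 L} (hu : u ∈ H L)
    (hv : v ∈ H L) (h : ∀ j, ⟪u, w j⟫ = ⟪v, w j⟫) : u = v := by
  have hd : u - v ∈ (Submodule.span ℝ (range w)).topologicalClosure :=
    hw.complete ((H L).sub_mem hu hv)
  have h1 : (Submodule.span ℝ (range w)).topologicalClosure
      ≤ LinearMap.ker (innerSL ℝ (u - v)).toLinearMap := by
    refine Submodule.topologicalClosure_minimal _ ?_ (innerSL ℝ (u - v)).isClosed_ker
    rw [Submodule.span_le]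
    rintro _ ⟨j, rfl⟩
    simp [h j]
  have h2 : ⟪u - v, u - v⟫ = 0 := h1 hd
  exact sub_eq_zero.mp (inner_self_eq_zero.mp h2)

/-- Parseval's identity in the eigenbasis. -/
lemma hasSum_inner_sq (hw : IsStokesEigenbasis L w lam) {u : L2 L} (hu : u ∈ H L) :
    HasSum (fun j => ⟪u, w j⟫ ^ 2) (‖u‖ ^ 2) := by
  let w' : ℕ → H L := fun j => ⟨w j, (hw.memV j).1⟩
  have ho : Orthonormal ℝ w' :=
    ⟨fun j => hw.orthonormal.1 j, fun i j hij => hw.orthonormal.2 hij⟩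
  have hbot : (Submodule.span ℝ (range w'))ᗮ = ⊥ := by
    rw [Submodule.eq_bot_iff]
    intro x hx
    rw [Submodule.mem_orthogonal'] at hx
    refine Subtype.ext ?_
    refine ext_of_inner_eigenbasis hw x.2 (H L).zero_mem fun j => ?_
    have := hx (w' j) (Submodule.subset_span ⟨j, rfl⟩)
    rw [ZeroMemClass.coe_zero, inner_zero_left]
    exact this
  have hcs : CompleteSpace (H L) := by
    have : IsClosed (H L : Set (L2 L)) := Submodule.isClosed_topologicalClosure _
    exact this.completeSpace_coe
  let b := HilbertBasis.mkOfOrthogonalEqBot ho hbot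
  have h1 := b.hasSum_inner_mul_inner ⟨u, hu⟩ ⟨u, hu⟩
  have h2 : ∀ j, ⟪(⟨u, hu⟩ : H L), b j⟫ * ⟪b j, (⟨u, hu⟩ : H L)⟫ = ⟪u, w j⟫ ^ 2 := by
    intro j
    rw [HilbertBasis.coe_mkOfOrthogonalEqBot, Submodule.coe_inner, Submodule.coe_inner,
      real_inner_comm, ← sq, real_inner_comm]
  simp only [h2] at h1
  rwa [real_inner_self_eq_norm_sq] at h1

lemma tsum_ofReal_inner_sq (hw : IsStokesEigenbasis L w lam) {u : L2 L} (hu : u ∈ H L) :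
    ∑' j, ENNReal.ofReal (⟪u, w j⟫ ^ 2) = ENNReal.ofReal (‖u‖ ^ 2) := by
  have h := hasSum_inner_sq hw hu
  rw [← h.tsum_eq, ENNReal.ofReal_tsum_of_nonneg (fun _ => sq_nonneg _) h.summable]

lemma tsum_ofReal_modeSq (hL : 0 < L) (u : L2 L) :
    ∑' k, ENNReal.ofReal (modeSq L u k) = ENNReal.ofReal (‖u‖ ^ 2) := by
  have h := hasSum_norm_sq hL u
  rw [← h.tsum_eq]
  exact (ENNReal.ofReal_tsum_of_nonneg (fun k => modeSq_nonneg hL u k) h.summable).symm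

/-- Bessel's inequality on an eigenspace: the part of `g` in the eigenfunctions with eigenvalue `R`
is controlled by the Fourier modes of `g` with `|κ|² = R`. -/
lemma tsum_eigenvalue_le (hL : 0 < L) (hw : IsStokesEigenbasis L w lam) (g : L2 L) (R : ℝ) :
    ∑' j : {j // lam j = R}, ENNReal.ofReal (⟪g, w j⟫ ^ 2)
      ≤ ∑' k : {k // waveSq L k = R}, ENNReal.ofReal (modeSq L g k) := by
  set K : Set (Fin 3 → ℤ) := {k | waveSq L k = R} with hK
  have hsum := hasSum_norm_sq hL g
  have hsK : Summable (K.indicator (modeSq L g)) := Summable.indicator hsum.summable K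
  have hG : ∑' k : {k // waveSq L k = R}, ENNReal.ofReal (modeSq L g k)
      = ENNReal.ofReal (∑' k, K.indicator (modeSq L g) k) := by
    rw [ENNReal.ofReal_tsum_of_nonneg
      (fun k => indicator_nonneg (fun k _ => modeSq_nonneg hL g k) k) hsK]
    refine (tsum_subtype K fun k => ENNReal.ofReal (modeSq L g k)).trans ?_
    refine tsum_congr fun k => ?_
    by_cases hk : k ∈ K <;> simp [hk]
  rw [hG, ENNReal.tsum_eq_iSup_sum]
  refine iSup_le fun F => ?_
  rw [← ENNReal.ofReal_sum_of_nonneg fun _ _ => sq_nonneg _]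
  refine ENNReal.ofReal_le_ofReal ?_
  -- `v` is the projection of `g` on finitely many of the eigenfunctions
  set v : L2 L := ∑ j ∈ F, ⟪g, w j⟫ • w j with hv
  set S := ∑ j ∈ F, ⟪g, w j⟫ ^ 2 with hS
  have ho : Orthonormal ℝ fun j : {j // lam j = R} => w j :=
    hw.orthonormal.comp _ Subtype.val_injective
  have h1 : ⟪g, v⟫ = S := by
    rw [hv, inner_sum]
    exact Finset.sum_congr rfl fun j _ => by rw [inner_smul_right]; ring
  have h2 : ‖v‖ ^ 2 = S := by
    rw [← real_inner_self_eq_norm_sq, hv, ho.inner_sum]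
    exact Finset.sum_congr rfl fun j _ => by simp [sq]
  have hvK : ∀ k, k ∉ K → ∀ i, fourierCoeff L v k i = 0 := by
    intro k hk i
    have : fourierCoeff L v k i = ∑ j ∈ F, ⟪g, w j⟫ • fourierCoeff L (w j) k i := by
      have := map_sum (fourierCoeffₗ L k i) (fun j : {j // lam j = R} => ⟪g, w j⟫ • w j) F
      simp only [map_smul] at this
      exact this
    rw [this]
    refine Finset.sum_eq_zero fun j _ => ?_
    rw [hw.fourierCoeff_eq_zero hL, smul_zero]
    rw [j.2]; exact hk
  have h3 : HasSum (fun k => L ^ 3 *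
      (∑ i, conj (fourierCoeff L g k i) * fourierCoeff L v k i).re) S := by
    have := (Complex.hasSum_re (hasSum_inner hL g v)).mul_left (L ^ 3)
    rwa [Complex.ofReal_re, mul_inv_cancel_left₀ (by positivity), h1] at this
  -- `⟪g, v⟫` involves only modes in `K`, so half the sum of squares over `K` bounds it
  have h4 := (hsK.hasSum.add (hasSum_norm_sq hL v)).mul_left (1 / 2)
  rw [h2] at h4
  have h5 := hasSum_le (fun k => ?_) h3 h4
  · linarith
  · by_cases hk : k ∈ K
    · rw [indicator_of_mem hk, modeSq, ← mul_add, ← mul_assoc, mul_comm (1 / 2 : ℝ), mul_assoc]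
      gcongr
      rw [Complex.re_sum, ← Finset.sum_add_distrib, Finset.mul_sum]
      refine Finset.sum_le_sum fun i _ => ?_
      refine (Complex.re_le_norm _).trans ?_
      rw [norm_mul, RCLike.norm_conj]
      nlinarith [sq_nonneg (‖fourierCoeff L g k i‖ - ‖fourierCoeff L v k i‖)]
    · simp [hvK k hk, hk]

/-- A weighted sum may be grouped along the fibres of the argument of the weight. -/
lemma tsum_weight_eq {ι : Type*} (f : ι → ℝ) (h : ℝ → ℝ≥0∞) (a : ι → ℝ≥0∞) :
    ∑' i, h (f i) * a i = ∑' R : ℝ, h R * ∑' i : {i // f i = R}, a i := by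
  rw [← (Equiv.sigmaFiberEquiv f).tsum_eq, ENNReal.tsum_sigma']
  refine tsum_congr fun R => ?_
  rw [← ENNReal.tsum_mul_left]
  refine tsum_congr fun i => ?_
  simp [Equiv.sigmaFiberEquiv, i.2]

/-- On `H` Bessel's inequality is an equality in every eigenspace, since both sides have the same
sum `‖g‖²` over all eigenvalues. -/
lemma tsum_eigenvalue_eq (hL : 0 < L) (hw : IsStokesEigenbasis L w lam) {g : L2 L} (hg : g ∈ H L)
    (R : ℝ) : ∑' j : {j // lam j = R}, ENNReal.ofReal (⟪g, w j⟫ ^ 2)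
      = ∑' k : {k // waveSq L k = R}, ENNReal.ofReal (modeSq L g k) := by
  have h1 := tsum_weight_eq lam (fun _ => 1) fun j => ENNReal.ofReal (⟪g, w j⟫ ^ 2)
  have h2 := tsum_weight_eq (waveSq L) (fun _ => 1) fun k => ENNReal.ofReal (modeSq L g k)
  simp only [one_mul] at h1 h2
  rw [tsum_ofReal_inner_sq hw hg] at h1
  rw [tsum_ofReal_modeSq hL g] at h2
  by_contra hne
  have h3 := ENNReal.tsum_lt_tsum (by rw [← h1]; exact ENNReal.ofReal_ne_top)
    (tsum_eigenvalue_le hL hw g) (lt_of_le_of_ne (tsum_eigenvalue_le hL hw g R) hne)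
  rw [← h1, ← h2] at h3
  exact lt_irrefl _ h3

lemma sobSq_eq_tsum_weight (hw : IsStokesEigenbasis L w lam) (s : ℝ) (u : L2 L) :
    sobSq w lam s u = ∑' R : ℝ, ENNReal.ofReal (R ^ s) *
      ∑' j : {j // lam j = R}, ENNReal.ofReal (⟪u, w j⟫ ^ 2) := by
  rw [← tsum_weight_eq lam (fun R => ENNReal.ofReal (R ^ s))
    fun j => ENNReal.ofReal (⟪u, w j⟫ ^ 2)]
  exact tsum_congr fun j => ENNReal.ofReal_mul (Real.rpow_nonneg (hw.pos j).le s)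

lemma fourierSobSq_eq_tsum_weight (s : ℝ) (u : L2 L) :
    fourierSobSq L s u = ∑' R : ℝ, ENNReal.ofReal (R ^ s) *
      ∑' k : {k // waveSq L k = R}, ENNReal.ofReal (modeSq L u k) := by
  rw [← tsum_weight_eq (waveSq L) (fun R => ENNReal.ofReal (R ^ s))
    fun k => ENNReal.ofReal (modeSq L u k)]
  exact tsum_congr fun k => ENNReal.ofReal_mul (Real.rpow_nonneg (waveSq_nonneg k) s)

/-- For a field outside `H` the eigenbasis sees only its Leray projection, so there is only an
inequality. -/
theorem sobSq_le_fourierSobSq (hL : 0 < L) (hw : IsStokesEigenbasis L w lam) (s : ℝ) (u : L2 L) :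
    sobSq w lam s u ≤ fourierSobSq L s u := by
  rw [sobSq_eq_tsum_weight hw, fourierSobSq_eq_tsum_weight]
  exact ENNReal.tsum_le_tsum fun R => by gcongr; exact tsum_eigenvalue_le hL hw u R

theorem sobSq_eq_fourierSobSq (hL : 0 < L) (hw : IsStokesEigenbasis L w lam) (s : ℝ) {u : L2 L}
    (hu : u ∈ H L) : sobSq w lam s u = fourierSobSq L s u := by
  rw [sobSq_eq_tsum_weight hw, fourierSobSq_eq_tsum_weight]
  exact tsum_congr fun R => by rw [tsum_eigenvalue_eq hL hw hu R]

lemma tsum_vTerm (hL : 0 < L) (hw : IsStokesEigenbasis L w lam) (m : ℕ) {u : L2 L} (hu : u ∈ H L) :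
    ∑' k, ENNReal.ofReal (vTerm L m u k) = sobSq w lam m u := by
  rw [sobSq_eq_fourierSobSq hL hw m hu]
  exact tsum_congr fun k => by rw [vTerm_eq, Real.rpow_natCast]; rfl

theorem memV_iff (hL : 0 < L) (hw : IsStokesEigenbasis L w lam) (m : ℕ) {u : L2 L} :
    MemV L m u ↔ u ∈ H L ∧ sobSq w lam m u < ⊤ := by
  refine and_congr_right fun hu => ?_
  rw [← tsum_vTerm hL hw m hu]
  constructor
  · intro h
    rw [← ENNReal.ofReal_tsum_of_nonneg (vTerm_nonneg hL m u) h]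
    exact ENNReal.ofReal_lt_top
  · intro h
    have := ENNReal.summable_toReal h.ne
    simpa only [ENNReal.toReal_ofReal (vTerm_nonneg hL m u _)] using this

/-- Valid for every `u`, as both sides vanish when the series diverges. -/
lemma vNorm_eq_fourier (hL : 0 < L) (m : ℕ) (u : L2 L) :
    vNorm L m u = Real.sqrt (∑' k, ENNReal.ofReal (vTerm L m u k)).toReal := by
  rw [vNorm, ENNReal.tsum_toReal_eq fun _ => ENNReal.ofReal_ne_top]
  simp only [ENNReal.toReal_ofReal (vTerm_nonneg hL m u _)]

theorem vNorm_eq (hL : 0 < L) (hw : IsStokesEigenbasis L w lam) (m : ℕ) {u : L2 L} (hu : u ∈ H L) :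
    vNorm L m u = Real.sqrt (sobSq w lam m u).toReal := by
  rw [vNorm_eq_fourier hL, tsum_vTerm hL hw m hu]

end

/-! ### The convolution estimate -/

section

variable {L : ℝ} {w : ℕ → L2 L} {lam : ℕ → ℝ}

lemma waveSq_eq_norm_sq (k : Fin 3 → ℤ) :
    waveSq L k = (2 * Real.pi / L) ^ 2
      * ‖(WithLp.toLp 2 fun i => (k i : ℝ) : E3)‖ ^ 2 := by
  rw [EuclideanSpace.norm_sq_eq, Finset.mul_sum]
  refine Finset.sum_congr rfl fun i _ => ?_
  simp only [wave, Real.norm_eq_abs, sq_abs]; ring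

/-- The lattice sum `∑ |κ|^{-2r}` converges for `r > 3/2`; the term `k = 0` is zero by the
convention `0 ^ (-r) = 0`. -/
lemma summable_waveSq_rpow {r : ℝ} (hr : 3 / 2 < r) :
    Summable fun k : Fin 3 → ℤ => waveSq L k ^ (-r) := by
  let b := (EuclideanSpace.basisFun (Fin 3) ℝ).toBasis
  let Λ := Submodule.span ℤ (Set.range b)
  have hrank : Module.finrank ℤ Λ = 3 := by
    rw [ZLattice.rank ℝ Λ, finrank_euclideanSpace_fin]
  have h1 := ZLattice.summable_norm_rpow Λ (-(2 * r)) (by rw [hrank]; push_cast; linarith)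
  have hmem : ∀ k : Fin 3 → ℤ, (WithLp.toLp 2 fun i => (k i : ℝ) : E3) ∈ Λ := fun k => by
    have : (WithLp.toLp 2 fun i => (k i : ℝ) : E3) = ∑ i, k i • b i := by
      ext j
      simp [b, Finset.sum_apply, Pi.single_apply]
    rw [this]
    exact Submodule.sum_mem _ fun i _ =>
      Submodule.smul_mem _ _ (Submodule.subset_span ⟨i, rfl⟩)
  let ι : (Fin 3 → ℤ) → Λ := fun k => ⟨_, hmem k⟩
  have hι : Function.Injective ι := fun k l hkl => by
    have h2 : (WithLp.toLp 2 fun i => (k i : ℝ) : E3) = WithLp.toLp 2 fun i => (l i : ℝ) :=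
      congrArg Subtype.val hkl
    funext i
    have h3 : (k i : ℝ) = l i := congrArg (fun x : E3 => x i) h2
    exact_mod_cast h3
  have h4 : ∀ k, waveSq L k ^ (-r) = ((2 * Real.pi / L) ^ 2) ^ (-r) * ‖ι k‖ ^ (-(2 * r)) := by
    intro k
    rw [waveSq_eq_norm_sq, Real.mul_rpow (sq_nonneg _) (sq_nonneg _), ← Real.rpow_natCast ‖_‖ 2,
      ← Real.rpow_mul (norm_nonneg _)]
    congr 2
    push_cast; ring
  simp only [h4]
  exact (h1.comp_injective hι).mul_left _

/-- The Cauchy–Schwarz inequality for series in `[0, ∞]`. -/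
lemma tsum_sq_le_mul {ι : Type*} [Countable ι] {x A B : ι → ℝ≥0∞} (h : ∀ l, x l ^ 2 ≤ A l * B l) :
    (∑' l, x l) ^ 2 ≤ (∑' l, A l) * ∑' l, B l := by
  let _ : MeasurableSpace ι := ⊤
  have h1 : ∀ l, x l ≤ A l ^ (1 / 2 : ℝ) * B l ^ (1 / 2 : ℝ) := fun l => by
    rw [← ENNReal.mul_rpow_of_nonneg _ _ (by norm_num)]
    have := ENNReal.rpow_le_rpow (h l) (show (0 : ℝ) ≤ 1 / 2 by norm_num)
    rwa [← ENNReal.rpow_natCast, ← ENNReal.rpow_mul, show ((2 : ℕ) : ℝ) * (1 / 2) = 1 by norm_num,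
      ENNReal.rpow_one] at this
  have h2 := ENNReal.lintegral_mul_le_Lp_mul_Lq (Measure.count : Measure ι)
    Real.HolderConjugate.two_two (f := fun l => A l ^ (1 / 2 : ℝ)) (g := fun l => B l ^ (1 / 2 : ℝ))
    (measurable_of_countable _).aemeasurable (measurable_of_countable _).aemeasurable
  have h3 : ∀ a : ℝ≥0∞, (a ^ (1 / 2 : ℝ)) ^ (2 : ℝ) = a := fun a => by
    rw [← ENNReal.rpow_mul]; norm_num
  simp only [lintegral_count, Pi.mul_apply, h3] at h2
  have h4 := (ENNReal.tsum_le_tsum h1).trans h2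
  have h5 := pow_le_pow_left' h4 2
  have h6 : ∀ a : ℝ≥0∞, (a ^ (1 / 2 : ℝ)) ^ 2 = a := fun a => by
    rw [← ENNReal.rpow_natCast, Nat.cast_ofNat, h3]
  rwa [mul_pow, h6, h6] at h5

lemma waveSq_sub_add_le (k l : Fin 3 → ℤ) : waveSq L k ≤ 2 * (waveSq L (k - l) + waveSq L l) := by
  unfold waveSq
  rw [← Finset.sum_add_distrib, Finset.mul_sum]
  refine Finset.sum_le_sum fun i _ => ?_
  have : wave L k i = wave L (k - l) i + wave L l i := by
    simp only [wave, Pi.sub_apply]; push_cast; ring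
  rw [this]
  nlinarith [sq_nonneg (wave L (k - l) i - wave L l i)]

/-- The kernel bound behind the convolution estimate: of the two frequencies, the larger one absorbs
the weight of the output. -/
lemma rpow_mul_rpow_le {x y z σ s : ℝ} (hx : 0 < x) (hy : 0 < y) (hz : 0 ≤ z)
    (hzxy : z ≤ 2 * (x + y)) (hσ : 0 ≤ σ) (hσs : σ ≤ s) :
    z ^ σ * (x ^ (-s) * y ^ (-s)) ≤ 4 ^ σ * (x ^ (-(2 * s - σ)) + y ^ (-(2 * s - σ))) := by
  wlog hxy : x ≤ y generalizing x y
  · have := this hy hx (by linarith) (by linarith)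
    linarith [mul_comm (x ^ (-s)) (y ^ (-s))]
  have h1 : z ^ σ ≤ 4 ^ σ * y ^ σ := by
    rw [← Real.mul_rpow (by norm_num) hy.le]
    exact Real.rpow_le_rpow hz (by linarith) hσ
  have h2 : y ^ σ * y ^ (-s) ≤ x ^ (σ - s) := by
    rw [← Real.rpow_add hy, ← sub_eq_add_neg]
    exact Real.rpow_le_rpow_of_nonpos hx hxy (by linarith)
  have h3 : x ^ (σ - s) * x ^ (-s) = x ^ (-(2 * s - σ)) := by
    rw [← Real.rpow_add hx]; congr 1; ring
  have h4 : 0 ≤ y ^ (-(2 * s - σ)) := by positivity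
  calc z ^ σ * (x ^ (-s) * y ^ (-s)) ≤ 4 ^ σ * y ^ σ * (x ^ (-s) * y ^ (-s)) := by gcongr
    _ = 4 ^ σ * (y ^ σ * y ^ (-s) * x ^ (-s)) := by ring
    _ ≤ 4 ^ σ * (x ^ (σ - s) * x ^ (-s)) := by gcongr
    _ ≤ _ := by rw [h3]; gcongr; linarith

/-- The product estimate for sequences: convolution maps pairs of sequences in the weighted space of
order `s` to the weighted space of order `σ`, provided that `σ ≤ s` and `2s - σ > 3/2`. -/
theorem exists_convolution_bound (hL : 0 < L) {s σ : ℝ} (hσ : 0 < σ) (hσs : σ ≤ s)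
    (h : 3 / 2 < 2 * s - σ) : ∃ C : ℝ≥0∞, C ≠ ⊤ ∧ ∀ a b c : (Fin 3 → ℤ) → ℝ≥0∞, a 0 = 0 → b 0 = 0 →
      (∀ k, c k ≤ ∑' l, a (k - l) * b l) →
      ∑' k, ENNReal.ofReal (waveSq L k ^ σ) * c k ^ 2
        ≤ C * ((∑' k, ENNReal.ofReal (waveSq L k ^ s) * a k ^ 2)
          * ∑' k, ENNReal.ofReal (waveSq L k ^ s) * b k ^ 2) := by
  set Z : ℝ≥0∞ := ∑' l : Fin 3 → ℤ, ENNReal.ofReal (waveSq L l ^ (-(2 * s - σ))) with hZ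
  have hZtop : Z ≠ ⊤ := by
    rw [hZ, ← ENNReal.ofReal_tsum_of_nonneg (fun l => Real.rpow_nonneg (waveSq_nonneg l) _)
      (summable_waveSq_rpow h)]
    exact ENNReal.ofReal_ne_top
  refine ⟨ENNReal.ofReal (4 ^ σ) * (Z + Z), by finiteness, fun a b c ha hb hc => ?_⟩
  have hs : 0 < s := lt_of_lt_of_le hσ hσs
  set Aw := fun k => ENNReal.ofReal (waveSq L k ^ s) * a k ^ 2 with hAw
  set Bw := fun k => ENNReal.ofReal (waveSq L k ^ s) * b k ^ 2 with hBw
  -- Cauchy–Schwarz at a fixed wave number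
  have key : ∀ k, ENNReal.ofReal (waveSq L k ^ σ) * c k ^ 2
      ≤ ENNReal.ofReal (4 ^ σ) * (Z + Z) * ∑' l, Aw (k - l) * Bw l := by
    intro k
    have h1 : (∑' l, a (k - l) * b l) ^ 2
        ≤ (∑' l, ENNReal.ofReal (waveSq L (k - l) ^ (-s) * waveSq L l ^ (-s)))
          * ∑' l, Aw (k - l) * Bw l := by
      refine tsum_sq_le_mul fun l => ?_
      by_cases hl : l = 0
      · simp [hl, hb]
      by_cases hkl : k - l = 0
      · simp [hkl, ha]
      have p1 := waveSq_pos hL hl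
      have p2 := waveSq_pos hL hkl
      have e1 : ENNReal.ofReal (waveSq L (k - l) ^ (-s) * waveSq L l ^ (-s))
          * (ENNReal.ofReal (waveSq L (k - l) ^ s) * ENNReal.ofReal (waveSq L l ^ s)) = 1 := by
        rw [← ENNReal.ofReal_mul (by positivity), ← ENNReal.ofReal_mul (by positivity),
          Real.rpow_neg p1.le, Real.rpow_neg p2.le]
        rw [← ENNReal.ofReal_one]
        congr 1
        have := Real.rpow_pos_of_pos p1 s
        have := Real.rpow_pos_of_pos p2 s
        field_simp
      refine le_of_eq ?_
      calc (a (k - l) * b l) ^ 2 = 1 * (a (k - l) ^ 2 * b l ^ 2) := by rw [one_mul, mul_pow]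
        _ = _ := by rw [← e1, hAw, hBw]; ring
    have h2 : ENNReal.ofReal (waveSq L k ^ σ)
        * ∑' l, ENNReal.ofReal (waveSq L (k - l) ^ (-s) * waveSq L l ^ (-s))
        ≤ ENNReal.ofReal (4 ^ σ) * (Z + Z) := by
      have e2 : ∑' l, ENNReal.ofReal (waveSq L (k - l) ^ (-(2 * s - σ))) = Z :=
        (Equiv.subLeft k).tsum_eq fun l => ENNReal.ofReal (waveSq L l ^ (-(2 * s - σ)))
      rw [← ENNReal.tsum_mul_left]
      nth_rewrite 1 [← e2]
      rw [hZ, ← ENNReal.tsum_add, ← ENNReal.tsum_mul_left]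
      refine ENNReal.tsum_le_tsum fun l => ?_
      have q0 := waveSq_nonneg (L := L) k
      have q1 := waveSq_nonneg (L := L) l
      have q2 := waveSq_nonneg (L := L) (k - l)
      rw [← ENNReal.ofReal_mul (by positivity), ← ENNReal.ofReal_add (by positivity)
        (by positivity), ← ENNReal.ofReal_mul (by positivity)]
      refine ENNReal.ofReal_le_ofReal ?_
      have q3 : 0 ≤ 4 ^ σ * (waveSq L (k - l) ^ (-(2 * s - σ)) + waveSq L l ^ (-(2 * s - σ))) := by
        positivity
      have hs0 : (0 : ℝ) ^ (-s) = 0 := Real.zero_rpow (by linarith)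
      by_cases hl : l = 0
      · rwa [show waveSq L l ^ (-s) = 0 by rw [hl, waveSq_zero, hs0], mul_zero, mul_zero]
      by_cases hkl : k - l = 0
      · rwa [show waveSq L (k - l) ^ (-s) = 0 by rw [hkl, waveSq_zero, hs0], zero_mul, mul_zero]
      exact rpow_mul_rpow_le (waveSq_pos hL hkl) (waveSq_pos hL hl) q0 (waveSq_sub_add_le k l)
        hσ.le hσs
    calc ENNReal.ofReal (waveSq L k ^ σ) * c k ^ 2
        ≤ ENNReal.ofReal (waveSq L k ^ σ) * (∑' l, a (k - l) * b l) ^ 2 := by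
          gcongr; exact hc k
      _ ≤ ENNReal.ofReal (waveSq L k ^ σ) *
          ((∑' l, ENNReal.ofReal (waveSq L (k - l) ^ (-s) * waveSq L l ^ (-s)))
          * ∑' l, Aw (k - l) * Bw l) := by gcongr
      _ ≤ _ := by rw [← mul_assoc]; gcongr
  calc ∑' k, ENNReal.ofReal (waveSq L k ^ σ) * c k ^ 2
      ≤ ∑' k, ENNReal.ofReal (4 ^ σ) * (Z + Z) * ∑' l, Aw (k - l) * Bw l :=
        ENNReal.tsum_le_tsum key
    _ = ENNReal.ofReal (4 ^ σ) * (Z + Z) * ∑' l, ∑' k, Aw (k - l) * Bw l := by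
        rw [ENNReal.tsum_mul_left, ENNReal.tsum_comm]
    _ = _ := by
        congr 1
        rw [← ENNReal.tsum_mul_left]
        refine tsum_congr fun l => ?_
        rw [ENNReal.tsum_mul_right]
        congr 1
        exact (Equiv.subRight l).tsum_eq Aw

end

/-! ### The nonlinear term -/

section

variable {L : ℝ} {w : ℕ → L2 L} {lam : ℕ → ℝ}

lemma MemV.add {m : ℕ} (hL : 0 < L) {u v : L2 L} (hu : MemV L m u) (hv : MemV L m v) :
    MemV L m (u + v) := by
  refine ⟨(H L).add_mem hu.1 hv.1, Summable.of_nonneg_of_le (vTerm_nonneg hL m _) (fun k => ?_)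
    ((hu.2.add hv.2).mul_left 2)⟩
  rw [vTerm_eq, vTerm_eq, vTerm_eq, ← mul_add, ← mul_add, ← Finset.sum_add_distrib]
  have h1 : ∑ i, ‖fourierCoeff L (u + v) k i‖ ^ 2
      ≤ 2 * ∑ i, (‖fourierCoeff L u k i‖ ^ 2 + ‖fourierCoeff L v k i‖ ^ 2) := by
    rw [Finset.mul_sum]
    refine Finset.sum_le_sum fun i _ => ?_
    rw [fourierCoeff_add]
    have := norm_add_le (fourierCoeff L u k i) (fourierCoeff L v k i)
    have h0 := norm_nonneg (fourierCoeff L u k i + fourierCoeff L v k i)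
    nlinarith [sq_nonneg (‖fourierCoeff L u k i‖ - ‖fourierCoeff L v k i‖)]
  have := waveSq_nonneg (L := L) k
  calc _ ≤ waveSq L k ^ m * (L ^ 3 *
        (2 * ∑ i, (‖fourierCoeff L u k i‖ ^ 2 + ‖fourierCoeff L v k i‖ ^ 2))) := by gcongr
    _ = _ := by ring

lemma vTerm_smul (m : ℕ) (a : ℝ) (u : L2 L) (k : Fin 3 → ℤ) :
    vTerm L m (a • u) k = a ^ 2 * vTerm L m u k := by
  rw [vTerm_eq, vTerm_eq]
  simp only [fourierCoeff_smul, norm_mul, mul_pow, ← Finset.mul_sum,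
    Complex.norm_real, Real.norm_eq_abs, sq_abs]
  ring

lemma MemV.smul {m : ℕ} (a : ℝ) {u : L2 L} (hu : MemV L m u) : MemV L m (a • u) := by
  refine ⟨(H L).smul_mem a hu.1, ?_⟩
  rw [show vTerm L m (a • u) = fun k => a ^ 2 * vTerm L m u k from funext (vTerm_smul m a u)]
  exact hu.2.mul_left _

lemma memV_zero (m : ℕ) : MemV L m 0 := by
  have h : vTerm L m 0 = fun _ => 0 := funext fun k => by
    have := vTerm_smul (L := L) m 0 0 k
    simpa using this
  exact ⟨(H L).zero_mem, by rw [h]; exact summable_zero⟩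

/-- The space `V²` as a linear subspace. -/
def V2 (hL : 0 < L) : Submodule ℝ (L2 L) where
  carrier := {u | MemV L 2 u}
  add_mem' hu hv := MemV.add hL hu hv
  zero_mem' := memV_zero 2
  smul_mem' a _ hu := MemV.smul a hu

lemma MemV.sub {m : ℕ} (hL : 0 < L) {u v : L2 L} (hu : MemV L m u) (hv : MemV L m v) :
    MemV L m (u - v) := by
  have := hu.add hL (hv.smul (-1))
  rwa [neg_one_smul, ← sub_eq_add_neg] at this

/-- Elements of `V²` have absolutely convergent Fourier series, because `∑ |κ|⁻⁴` is finite in three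
dimensions. -/
lemma MemV.summable_coef (hL : 0 < L) {u : L2 L} (hu : MemV L 2 u) (i : Fin 3) :
    Summable fun k => ‖fourierCoeff L u k i‖ := by
  have h1 := (hu.2.mul_left (L ^ 3)⁻¹).add (summable_waveSq_rpow (L := L) (r := 2) (by norm_num))
  refine Summable.of_nonneg_of_le (fun k => norm_nonneg _) (fun k => ?_) h1
  rw [vTerm_eq, mul_left_comm, inv_mul_cancel_left₀ (by positivity)]
  have h2 : ‖fourierCoeff L u k i‖ ^ 2 ≤ ∑ i, ‖fourierCoeff L u k i‖ ^ 2 :=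
    Finset.single_le_sum (f := fun i => ‖fourierCoeff L u k i‖ ^ 2)
      (fun j _ => by positivity) (Finset.mem_univ i)
  by_cases hk : k = 0
  · subst hk
    rw [fourierCoeff_zero_of_mem hL hu.1, norm_zero, waveSq_zero,
      Real.zero_rpow (by norm_num)]
    positivity
  · have hp := waveSq_pos hL hk
    rw [Real.rpow_neg hp.le, Real.rpow_two]
    have h3 : waveSq L k ^ 2 * ‖fourierCoeff L u k i‖ ^ 2
        ≤ waveSq L k ^ 2 * ∑ i, ‖fourierCoeff L u k i‖ ^ 2 := by gcongr
    have h4 : waveSq L k * (waveSq L k)⁻¹ = 1 := mul_inv_cancel₀ hp.ne'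
    set p := waveSq L k
    set q := (waveSq L k)⁻¹
    set n := ‖fourierCoeff L u k i‖
    have h5 : (p ^ 2)⁻¹ = q ^ 2 := by simp [q, p]
    rw [h5]
    have h6 : n = (p * n) * q := by rw [mul_right_comm, h4, one_mul]
    nlinarith [sq_nonneg (p * n - q), sq_nonneg (p * n), sq_nonneg q]

lemma MemV.memLp_top (hL : 0 < L) {u : L2 L} (hu : MemV L 2 u) (i : Fin 3) :
    MemLp (fun x => u x i) ∞ (μQ L) := by
  have h := memLp_top_of_summable_coef hL (memLp_comp u i) (hu.summable_coef hL i)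
  exact h.re

lemma memLp_advection (hL : 0 < L) {u : L2 L} (hu : MemV L 2 u) (v : L2 L) :
    MemLp (advection L u v) 2 (μQ L) := by
  have h : ∀ i : Fin 3, MemLp (fun x => u x i • weakPartial L i v x) 2 (μQ L) := fun i =>
    (Lp.memLp (weakPartial L i v)).smul (hu.memLp_top hL i)
  exact memLp_finsetSum Finset.univ fun i _ => h i

lemma B_eq (hL : 0 < L) {u : L2 L} (hu : MemV L 2 u) (v : L2 L) :
    B L u v = lerayProj L (memLp_advection hL hu v).toLp := dif_pos _

lemma B_mem (u v : L2 L) : B L u v ∈ H L := by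
  unfold B
  split_ifs
  · exact lerayProj_mem _
  · exact (H L).zero_mem

lemma weakPartial_add (hL : 0 < L) {u v : L2 L} (hu : MemV L 2 u) (hv : MemV L 2 v) (i : Fin 3) :
    weakPartial L i (u + v) = weakPartial L i u + weakPartial L i v := by
  refine ext_fourierCoeff hL fun k l => ?_
  rw [fourierCoeff_add, (hu.add hL hv).fourierCoeff_weakPartial hL one_le_two,
    hu.fourierCoeff_weakPartial hL one_le_two, hv.fourierCoeff_weakPartial hL one_le_two,
    fourierCoeff_add]
  ring

lemma weakPartial_smul (hL : 0 < L) (a : ℝ) {u : L2 L} (hu : MemV L 2 u) (i : Fin 3) :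
    weakPartial L i (a • u) = a • weakPartial L i u := by
  refine ext_fourierCoeff hL fun k l => ?_
  rw [fourierCoeff_smul, (hu.smul a).fourierCoeff_weakPartial hL one_le_two,
    hu.fourierCoeff_weakPartial hL one_le_two, fourierCoeff_smul]
  ring

/-- The nonlinear term as a bilinear map on `V²`. -/
def bilin (hL : 0 < L) : V2 hL →ₗ[ℝ] V2 hL →ₗ[ℝ] L2 L :=
  LinearMap.mk₂ ℝ (fun u v => B L u v)
    (fun u u' v => by
      rw [B_eq hL u.2, B_eq hL u'.2, B_eq hL (u + u').2, ← map_add, ← MemLp.toLp_add]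
      congr 1
      refine MemLp.toLp_congr _ _ ?_
      filter_upwards [Lp.coeFn_add (u : L2 L) u'] with x hx
      simp only [advection, Submodule.coe_add, hx, Pi.add_apply, PiLp.add_apply, add_smul,
        Finset.sum_add_distrib])
    (fun a u v => by
      rw [B_eq hL u.2, B_eq hL (a • u).2, ← map_smul, ← MemLp.toLp_const_smul]
      congr 1
      refine MemLp.toLp_congr _ _ ?_
      filter_upwards [Lp.coeFn_smul a (u : L2 L)] with x hx
      simp only [advection, Submodule.coe_smul, hx, Pi.smul_apply, PiLp.smul_apply, smul_eq_mul,
        Finset.smul_sum, mul_smul])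
    (fun u v v' => by
      rw [B_eq hL u.2, B_eq hL u.2, B_eq hL u.2, ← map_add, ← MemLp.toLp_add]
      congr 1
      refine MemLp.toLp_congr _ _ ?_
      have h : ∀ᵐ x ∂μQ L, ∀ i, weakPartial L i (v + v' : L2 L) x
          = weakPartial L i v x + weakPartial L i v' x := by
        rw [ae_all_iff]
        intro i
        rw [weakPartial_add hL v.2 v'.2]
        filter_upwards [Lp.coeFn_add (weakPartial L i v) (weakPartial L i v')] with x hx
        rw [hx]; rfl
      filter_upwards [h] with x hx
      simp only [advection, Submodule.coe_add, hx, Pi.add_apply, smul_add,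
        Finset.sum_add_distrib])
    (fun a u v => by
      rw [B_eq hL u.2, B_eq hL u.2, ← map_smul, ← MemLp.toLp_const_smul]
      congr 1
      refine MemLp.toLp_congr _ _ ?_
      have h : ∀ᵐ x ∂μQ L, ∀ i, weakPartial L i (a • v : L2 L) x = a • weakPartial L i v x := by
        rw [ae_all_iff]
        intro i
        rw [weakPartial_smul hL a v.2]
        filter_upwards [Lp.coeFn_smul a (weakPartial L i v)] with x hx
        rw [hx]; rfl
      filter_upwards [h] with x hx
      simp only [advection, Submodule.coe_smul, hx, Pi.smul_apply, Finset.smul_sum, smul_comm a])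

lemma bilin_apply (hL : 0 < L) (u v : V2 hL) : bilin hL u v = B L u v := rfl

lemma B_sub_B (hL : 0 < L) {u v : L2 L} (hu : MemV L 2 u) (hv : MemV L 2 v) :
    B L v v - B L u u = B L (v - u) v + B L u (v - u) := by
  have h : bilin hL ⟨v, hv⟩ ⟨v, hv⟩ - bilin hL ⟨u, hu⟩ ⟨u, hu⟩
      = bilin hL (⟨v, hv⟩ - ⟨u, hu⟩) ⟨v, hv⟩ + bilin hL ⟨u, hu⟩ (⟨v, hv⟩ - ⟨u, hu⟩) := by
    rw [map_sub, map_sub, LinearMap.sub_apply]; abel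
  exact h

lemma fourierSobSq_eq_enorm (hL : 0 < L) (s : ℝ) (u : L2 L) :
    fourierSobSq L s u = ENNReal.ofReal (L ^ 3) *
      ∑ i, ∑' k, ENNReal.ofReal (waveSq L k ^ s) * ‖fourierCoeff L u k i‖ₑ ^ 2 := by
  rw [fourierSobSq, ← (Summable.tsum_finsetSum fun _ _ => ENNReal.summable), ← ENNReal.tsum_mul_left]
  refine tsum_congr fun k => ?_
  have hp := Real.rpow_nonneg (waveSq_nonneg (L := L) k) s
  rw [modeSq, ENNReal.ofReal_mul hp, ENNReal.ofReal_mul (by positivity),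
    ENNReal.ofReal_sum_of_nonneg fun _ _ => by positivity, mul_left_comm, Finset.mul_sum]
  simp only [ENNReal.ofReal_pow (norm_nonneg _), ofReal_norm]

lemma sum_sq_le_three (f : Fin 3 → ℝ≥0∞) : (∑ i, f i) ^ 2 ≤ 3 * ∑ i, f i ^ 2 := by
  have := tsum_sq_le_mul (x := f) (A := fun _ => 1) (B := fun i => f i ^ 2) fun l => by simp
  simpa [tsum_fintype] using this

/-- The estimate `‖B(u, v)‖_σ ≤ C ‖u‖_s ‖v‖_{s+1}` (in terms of squares). -/
theorem exists_sobSq_B_le (hL : 0 < L) (hw : IsStokesEigenbasis L w lam) {s σ : ℝ} (hσ : 0 < σ)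
    (hσs : σ ≤ s) (h : 3 / 2 < 2 * s - σ) : ∃ C : ℝ≥0∞, C ≠ ⊤ ∧ ∀ u v, MemV L 2 u → MemV L 2 v →
      sobSq w lam σ (B L u v) ≤ C * (sobSq w lam s u * sobSq w lam (s + 1) v) := by
  obtain ⟨C, hC, hconv⟩ := exists_convolution_bound hL hσ hσs h
  set K := ENNReal.ofReal (L ^ 3) with hK
  have hK0 : K ≠ 0 := by rw [hK, Ne, ENNReal.ofReal_eq_zero, not_le]; positivity
  have hKtop : K ≠ ⊤ := ENNReal.ofReal_ne_top
  refine ⟨C * 3 * K⁻¹, by finiteness, fun u v hu hv => ?_⟩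
  set G := (memLp_advection hL hu v).toLp with hG
  -- the Leray projection does not change the coefficients in the eigenbasis
  have e1 : sobSq w lam σ (B L u v) = sobSq w lam σ G := by
    rw [B_eq hL hu]
    exact tsum_congr fun j => by rw [inner_lerayProj (hw.memV j).1]
  set S : ℝ → L2 L → Fin 3 → ℝ≥0∞ := fun r u i =>
    ∑' k, ENNReal.ofReal (waveSq L k ^ r) * ‖fourierCoeff L u k i‖ₑ ^ 2 with hS
  have hF : ∀ r u, u ∈ H L → ∑ i, S r u i = K⁻¹ * sobSq w lam r u := fun r u hu => by
    rw [sobSq_eq_fourierSobSq hL hw r hu, fourierSobSq_eq_enorm hL,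
      ENNReal.inv_mul_cancel_left (fun h => absurd h hK0) (fun h => absurd h hKtop)]
  -- `a` majorizes the Fourier coefficients of `u`, and `b i` those of the gradient of `v i`
  set a : (Fin 3 → ℤ) → ℝ≥0∞ := fun k => ∑ j, ‖fourierCoeff L u k j‖ₑ with ha
  set b : Fin 3 → (Fin 3 → ℤ) → ℝ≥0∞ := fun i k =>
    ENNReal.ofReal (Real.sqrt (waveSq L k)) * ‖fourierCoeff L v k i‖ₑ with hb
  have ha0 : a 0 = 0 := by simp [ha, fourierCoeff_zero_of_mem hL hu.1]
  have hb0 : ∀ i, b i 0 = 0 := fun i => by simp [hb, waveSq_zero]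
  have hc : ∀ i k, ‖fourierCoeff L G k i‖ₑ ≤ ∑' l, a (k - l) * b i l := by
    intro i k
    have hm : ∀ j, MemLp (fun x => (u x j : ℂ) * (weakPartial L j v x i : ℂ)) 2 (μQ L) := by
      intro j
      have := (memLp_real_comp (weakPartial L j v) i).mul' (hu.memLp_top hL j) (r := 2)
      simpa using this.ofReal (K := ℂ)
    have h1 : fourierCoeff L G k i
        = ∑ j, coef L (fun x => (u x j : ℂ) * (weakPartial L j v x i : ℂ)) k := by
      rw [fourierCoeff_congr_ae (MemLp.coeFn_toLp (memLp_advection hL hu v)),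
        ← coef_sum _ fun j _ => hm j]
      congr 1
      funext x
      simp [advection]
    have h2 := hasSum_sum (s := Finset.univ) fun j _ =>
      hasSum_coef_mul hL (memLp_comp u j) (memLp_comp (weakPartial L j v) i) k
    rw [← h1] at h2
    refine h2.enorm_le_of_bounded ENNReal.summable.hasSum fun l => ?_
    rw [ha, Finset.sum_mul]
    refine enorm_sum_le_of_le _ fun j _ => ?_
    rw [← fourierCoeff_eq_coef, ← fourierCoeff_eq_coef, enorm_mul,
      hv.fourierCoeff_weakPartial hL one_le_two, enorm_mul]
    refine mul_le_mul_right ?_ _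
    refine mul_le_mul_left ?_ _
    rw [← ofReal_norm]
    refine ENNReal.ofReal_le_ofReal ?_
    simp only [norm_mul, Complex.norm_I, one_mul, Complex.norm_real, Real.norm_eq_abs]
    exact Real.abs_le_sqrt (wave_sq_le l j)
  have hA : ∑' k, ENNReal.ofReal (waveSq L k ^ s) * a k ^ 2 ≤ 3 * ∑ i, S s u i := by
    rw [hS, ← (Summable.tsum_finsetSum fun _ _ => ENNReal.summable), ← ENNReal.tsum_mul_left]
    refine ENNReal.tsum_le_tsum fun k => ?_
    rw [← Finset.mul_sum, mul_left_comm]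
    gcongr
    exact sum_sq_le_three _
  have hB : ∀ i, ∑' k, ENNReal.ofReal (waveSq L k ^ s) * b i k ^ 2 = S (s + 1) v i := by
    intro i
    refine tsum_congr fun k => ?_
    have hp := waveSq_nonneg (L := L) k
    rw [hb, mul_pow, ← mul_assoc, ← ENNReal.ofReal_pow (Real.sqrt_nonneg _), Real.sq_sqrt hp,
      ← ENNReal.ofReal_mul (Real.rpow_nonneg hp s), Real.rpow_add_one' hp (by linarith)]
  calc sobSq w lam σ (B L u v) ≤ fourierSobSq L σ G := e1 ▸ sobSq_le_fourierSobSq hL hw σ G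
    _ = K * ∑ i, S σ G i := fourierSobSq_eq_enorm hL σ G
    _ ≤ K * ∑ i, C * (3 * (∑ i, S s u i) * S (s + 1) v i) := by
        gcongr with i
        refine (hconv a (b i) _ ha0 (hb0 i) (hc i)).trans ?_
        rw [hB]
        gcongr
    _ = K * (C * (3 * (∑ i, S s u i) * ∑ i, S (s + 1) v i)) := by
        rw [← Finset.mul_sum, ← Finset.mul_sum]
    _ = K * (C * (3 * (K⁻¹ * sobSq w lam s u) * (K⁻¹ * sobSq w lam (s + 1) v))) := by
        rw [hF s u hu.1, hF (s + 1) v hv.1]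
    _ = (K * K⁻¹) * (C * 3 * K⁻¹ * (sobSq w lam s u * sobSq w lam (s + 1) v)) := by ring
    _ = _ := by rw [ENNReal.mul_inv_cancel hK0 hKtop, one_mul]

end

/-! ### Scalar evolution equations -/

section

/-- `y` is absolutely continuous on `[0, T]` with almost everywhere derivative `h`. -/
structure IsPrimitive (T : ℝ) (y h : ℝ → ℝ) : Prop where
  intervalIntegrable : IntervalIntegrable h volume 0 T
  eq_integral : ∀ t ∈ Icc 0 T, y t = y 0 + ∫ s in (0 : ℝ)..t, h s

namespace IsPrimitive

variable {T : ℝ} {y h : ℝ → ℝ}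

lemma mono (hy : IsPrimitive T y h) {t : ℝ} (ht : t ∈ Icc 0 T) : IsPrimitive t y h where
  intervalIntegrable := hy.intervalIntegrable.mono_set (by
    rw [uIcc_of_le ht.1, uIcc_of_le (ht.1.trans ht.2)]; exact Icc_subset_Icc_right ht.2)
  eq_integral s hs := hy.eq_integral s ⟨hs.1, hs.2.trans ht.2⟩

lemma continuousOn (hT : 0 ≤ T) (hy : IsPrimitive T y h) : ContinuousOn y (Icc 0 T) := by
  have h1 : ContinuousOn (fun t => y 0 + ∫ s in (0 : ℝ)..t, h s) (Icc 0 T) := by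
    refine continuousOn_const.add ?_
    have := intervalIntegral.continuousOn_primitive_interval
      (μ := volume) (f := h) (a := 0) (b := T) (by
        have := (intervalIntegrable_iff_integrableOn_Icc_of_le hT).1 hy.intervalIntegrable
        rwa [uIcc_of_le hT])
    rwa [uIcc_of_le hT] at this
  exact h1.congr hy.eq_integral

/-- The chain rule for the square of an absolutely continuous function. -/
lemma sq_eq (hT : 0 ≤ T) (hy : IsPrimitive T y h) :
    y T ^ 2 = y 0 ^ 2 + ∫ s in (0 : ℝ)..T, 2 * (y s * h s) := by
  set Y : ℝ → ℝ := fun t => y 0 + ∫ s in (0 : ℝ)..t, h s with hY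
  have hac : AbsolutelyContinuousOnInterval Y 0 T := by
    have h1 := hy.intervalIntegrable.absolutelyContinuousOnInterval_intervalIntegral
      (c := 0) left_mem_uIcc
    have h2 : AbsolutelyContinuousOnInterval (fun _ : ℝ => y 0) 0 T :=
      (LipschitzWith.const (y 0)).lipschitzOnWith.absolutelyContinuousOnInterval
    exact h2.add h1
  have h3 := hac.integral_deriv_mul_eq_sub hac
  have h4 : ∫ x in (0 : ℝ)..T, deriv Y x * Y x + Y x * deriv Y x
      = ∫ s in (0 : ℝ)..T, 2 * (y s * h s) := by
    refine intervalIntegral.integral_congr_ae ?_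
    filter_upwards [hy.intervalIntegrable.ae_hasDerivAt_integral] with x hx hxm
    have hx1 : x ∈ uIcc 0 T := uIoc_subset_uIcc hxm
    have hd : HasDerivAt Y (h x) x := (hx hx1 0 left_mem_uIcc).const_add (y 0)
    rw [uIcc_of_le hT] at hx1
    rw [hd.deriv, show Y x = y x from (hy.eq_integral x hx1).symm]
    ring
  rw [h4] at h3
  have h5 : Y T = y T := (hy.eq_integral T ⟨hT, le_rfl⟩).symm
  have h6 : Y 0 = y 0 := by simp [hY]
  rw [h5, h6] at h3
  rw [h3]; ring

/-- The energy estimate for `y' + μ y = g`: the dissipation absorbs half of the forcing term. -/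
lemma energy (hT : 0 ≤ T) (hy : IsPrimitive T y h) {μ : ℝ} (hμ : 0 < μ) :
    ENNReal.ofReal (y T ^ 2) + ENNReal.ofReal μ * ∫⁻ s in Ioc 0 T, ENNReal.ofReal (y s ^ 2)
      ≤ ENNReal.ofReal (y 0 ^ 2)
        + ENNReal.ofReal μ⁻¹ * ∫⁻ s in Ioc 0 T, ENNReal.ofReal ((h s + μ * y s) ^ 2) := by
  by_cases htop : ∫⁻ s in Ioc 0 T, ENNReal.ofReal ((h s + μ * y s) ^ 2) = ⊤
  · rw [htop, ENNReal.mul_top (by simpa using hμ)]; simp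
  have hc := hy.continuousOn hT
  have hhi : IntegrableOn h (Ioc 0 T) :=
    (intervalIntegrable_iff_integrableOn_Ioc_of_le hT).1 hy.intervalIntegrable
  have hyi2 : IntegrableOn (fun s => y s ^ 2) (Ioc 0 T) :=
    ((hc.pow 2).integrableOn_Icc).mono_set Ioc_subset_Icc_self
  have hyi : IntegrableOn y (Ioc 0 T) := (hc.integrableOn_Icc).mono_set Ioc_subset_Icc_self
  have hg2 : IntegrableOn (fun s => (h s + μ * y s) ^ 2) (Ioc 0 T) := by
    refine ⟨((hhi.1.add (hyi.1.const_mul μ)).pow 2), ?_⟩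
    rw [hasFiniteIntegral_iff_ofReal (Eventually.of_forall fun s => sq_nonneg _)]
    exact lt_top_iff_ne_top.mpr htop
  have hyh : IntegrableOn (fun s => 2 * (y s * h s)) (Ioc 0 T) := by
    have h1 : IntervalIntegrable (fun s => y s * h s) volume 0 T :=
      hy.intervalIntegrable.continuousOn_mul (by rwa [uIcc_of_le hT])
    exact ((intervalIntegrable_iff_integrableOn_Ioc_of_le hT).1 h1).const_mul 2
  rw [← ofReal_integral_eq_lintegral_ofReal hyi2 (Eventually.of_forall fun s => sq_nonneg _),
    ← ofReal_integral_eq_lintegral_ofReal hg2 (Eventually.of_forall fun s => sq_nonneg _),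
    ← ENNReal.ofReal_mul hμ.le, ← ENNReal.ofReal_mul (by positivity),
    ← ENNReal.ofReal_add (sq_nonneg _) (mul_nonneg hμ.le (integral_nonneg fun s => sq_nonneg _)),
    ← ENNReal.ofReal_add (sq_nonneg _)
      (mul_nonneg (by positivity) (integral_nonneg fun s => sq_nonneg _))]
  refine ENNReal.ofReal_le_ofReal ?_
  rw [hy.sq_eq hT, intervalIntegral.integral_of_le hT, ← integral_const_mul, ← integral_const_mul,
    add_assoc, ← integral_add hyh (hyi2.const_mul μ)]
  refine add_le_add le_rfl ?_
  refine integral_mono (hyh.add (hyi2.const_mul μ)) (hg2.const_mul _) fun s => ?_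
  change 2 * (y s * h s) + μ * y s ^ 2 ≤ μ⁻¹ * (h s + μ * y s) ^ 2
  rw [← div_eq_inv_mul, le_div_iff₀ hμ]
  nlinarith [sq_nonneg (h s)]

end IsPrimitive

/-- Grönwall's inequality in integral form. -/
lemma le_mul_exp_of_le_integral {T a k : ℝ} (hT : 0 ≤ T) (ha : 0 ≤ a) (hk : 0 ≤ k) {g : ℝ → ℝ}
    (hg : ContinuousOn g (Icc 0 T)) (hg0 : ∀ t ∈ Icc 0 T, 0 ≤ g t)
    (h : ∀ t ∈ Icc 0 T, g t ≤ a + k * ∫ s in (0 : ℝ)..t, g s) :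
    ∀ t ∈ Icc 0 T, g t ≤ a * Real.exp (k * t) := by
  set G := IccExtend hT ((Icc 0 T).domRestrict g) with hG
  have hGc : Continuous G := hg.domRestrict.Icc_extend'
  have hGe : ∀ t ∈ Icc 0 T, G t = g t := fun t ht => IccExtend_of_mem hT _ ht
  have hG0 : ∀ t, 0 ≤ G t := fun t => hg0 _ (projIcc 0 T hT t).2
  set Y : ℝ → ℝ := fun t => a + k * ∫ s in (0 : ℝ)..t, G s with hY
  have hd : ∀ t, HasDerivAt Y (k * G t) t := fun t =>
    ((hGc.integral_hasStrictDerivAt 0 t).hasDerivAt.const_mul k).const_add a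
  have hle : ∀ t ∈ Icc 0 T, G t ≤ Y t := fun t ht => by
    rw [hGe t ht]
    refine (h t ht).trans (le_of_eq ?_)
    rw [hY]
    congr 2
    refine intervalIntegral.integral_congr fun s hs => ?_
    rw [uIcc_of_le ht.1] at hs
    exact (hGe s ⟨hs.1, hs.2.trans ht.2⟩).symm
  have hgr := norm_le_gronwallBound_of_norm_deriv_right_le (f := Y) (f' := fun t => k * G t)
    (δ := a) (K := k) (ε := 0) (a := 0) (b := T)
    (fun t _ => (hd t).continuousAt.continuousWithinAt) (fun t _ => (hd t).hasDerivWithinAt)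
    (by simp [hY, abs_of_nonneg ha]) (fun t ht => by
      have h1 := hle t ⟨ht.1, ht.2.le⟩
      rw [Real.norm_eq_abs, Real.norm_eq_abs, abs_of_nonneg (mul_nonneg hk (hG0 t)), add_zero]
      exact mul_le_mul_of_nonneg_left (h1.trans (le_abs_self _)) hk)
  intro t ht
  have h1 := hgr t ht
  rw [gronwallBound_ε0, sub_zero] at h1
  rw [← hGe t ht]
  exact (hle t ht).trans ((le_abs_self _).trans h1)

/-- A continuous function that starts below `1`, and is below `1` at every time up to which it has
been at most `1`, stays below `1`. -/
lemma lt_one_of_bootstrap {T : ℝ} {g : ℝ → ℝ} (hg : ContinuousOn g (Icc 0 T)) (hg0 : g 0 < 1)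
    (h : ∀ t ∈ Icc 0 T, (∀ s ∈ Icc 0 t, g s ≤ 1) → g t < 1) : ∀ t ∈ Icc 0 T, g t < 1 := by
  by_contra! hcon
  obtain ⟨t₁, ht₁, h1⟩ := hcon
  set S := {t ∈ Icc 0 T | g t = 1} with hS
  have ivt : ∀ t ∈ Icc 0 T, 1 ≤ g t → ∃ s ∈ Icc 0 t, g s = 1 := fun t ht hgt =>
    intermediate_value_Icc ht.1 (hg.mono (Icc_subset_Icc_right ht.2)) ⟨hg0.le, hgt⟩
  have hne : S.Nonempty := by
    obtain ⟨s, hs, hs1⟩ := ivt t₁ ht₁ h1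
    exact ⟨s, ⟨hs.1, hs.2.trans ht₁.2⟩, hs1⟩
  have hcomp : IsCompact S := by
    have : IsClosed S := hg.preimage_isClosed_of_isClosed isClosed_Icc isClosed_singleton
    exact isCompact_Icc.of_isClosed_subset this fun t ht => ht.1
  obtain ⟨t₀, ht₀, hmin⟩ := hcomp.exists_isLeast hne
  have := h t₀ ht₀.1 fun s hs => by
    by_contra! hgt
    obtain ⟨r, hr, hr1⟩ := ivt s ⟨hs.1, hs.2.trans ht₀.1.2⟩ hgt.le
    have h2 := hmin ⟨⟨hr.1, hr.2.trans (hs.2.trans ht₀.1.2)⟩, hr1⟩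
    have h3 : s = t₀ := le_antisymm hs.2 (h2.trans hr.2)
    rw [h3, ht₀.2] at hgt
    exact lt_irrefl _ hgt
  exact absurd ht₀.2 this.ne

/-- Global solvability of `x(t) = F(t) + ∫₀ᵗ G(x)` after the argument of `G` has been truncated to
the cube of half-width `R`. -/
lemma exists_truncated_solution {n : ℕ} {T R : ℝ} (hT : 0 ≤ T) (hR : 0 ≤ R)
    {G : (Fin n → ℝ) → Fin n → ℝ} (hG : ContDiff ℝ 1 G) {F : ℝ → Fin n → ℝ}
    (hF : ContinuousOn F (Icc 0 T)) :
    ∃ x : ℝ → Fin n → ℝ, ContinuousOn x (Icc 0 T) ∧ ∀ t ∈ Icc 0 T,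
      x t = F t + ∫ s in (0 : ℝ)..t, G fun j => max (-R) (min R (x s j)) := by
  let clip : (Fin n → ℝ) → Fin n → ℝ := fun x j => max (-R) (min R (x j))
  have hclip : LipschitzWith 1 clip := by
    refine LipschitzWith.of_dist_le_mul fun x y => ?_
    rw [NNReal.coe_one, one_mul, dist_pi_le_iff dist_nonneg]
    intro j
    have h1 : LipschitzWith 1 fun r : ℝ => max (-R) (min R r) :=
      (LipschitzWith.id.const_min R).const_max (-R)
    have h2 := h1.dist_le_mul (x j) (y j)
    rw [NNReal.coe_one, one_mul] at h2
    exact h2.trans (dist_le_pi_dist x y j)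
  have hmem : ∀ x, clip x ∈ Metric.closedBall (0 : Fin n → ℝ) R := fun x => by
    rw [mem_closedBall_zero_iff, pi_norm_le_iff_of_nonneg hR]
    intro j
    rw [Real.norm_eq_abs, abs_le]
    exact ⟨le_max_left _ _, max_le (by linarith) (min_le_left _ _)⟩
  have hcomp := isCompact_closedBall (0 : Fin n → ℝ) R
  obtain ⟨K, hK⟩ := (hG.locallyLipschitz.locallyLipschitzOn
    (s := Metric.closedBall (0 : Fin n → ℝ) R)).exists_lipschitzOnWith_of_compact hcomp
  obtain ⟨M, hM⟩ := hcomp.exists_bound_of_continuousOn hG.continuous.continuousOn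
  have hM0 : 0 ≤ M := (norm_nonneg _).trans (hM _ (hmem 0))
  have hLip : LipschitzWith K (G ∘ clip) := by
    have := hK.comp (hclip.lipschitzOnWith (s := univ)) fun x _ => hmem x
    rw [mul_one, lipschitzOnWith_univ] at this
    exact this
  lift M to NNReal using hM0
  lift T to NNReal using hT
  -- Picard–Lindelöf for `y = x - F`, whose right-hand side is bounded and Lipschitz
  have hPL : IsPicardLindelof (fun t y => G (clip (y + F t))) (tmin := 0) (tmax := (T : ℝ))
      ⟨0, le_rfl, T.2⟩ 0 (M * T) 0 M K := by
    refine ⟨fun t _ => ?_, fun y _ => ?_, fun t _ y _ => hM _ (hmem _), ?_⟩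
    · refine (LipschitzWith.of_dist_le_mul fun y y' => ?_).lipschitzOnWith
      have := hLip.dist_le_mul (y + F t) (y' + F t)
      rwa [dist_add_right] at this
    · exact hLip.continuous.comp_continuousOn (continuousOn_const.add hF)
    · simp
  obtain ⟨y, hy0, hy⟩ := hPL.exists_eq_forall_mem_Icc_hasDerivWithinAt₀
  have hyc : ContinuousOn y (Icc 0 (T : ℝ)) := fun t ht => (hy t ht).continuousWithinAt
  refine ⟨fun t => F t + y t, hF.add hyc, fun t ht => ?_⟩
  have hsub : Icc 0 t ⊆ Icc 0 (T : ℝ) := Icc_subset_Icc_right ht.2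
  have hcont : ContinuousOn (fun s => G (clip (y s + F s))) (Icc 0 t) :=
    hLip.continuous.comp_continuousOn ((hyc.add hF).mono hsub)
  have h1 := intervalIntegral.integral_eq_sub_of_hasDerivAt_of_le ht.1 (hyc.mono hsub)
    (f' := fun s => G (clip (y s + F s))) (fun s hs => by
      refine (hy s ⟨hs.1.le, hs.2.le.trans ht.2⟩).hasDerivAt ?_
      exact Icc_mem_nhds hs.1 (hs.2.trans_le ht.2)) (by
      refine ContinuousOn.intervalIntegrable ?_
      rwa [uIcc_of_le ht.1])
  change y 0 = 0 at hy0
  rw [hy0, sub_zero] at h1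
  change F t + y t = _
  rw [← h1]
  congr 1
  refine intervalIntegral.integral_congr fun s _ => ?_
  simp only [clip, add_comm (y s), Pi.add_apply]

end

/-! ### Diagonal parabolic systems -/

section

variable {T ν : ℝ} {lam : ℕ → ℝ} {y h : ℕ → ℝ → ℝ}

/-- The `V^s` energy estimate for the diagonal system `y_j' + ν λ_j y_j = g_j`. -/
theorem diagonal_energy (hT : 0 ≤ T) (hν : 0 < ν) (hlam : ∀ j, 0 < lam j)
    (hy : ∀ j, IsPrimitive T (y j) (h j)) (s : ℝ) :
    ∑' j, ENNReal.ofReal (lam j ^ s * y j T ^ 2)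
        + ENNReal.ofReal ν * ∫⁻ t in Ioc 0 T, ∑' j, ENNReal.ofReal (lam j ^ (s + 1) * y j t ^ 2)
      ≤ ∑' j, ENNReal.ofReal (lam j ^ s * y j 0 ^ 2)
        + ENNReal.ofReal ν⁻¹ * ∫⁻ t in Ioc 0 T,
          ∑' j, ENNReal.ofReal (lam j ^ (s - 1) * (h j t + ν * lam j * y j t) ^ 2) := by
  have hym : ∀ j, AEMeasurable (y j) (volume.restrict (Ioc 0 T)) := fun j =>
    ((((hy j).continuousOn hT).integrableOn_Icc).mono_set Ioc_subset_Icc_self).1.aemeasurable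
  have hhm : ∀ j, AEMeasurable (h j) (volume.restrict (Ioc 0 T)) := fun j =>
    ((intervalIntegrable_iff_integrableOn_Ioc_of_le hT).1
      (hy j).intervalIntegrable).1.aemeasurable
  have hgm : ∀ j, AEMeasurable
      (fun t => ENNReal.ofReal (lam j ^ (s - 1) * (h j t + ν * lam j * y j t) ^ 2))
      (volume.restrict (Ioc 0 T)) := fun j =>
    ((((hhm j).add ((hym j).const_mul _)).pow_const 2).const_mul _).ennreal_ofReal
  rw [lintegral_tsum fun j => (((hym j).pow_const 2).const_mul _).ennreal_ofReal,
    lintegral_tsum hgm,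
    ← ENNReal.tsum_mul_left, ← ENNReal.tsum_mul_left, ← ENNReal.tsum_add, ← ENNReal.tsum_add]
  refine ENNReal.tsum_le_tsum fun j => ?_
  have hl := hlam j
  have h1 := mul_le_mul_right ((hy j).energy hT (mul_pos hν hl)) (ENNReal.ofReal (lam j ^ s))
  have e1 : ∀ r : ℝ, 0 ≤ r → ∀ g : ℝ → ℝ,
      ∫⁻ t in Ioc 0 T, ENNReal.ofReal (r * g t) = ENNReal.ofReal r *
        ∫⁻ t in Ioc 0 T, ENNReal.ofReal (g t) := fun r hr g => by
    rw [← lintegral_const_mul' _ _ ENNReal.ofReal_ne_top]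
    simp only [ENNReal.ofReal_mul hr]
  have q1 : 0 ≤ lam j ^ s := by positivity
  have q2 : 0 ≤ lam j ^ (s + 1) := by positivity
  have q3 : 0 ≤ lam j ^ (s - 1) := by positivity
  rw [e1 _ q2, e1 _ q3, ENNReal.ofReal_mul q1, ENNReal.ofReal_mul q1, ← mul_assoc, ← mul_assoc,
    ← ENNReal.ofReal_mul hν.le, ← ENNReal.ofReal_mul (inv_nonneg.2 hν.le)]
  have r1 : lam j ^ s * (ν * lam j) = ν * lam j ^ (s + 1) := by
    rw [Real.rpow_add_one hl.ne']; ring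
  have r2 : lam j ^ s * (ν * lam j)⁻¹ = ν⁻¹ * lam j ^ (s - 1) := by
    rw [Real.rpow_sub_one hl.ne']; field_simp
  rwa [mul_add, mul_add, ← mul_assoc, ← mul_assoc, ← ENNReal.ofReal_mul q1 (q := ν * lam j),
    ← ENNReal.ofReal_mul q1 (q := (ν * lam j)⁻¹), r1, r2] at h1

/-- Nonlinear comparison: a finite diagonal system with zero initial data whose forcing is
controlled, as long as the solution `φ` has norm at most one, by the norm of `φ` and a small source
`ρ`, stays small in `L^∞ V^m ∩ L² V^{m+1}`. -/
theorem diagonal_comparison (hT : 0 ≤ T) (hν : 0 < ν) (hlam : ∀ j, 0 < lam j)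
    (hy : ∀ j, IsPrimitive T (y j) (h j)) (h0 : ∀ j, y j 0 = 0) {n : ℕ}
    (hn : ∀ j, n ≤ j → ∀ t ∈ Icc 0 T, y j t = 0) {m K D : ℝ} (hK : 0 ≤ K) (hD : 0 ≤ D)
    {ρ : ℝ → ℝ≥0∞} (hρ : ∫⁻ t in Ioc 0 T, ρ t ≤ ENNReal.ofReal D)
    (hb : ∀ᵐ t ∂volume.restrict (Ioc 0 T), ∑' j, ENNReal.ofReal (lam j ^ m * y j t ^ 2) ≤ 1 →
      ∑' j, ENNReal.ofReal (lam j ^ (m - 1) * (h j t + ν * lam j * y j t) ^ 2)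
        ≤ ENNReal.ofReal K * (∑' j, ENNReal.ofReal (lam j ^ m * y j t ^ 2) + ρ t))
    (hsmall : K / ν * D * (Real.exp (K / ν * T) * (1 + K / ν * T)) < 1) :
    ∀ t ∈ Icc 0 T, ∑' j, ENNReal.ofReal (lam j ^ m * y j t ^ 2)
        + ENNReal.ofReal ν * ∫⁻ s in Ioc 0 t, ∑' j, ENNReal.ofReal (lam j ^ (m + 1) * y j s ^ 2)
      ≤ ENNReal.ofReal (K / ν * D * (Real.exp (K / ν * T) * (1 + K / ν * T))) := by
  set k := K / ν with hk
  have hk0 : 0 ≤ k := div_nonneg hK hν.le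
  set A := k * D with hA
  have hA0 : 0 ≤ A := mul_nonneg hk0 hD
  set g : ℝ → ℝ := fun t => ∑ j ∈ Finset.range n, lam j ^ m * y j t ^ 2 with hg
  have hw : ∀ j, 0 ≤ lam j ^ m := fun j => Real.rpow_nonneg (hlam j).le m
  have hg0 : ∀ t, 0 ≤ g t := fun t =>
    Finset.sum_nonneg fun j _ => mul_nonneg (hw j) (sq_nonneg _)
  have heg : ∀ t ∈ Icc 0 T, ∑' j, ENNReal.ofReal (lam j ^ m * y j t ^ 2) = ENNReal.ofReal (g t) := by
    intro t ht
    rw [ENNReal.ofReal_sum_of_nonneg fun j _ => mul_nonneg (hw j) (sq_nonneg _)]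
    refine tsum_eq_sum fun j hj => ?_
    rw [hn j (by simpa using hj) t ht]; simp
  have hgc : ContinuousOn g (Icc 0 T) := continuousOn_finsetSum _ fun j _ =>
    continuousOn_const.mul (((hy j).continuousOn hT).pow 2)
  -- the energy estimate up to a time until which the norm has been at most one
  have claim : ∀ t ∈ Icc 0 T, (∀ s ∈ Icc 0 t, g s ≤ 1) →
      ∑' j, ENNReal.ofReal (lam j ^ m * y j t ^ 2)
        + ENNReal.ofReal ν * ∫⁻ s in Ioc 0 t, ∑' j, ENNReal.ofReal (lam j ^ (m + 1) * y j s ^ 2)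
      ≤ ENNReal.ofReal (A + k * ∫ s in (0 : ℝ)..t, g s) := by
    intro t ht hle
    have hsub : Ioc 0 t ⊆ Ioc 0 T := Ioc_subset_Ioc_right ht.2
    refine (diagonal_energy ht.1 hν hlam (fun j => (hy j).mono ht) m).trans ?_
    have z : ∑' j, ENNReal.ofReal (lam j ^ m * y j 0 ^ 2) = 0 := by simp [h0]
    rw [z, zero_add]
    have hgi : IntegrableOn g (Ioc 0 t) :=
      ((hgc.mono (Icc_subset_Icc_right ht.2)).integrableOn_Icc).mono_set Ioc_subset_Icc_self
    have b1 : ∫⁻ s in Ioc 0 t,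
        ∑' j, ENNReal.ofReal (lam j ^ (m - 1) * (h j s + ν * lam j * y j s) ^ 2)
        ≤ ∫⁻ s in Ioc 0 t, ENNReal.ofReal K * (ENNReal.ofReal (g s) + ρ s) := by
      refine lintegral_mono_ae ?_
      filter_upwards [ae_restrict_of_ae_restrict_of_subset hsub hb,
        ae_restrict_mem measurableSet_Ioc] with s hs hsm
      have hsT : s ∈ Icc 0 T := ⟨hsm.1.le, hsm.2.trans ht.2⟩
      rw [heg s hsT] at hs
      refine hs ?_
      rw [← ENNReal.ofReal_one]
      exact ENNReal.ofReal_le_ofReal (hle s ⟨hsm.1.le, hsm.2⟩)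
    have b2 : ∫⁻ s in Ioc 0 t, ρ s ≤ ENNReal.ofReal D := (lintegral_mono_set hsub).trans hρ
    have b3 : ∫⁻ s in Ioc 0 t, ENNReal.ofReal (g s) = ENNReal.ofReal (∫ s in (0 : ℝ)..t, g s) := by
      rw [intervalIntegral.integral_of_le ht.1,
        ofReal_integral_eq_lintegral_ofReal hgi (Eventually.of_forall hg0)]
    have hI : 0 ≤ ∫ s in (0 : ℝ)..t, g s :=
      intervalIntegral.integral_nonneg ht.1 fun s _ => hg0 s
    calc _ ≤ ENNReal.ofReal ν⁻¹ * ∫⁻ s in Ioc 0 t, ENNReal.ofReal K * (ENNReal.ofReal (g s) + ρ s) :=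
          by gcongr
      _ = ENNReal.ofReal k * (ENNReal.ofReal (∫ s in (0 : ℝ)..t, g s) + ∫⁻ s in Ioc 0 t, ρ s) := by
          rw [lintegral_const_mul' _ _ ENNReal.ofReal_ne_top,
            lintegral_add_left' hgi.1.aemeasurable.ennreal_ofReal, b3, ← mul_assoc,
            ← ENNReal.ofReal_mul (by positivity), hk, div_eq_inv_mul]
      _ ≤ ENNReal.ofReal k * (ENNReal.ofReal (∫ s in (0 : ℝ)..t, g s) + ENNReal.ofReal D) := by
          gcongr
      _ = _ := by
          rw [← ENNReal.ofReal_add hI hD, ← ENNReal.ofReal_mul hk0]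
          congr 1
          rw [hA]; ring
  have claim2 : ∀ t ∈ Icc 0 T, (∀ s ∈ Icc 0 t, g s ≤ 1) → g t ≤ A * Real.exp (k * T) := by
    intro t ht hle
    have h1 := le_mul_exp_of_le_integral ht.1 hA0 hk0 (hgc.mono (Icc_subset_Icc_right ht.2))
      (fun s _ => hg0 s) (fun s hs => by
        have hsT : s ∈ Icc 0 T := ⟨hs.1, hs.2.trans ht.2⟩
        have h2 := claim s hsT fun r hr => hle r ⟨hr.1, hr.2.trans hs.2⟩
        rw [heg s hsT] at h2
        have hI : 0 ≤ ∫ s in (0 : ℝ)..s, g s :=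
          intervalIntegral.integral_nonneg hs.1 fun s _ => hg0 s
        exact (ENNReal.ofReal_le_ofReal_iff (by positivity)).1 (le_self_add.trans h2)) t ⟨ht.1, le_rfl⟩
    refine h1.trans ?_
    gcongr
    exact ht.2
  have hexp : A * Real.exp (k * T) ≤ A * (Real.exp (k * T) * (1 + k * T)) := by
    gcongr
    refine le_mul_of_one_le_right (Real.exp_pos _).le ?_
    linarith [mul_nonneg hk0 hT]
  have hlt := lt_one_of_bootstrap hgc (by simp [hg, h0]) fun t ht hle =>
    (claim2 t ht hle).trans_lt (hexp.trans_lt hsmall)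
  intro t ht
  have hle : ∀ r ∈ Icc 0 T, ∀ s ∈ Icc 0 r, g s ≤ 1 := fun r hr s hs =>
    (hlt s ⟨hs.1, hs.2.trans hr.2⟩).le
  refine (claim t ht (hle t ht)).trans (ENNReal.ofReal_le_ofReal ?_)
  have hI : ∫ s in (0 : ℝ)..t, g s ≤ T * (A * Real.exp (k * T)) := by
    have h1 : ∫ s in (0 : ℝ)..t, g s ≤ ∫ s in (0 : ℝ)..t, A * Real.exp (k * T) := by
      refine intervalIntegral.integral_mono_on ht.1 ?_ intervalIntegrable_const fun s hs => ?_
      · refine ContinuousOn.intervalIntegrable ?_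
        rw [uIcc_of_le ht.1]
        exact hgc.mono (Icc_subset_Icc_right ht.2)
      · have hsT : s ∈ Icc 0 T := ⟨hs.1, hs.2.trans ht.2⟩
        exact claim2 s hsT (hle s hsT)
    rw [intervalIntegral.integral_const, sub_zero, smul_eq_mul] at h1
    refine h1.trans ?_
    gcongr
    exact ht.2
  have h1 : (1 : ℝ) ≤ Real.exp (k * T) := Real.one_le_exp (mul_nonneg hk0 hT)
  calc A + k * ∫ s in (0 : ℝ)..t, g s ≤ A * Real.exp (k * T) + k * (T * (A * Real.exp (k * T))) := by
        gcongr
        exact le_mul_of_one_le_right hA0 h1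
    _ = _ := by ring

end

/-! ### Calculus of the squared Sobolev norms -/

section

variable {L ν T : ℝ} {w : ℕ → L2 L} {lam : ℕ → ℝ}

lemma sobSq_neg (s : ℝ) (u : L2 L) : sobSq w lam s (-u) = sobSq w lam s u := by
  simp [sobSq, inner_neg_left]

lemma sobSq_add_le (hw : IsStokesEigenbasis L w lam) (s : ℝ) (u v : L2 L) :
    sobSq w lam s (u + v) ≤ 2 * (sobSq w lam s u + sobSq w lam s v) := by
  rw [sobSq, sobSq, sobSq, ← ENNReal.tsum_add, ← ENNReal.tsum_mul_left]
  refine ENNReal.tsum_le_tsum fun j => ?_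
  have hp : 0 ≤ lam j ^ s := Real.rpow_nonneg (hw.pos j).le s
  rw [← ENNReal.ofReal_add (by positivity) (by positivity), two_mul,
    ← ENNReal.ofReal_add (by positivity) (by positivity), inner_add_left]
  refine ENNReal.ofReal_le_ofReal ?_
  nlinarith [mul_nonneg hp (sq_nonneg (⟪u, w j⟫ - ⟪v, w j⟫))]

lemma sobSq_sub_le (hw : IsStokesEigenbasis L w lam) (s : ℝ) (u v : L2 L) :
    sobSq w lam s (u - v) ≤ 2 * (sobSq w lam s u + sobSq w lam s v) := by
  rw [sub_eq_add_neg, ← sobSq_neg s v]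
  exact sobSq_add_le hw s u (-v)

/-- Poincaré's inequality: lower Sobolev norms are controlled by higher ones. -/
lemma sobSq_le_of_le (hw : IsStokesEigenbasis L w lam) {s r : ℝ} (h : s ≤ r) (u : L2 L) :
    sobSq w lam s u ≤ ENNReal.ofReal (lam 0 ^ (s - r)) * sobSq w lam r u := by
  rw [sobSq, sobSq, ← ENNReal.tsum_mul_left]
  refine ENNReal.tsum_le_tsum fun j => ?_
  rw [← ENNReal.ofReal_mul (Real.rpow_nonneg (hw.pos 0).le _), ← mul_assoc]
  refine ENNReal.ofReal_le_ofReal (mul_le_mul_of_nonneg_right ?_ (sq_nonneg _))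
  calc lam j ^ s = lam j ^ (s - r) * lam j ^ r := by rw [← Real.rpow_add (hw.pos j)]; simp
    _ ≤ lam 0 ^ (s - r) * lam j ^ r :=
      mul_le_mul_of_nonneg_right (Real.rpow_le_rpow_of_nonpos (hw.pos 0) (hw.mono (Nat.zero_le j))
        (by linarith)) (Real.rpow_nonneg (hw.pos j).le _)

lemma aemeasurable_sobSq_of_inner {μ : Measure ℝ} {F : ℝ → L2 L}
    (hF : ∀ j, AEMeasurable (fun t => ⟪F t, w j⟫) μ) (s : ℝ) :
    AEMeasurable (fun t => sobSq w lam s (F t)) μ :=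
  AEMeasurable.tsum fun j => (((hF j).pow_const 2).const_mul _).ennreal_ofReal

lemma aemeasurable_inner {μ : Measure ℝ} {F : ℝ → L2 L} (hF : AEStronglyMeasurable F μ) (v : L2 L) :
    AEMeasurable (fun t => ⟪F t, v⟫) μ :=
  (hF.inner aestronglyMeasurable_const).aemeasurable

lemma aemeasurable_sobSq {μ : Measure ℝ} {F : ℝ → L2 L} (hF : AEStronglyMeasurable F μ) (s : ℝ) :
    AEMeasurable (fun t => sobSq w lam s (F t)) μ :=
  aemeasurable_sobSq_of_inner (fun j => aemeasurable_inner hF (w j)) s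

/-- A triangle inequality for the norms `sobSq ^ (1 / 2)`; the constant `2` is not sharp. -/
lemma sqrt_sobSq_add_le (hw : IsStokesEigenbasis L w lam) (s : ℝ) (u v : L2 L) :
    sobSq w lam s (u + v) ^ (1 / 2 : ℝ)
      ≤ 2 * (sobSq w lam s u ^ (1 / 2 : ℝ) + sobSq w lam s v ^ (1 / 2 : ℝ)) := by
  have h2 : (2 : ℝ≥0∞) ^ (1 / 2 : ℝ) ≤ 2 := by
    calc (2 : ℝ≥0∞) ^ (1 / 2 : ℝ) ≤ 2 ^ (1 : ℝ) :=
          ENNReal.rpow_le_rpow_of_exponent_le (by norm_num) (by norm_num)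
      _ = 2 := ENNReal.rpow_one 2
  calc _ ≤ (2 * (sobSq w lam s u + sobSq w lam s v)) ^ (1 / 2 : ℝ) :=
        ENNReal.rpow_le_rpow (sobSq_add_le hw s u v) (by norm_num)
    _ = 2 ^ (1 / 2 : ℝ) * (sobSq w lam s u + sobSq w lam s v) ^ (1 / 2 : ℝ) :=
        ENNReal.mul_rpow_of_nonneg _ _ (by norm_num)
    _ ≤ _ := by
        gcongr
        exact ENNReal.rpow_add_le_add_rpow _ _ (by norm_num) (by norm_num)

lemma ofReal_vNorm (hL : 0 < L) (hw : IsStokesEigenbasis L w lam) {m : ℕ} {u : L2 L}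
    (hu : MemV L m u) : ENNReal.ofReal (vNorm L m u) = sobSq w lam m u ^ (1 / 2 : ℝ) := by
  rw [vNorm_eq hL hw m hu.1, Real.sqrt_eq_rpow,
    ← ENNReal.ofReal_rpow_of_nonneg ENNReal.toReal_nonneg (by norm_num),
    ENNReal.ofReal_toReal ((memV_iff hL hw m).1 hu).2.ne]

lemma vNorm_nonneg (m : ℕ) (u : L2 L) : 0 ≤ vNorm L m u := Real.sqrt_nonneg _

lemma enorm_vNorm (hL : 0 < L) (hw : IsStokesEigenbasis L w lam) {m : ℕ} {u : L2 L}
    (hu : MemV L m u) : ‖vNorm L m u‖ₑ = sobSq w lam m u ^ (1 / 2 : ℝ) := by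
  rw [← ofReal_vNorm hL hw hu, Real.enorm_eq_ofReal (vNorm_nonneg m u)]

lemma sobSq_eq_enorm_sq (hL : 0 < L) (hw : IsStokesEigenbasis L w lam) {m : ℕ} {u : L2 L}
    (hu : MemV L m u) : sobSq w lam m u = ‖vNorm L m u‖ₑ ^ (2 : ℝ) := by
  rw [enorm_vNorm hL hw hu, ← ENNReal.rpow_mul]; norm_num

/-! ### Functions of time in terms of their coefficients -/

lemma aestronglyMeasurable_vNorm (hL : 0 < L) (m : ℕ) {μ : Measure ℝ} {F : ℝ → L2 L}
    (hF : AEStronglyMeasurable F μ) : AEStronglyMeasurable (fun t => vNorm L m (F t)) μ := by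
  simp only [vNorm_eq_fourier hL]
  refine AEMeasurable.aestronglyMeasurable (Real.continuous_sqrt.measurable.comp_aemeasurable
    (AEMeasurable.ennreal_toReal (AEMeasurable.tsum fun k => ?_)))
  refine (AEMeasurable.const_mul ?_ _).ennreal_ofReal
  refine Finset.aemeasurable_fun_sum _ fun i _ => ?_
  exact (((continuous_fourierCoeff hL k i).comp_aestronglyMeasurable hF).norm.aemeasurable).pow_const 2

theorem memLpV_one_iff (hL : 0 < L) (hw : IsStokesEigenbasis L w lam) {m : ℕ} {F : ℝ → L2 L} :
    MemLpV L T 1 m F ↔ AEStronglyMeasurable F (volume.restrict (Ioc 0 T)) ∧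
      (∀ᵐ t ∂volume.restrict (Ioc 0 T), F t ∈ H L) ∧
      ∫⁻ t in Ioc 0 T, sobSq w lam m (F t) ^ (1 / 2 : ℝ) < ⊤ := by
  constructor
  · intro h
    refine ⟨h.1, h.2.mono fun t ht => ht.1, ?_⟩
    have := (eLpNorm_one_eq_lintegral_enorm (f := fun t => vNorm L m (F t))) ▸ h.3.2
    rwa [lintegral_congr_ae (h.2.mono fun t ht => enorm_vNorm hL hw ht)] at this
  · rintro ⟨h1, h2, h3⟩
    have hm : ∀ᵐ t ∂volume.restrict (Ioc 0 T), MemV L m (F t) := by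
      filter_upwards [h2, ae_lt_top' ((aemeasurable_sobSq h1 m).pow_const _) h3.ne] with t ht ht'
      exact (memV_iff hL hw m).2 ⟨ht, (ENNReal.rpow_lt_top_iff_of_pos (by norm_num)).1 ht'⟩
    refine ⟨h1, hm, aestronglyMeasurable_vNorm hL m h1, ?_⟩
    rwa [eLpNorm_one_eq_lintegral_enorm,
      lintegral_congr_ae (hm.mono fun t ht => enorm_vNorm hL hw ht)]

theorem memLpV_two_iff (hL : 0 < L) (hw : IsStokesEigenbasis L w lam) {m : ℕ} {F : ℝ → L2 L} :
    MemLpV L T 2 m F ↔ AEStronglyMeasurable F (volume.restrict (Ioc 0 T)) ∧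
      (∀ᵐ t ∂volume.restrict (Ioc 0 T), F t ∈ H L) ∧
      ∫⁻ t in Ioc 0 T, sobSq w lam m (F t) < ⊤ := by
  have key : ∀ g : ℝ → ℝ, eLpNorm g 2 (volume.restrict (Ioc 0 T)) < ⊤ ↔
      ∫⁻ t in Ioc 0 T, ‖g t‖ₑ ^ (2 : ℝ) < ⊤ := fun g => by
    rw [eLpNorm_lt_top_iff_lintegral_rpow_enorm_lt_top two_ne_zero ENNReal.ofNat_ne_top]
    simp
  constructor
  · intro h
    refine ⟨h.1, h.2.mono fun t ht => ht.1, ?_⟩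
    rw [lintegral_congr_ae (h.2.mono fun t ht => sobSq_eq_enorm_sq hL hw ht)]
    exact (key _).1 h.3.2
  · rintro ⟨h1, h2, h3⟩
    have hm : ∀ᵐ t ∂volume.restrict (Ioc 0 T), MemV L m (F t) := by
      filter_upwards [h2, ae_lt_top' (aemeasurable_sobSq h1 m) h3.ne] with t ht ht'
      exact (memV_iff hL hw m).2 ⟨ht, ht'⟩
    refine ⟨h1, hm, aestronglyMeasurable_vNorm hL m h1, (key _).2 ?_⟩
    rwa [← lintegral_congr_ae (hm.mono fun t ht => sobSq_eq_enorm_sq hL hw ht)]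

lemma MemLpV.exists_sobSq_le (hL : 0 < L) (hw : IsStokesEigenbasis L w lam) {m : ℕ} {F : ℝ → L2 L}
    (h : MemLpV L T ⊤ m F) : ∃ M : ℝ≥0∞, M ≠ ⊤ ∧
      ∀ᵐ t ∂volume.restrict (Ioc 0 T), sobSq w lam m (F t) ≤ M := by
  have h1 := h.3.2
  rw [eLpNorm_exponent_top] at h1
  refine ⟨eLpNormEssSup (fun t => vNorm L m (F t)) (volume.restrict (Ioc 0 T)) ^ (2 : ℝ),
    by finiteness, ?_⟩
  filter_upwards [h.2, enorm_ae_le_eLpNormEssSup (fun t => vNorm L m (F t))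
    (volume.restrict (Ioc 0 T))] with t ht ht'
  rw [sobSq_eq_enorm_sq hL hw ht]
  gcongr

lemma IsTimeDeriv.isPrimitive (hT : 0 ≤ T) {u u' : ℝ → L2 L} (h : IsTimeDeriv L T u u')
    (v : L2 L) : IsPrimitive T (fun t => ⟪u t, v⟫) (fun t => ⟪u' t, v⟫) where
  intervalIntegrable := by
    have := h.1
    rw [intervalIntegrable_iff] at this ⊢
    exact this.inner_const v
  eq_integral t ht := by
    have hi : IntervalIntegrable u' volume 0 t := h.1.mono_set (by
      rw [uIcc_of_le ht.1, uIcc_of_le hT]; exact Icc_subset_Icc_right ht.2)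
    have h2 := ContinuousLinearMap.intervalIntegral_comp_comm (innerSL ℝ v) hi
    simp only [innerSL_apply_apply] at h2
    simp only [real_inner_comm v] at h2 ⊢
    rw [h.2 t ht, inner_add_right, ← h2]

lemma IsTimeDeriv.continuousOn (hT : 0 ≤ T) {u u' : ℝ → L2 L} (h : IsTimeDeriv L T u u') :
    ContinuousOn u (Icc 0 T) := by
  have h1 : ContinuousOn (fun t => u 0 + ∫ s in (0 : ℝ)..t, u' s) (Icc 0 T) := by
    refine continuousOn_const.add ?_
    have := intervalIntegral.continuousOn_primitive_interval
      (μ := volume) (f := u') (a := 0) (b := T) (by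
        have := (intervalIntegrable_iff_integrableOn_Icc_of_le hT).1 h.1
        rwa [uIcc_of_le hT])
    rwa [uIcc_of_le hT] at this
  exact h1.congr h.2

/-! ### Regularity of the strong solution -/

/-- The coefficients of a solution of the equation solve a diagonal system. -/
lemma inner_equation (hL : 0 < L) (hw : IsStokesEigenbasis L w lam) {u u' b f : L2 L}
    (hu : MemV L 2 u) (h : u' + ν • stokes L u + b = f) (j : ℕ) :
    ⟪u', w j⟫ + ν * lam j * ⟪u, w j⟫ = ⟪f - b, w j⟫ := by
  rw [← h, add_sub_cancel_right, inner_add_left, real_inner_smul_left,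
    hw.inner_stokes_eq hL hu, mul_assoc]

/-- One step of the regularity argument: bounds in `L^∞ V^s ∩ L² V^{s+1}` give
`B(u, u) ∈ L² V^{s-3/4}`, and thus `u ∈ L^∞ V^{s+1/4} ∩ L² V^{s+5/4}`. -/
lemma IsStrongSolution.regularity_step (hL : 0 < L) (hν : 0 < ν) (hT : 0 ≤ T)
    (hw : IsStokesEigenbasis L w lam) {m : ℕ} {u₀ : L2 L} (hu₀ : MemV L m u₀) {f u : ℝ → L2 L}
    (hf : MemLpV L T 2 (m - 1) f) (hu : IsStrongSolution L ν T u₀ f u) {s : ℝ} (hs : 1 ≤ s)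
    (hsm : s + 1 / 4 ≤ m)
    (h : (∃ M : ℝ≥0∞, M ≠ ⊤ ∧ ∀ᵐ t ∂volume.restrict (Ioc 0 T), sobSq w lam s (u t) ≤ M) ∧
      ∫⁻ t in Ioc 0 T, sobSq w lam (s + 1) (u t) < ⊤) :
    (∃ M : ℝ≥0∞, M ≠ ⊤ ∧
        ∀ᵐ t ∂volume.restrict (Ioc 0 T), sobSq w lam (s + 1 / 4) (u t) ≤ M) ∧
      ∫⁻ t in Ioc 0 T, sobSq w lam (s + 1 / 4 + 1) (u t) < ⊤ := by
  obtain ⟨⟨M, hM, hle⟩, hint⟩ := h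
  obtain ⟨u', hu', heq⟩ := hu.equation
  -- the product estimate needs `2 s - σ > 3 / 2`; here `2 s - σ = s + 3 / 4 ≥ 7 / 4`
  obtain ⟨C, hC, hB⟩ := exists_sobSq_B_le hL hw (s := s) (σ := s - 3 / 4) (by linarith)
    (by linarith) (by linarith)
  have hm1 : 1 ≤ m := by
    have : (1 : ℝ) ≤ m := by linarith
    exact_mod_cast this
  obtain ⟨-, -, hfi⟩ := (memLpV_two_iff hL hw).1 hf
  have hcast : ((m - 1 : ℕ) : ℝ) = m - 1 := by push_cast [hm1]; ring
  rw [hcast] at hfi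
  set a := ENNReal.ofReal (lam 0 ^ (s - 3 / 4 - (m - 1 : ℝ))) with ha
  have hforce : ∫⁻ t in Ioc 0 T, ∑' j, ENNReal.ofReal
      (lam j ^ (s + 1 / 4 - 1) * (⟪u' t, w j⟫ + ν * lam j * ⟪u t, w j⟫) ^ 2) < ⊤ := by
    calc _ ≤ ∫⁻ t in Ioc 0 T, (2 * a * sobSq w lam (m - 1 : ℝ) (f t)
            + 2 * C * M * sobSq w lam (s + 1) (u t)) := by
          refine lintegral_mono_ae ?_
          filter_upwards [heq, hle, hu.memLp_two.2] with t h1 h2 h3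
          simp only [inner_equation hL hw h3 h1]
          rw [show s + 1 / 4 - 1 = s - 3 / 4 by ring]
          refine (sobSq_sub_le hw (s - 3 / 4) (f t) (B L (u t) (u t))).trans ?_
          rw [mul_add, mul_assoc, mul_assoc, mul_assoc]
          gcongr
          · exact sobSq_le_of_le hw (by linarith) _
          · exact (hB _ _ h3 h3).trans (by gcongr)
      _ = 2 * a * (∫⁻ t in Ioc 0 T, sobSq w lam (m - 1 : ℝ) (f t))
            + 2 * C * M * ∫⁻ t in Ioc 0 T, sobSq w lam (s + 1) (u t) := by
          rw [lintegral_add_left' ((aemeasurable_sobSq hf.1 _).const_mul _),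
            lintegral_const_mul' _ _ (by finiteness), lintegral_const_mul' _ _ (by finiteness)]
      _ < ⊤ := by finiteness
  have hen : ∀ t ∈ Icc 0 T, sobSq w lam (s + 1 / 4) (u t)
      + ENNReal.ofReal ν * ∫⁻ r in Ioc 0 t, sobSq w lam (s + 1 / 4 + 1) (u r)
      ≤ sobSq w lam (s + 1 / 4) u₀ + ENNReal.ofReal ν⁻¹ * ∫⁻ t in Ioc 0 T, ∑' j, ENNReal.ofReal
        (lam j ^ (s + 1 / 4 - 1) * (⟪u' t, w j⟫ + ν * lam j * ⟪u t, w j⟫) ^ 2) := by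
    intro t ht
    have h1 := diagonal_energy ht.1 hν hw.pos
      (fun j => (hu'.isPrimitive hT (w j)).mono ht) (s + 1 / 4)
    simp only [hu.initial] at h1
    refine h1.trans ?_
    unfold sobSq
    gcongr
    exact ht.2
  have h0 : sobSq w lam (s + 1 / 4) u₀ < ⊤ :=
    (sobSq_le_of_le hw hsm u₀).trans_lt
      (ENNReal.mul_lt_top ENNReal.ofReal_lt_top ((memV_iff hL hw m).1 hu₀).2)
  have hbd : sobSq w lam (s + 1 / 4) u₀ + ENNReal.ofReal ν⁻¹ * ∫⁻ t in Ioc 0 T, ∑' j,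
      ENNReal.ofReal (lam j ^ (s + 1 / 4 - 1) * (⟪u' t, w j⟫ + ν * lam j * ⟪u t, w j⟫) ^ 2) < ⊤ := by
    finiteness
  refine ⟨⟨_, hbd.ne, ?_⟩, ?_⟩
  · filter_upwards [ae_restrict_mem measurableSet_Ioc] with t ht
    exact le_self_add.trans (hen t (Ioc_subset_Icc_self ht))
  · have h1 := (le_add_self.trans (hen T ⟨hT, le_rfl⟩)).trans_lt hbd
    exact (ENNReal.mul_lt_top_iff.1 h1).elim (fun h => h.2) fun h => h.elim
      (fun h => absurd h (by simpa using hν)) fun h => h ▸ ENNReal.zero_lt_top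

/-- A strong solution with data of class `V^m` lies in `L^∞ V^m ∩ L² V^{m+1}`. -/
theorem IsStrongSolution.regularity (hL : 0 < L) (hν : 0 < ν) (hT : 0 ≤ T)
    (hw : IsStokesEigenbasis L w lam) {m : ℕ} (hm : 1 ≤ m) {u₀ : L2 L} (hu₀ : MemV L m u₀)
    {f u : ℝ → L2 L} (hf : MemLpV L T 2 (m - 1) f) (hu : IsStrongSolution L ν T u₀ f u) :
    (∃ M : ℝ≥0∞, M ≠ ⊤ ∧ ∀ᵐ t ∂volume.restrict (Ioc 0 T), sobSq w lam m (u t) ≤ M) ∧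
      ∫⁻ t in Ioc 0 T, sobSq w lam (m + 1) (u t) < ⊤ := by
  have key : ∀ k : ℕ, k ≤ 4 * (m - 1) →
      (∃ M : ℝ≥0∞, M ≠ ⊤ ∧
        ∀ᵐ t ∂volume.restrict (Ioc 0 T), sobSq w lam (1 + k / 4) (u t) ≤ M) ∧
      ∫⁻ t in Ioc 0 T, sobSq w lam (1 + k / 4 + 1) (u t) < ⊤ := by
    intro k
    induction k with
    | zero =>
      intro _
      simp only [Nat.cast_zero, zero_div, add_zero]
      have h1 := hu.memLp_top.exists_sobSq_le hL hw
      have h2 := ((memLpV_two_iff hL hw).1 hu.memLp_two).2.2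
      norm_num at h1 h2 ⊢
      exact ⟨h1, h2⟩
    | succ k ih =>
      intro hk
      have hle : (1 : ℝ) + k / 4 + 1 / 4 ≤ m := by
        have : ((k + 1 : ℕ) : ℝ) ≤ (4 * (m - 1) : ℕ) := by exact_mod_cast hk
        push_cast [hm] at this
        linarith
      have h1 := hu.regularity_step hL hν hT hw hu₀ hf (s := 1 + k / 4)
        (by have : (0 : ℝ) ≤ k := k.cast_nonneg; linarith) hle (ih (by omega))
      rwa [show (1 : ℝ) + k / 4 + 1 / 4 = 1 + ((k + 1 : ℕ) : ℝ) / 4 by push_cast; ring] at h1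
  have h1 := key (4 * (m - 1)) le_rfl
  rwa [show (1 : ℝ) + ((4 * (m - 1) : ℕ) : ℝ) / 4 = m by push_cast [hm]; ring] at h1

end

/-! ### The Galerkin projections -/

section

variable {L ν T : ℝ} {w : ℕ → L2 L} {lam : ℕ → ℝ}

lemma inner_galerkinProj (hw : IsStokesEigenbasis L w lam) (n : ℕ) (u : L2 L) (j : ℕ) :
    ⟪galerkinProj w n u, w j⟫ = if j < n then ⟪u, w j⟫ else 0 := by
  have h : ∀ i, ⟪w i, w j⟫ = if i = j then 1 else 0 :=
    fun i => orthonormal_iff_ite.1 hw.orthonormal i j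
  simp [galerkinProj, sum_inner, real_inner_smul_left, h]

lemma galerkinProj_mem (hw : IsStokesEigenbasis L w lam) (n : ℕ) (u : L2 L) :
    galerkinProj w n u ∈ H L :=
  (H L).sum_mem fun j _ => (H L).smul_mem _ (hw.memV j).1

lemma galerkinProj_sub (n : ℕ) (u v : L2 L) :
    galerkinProj w n (u - v) = galerkinProj w n u - galerkinProj w n v := by
  simp [galerkinProj, inner_sub_left, sub_smul]

lemma continuous_galerkinProj (n : ℕ) : Continuous (galerkinProj w n) := by
  unfold galerkinProj
  fun_prop

lemma memV_galerkinProj (hL : 0 < L) (hw : IsStokesEigenbasis L w lam) (n k : ℕ) (u : L2 L) :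
    MemV L k (galerkinProj w n u) := by
  refine (memV_iff hL hw k).2 ⟨galerkinProj_mem hw n u, ?_⟩
  rw [sobSq, tsum_eq_sum (s := Finset.range n)]
  · exact ENNReal.sum_lt_top.2 fun j _ => ENNReal.ofReal_lt_top
  · intro j hj
    rw [inner_galerkinProj hw, if_neg (by simpa using hj)]
    simp

lemma sobSq_galerkinProj_le (hw : IsStokesEigenbasis L w lam) (s : ℝ) (n : ℕ) (u : L2 L) :
    sobSq w lam s (galerkinProj w n u) ≤ sobSq w lam s u := by
  refine ENNReal.tsum_le_tsum fun j => ?_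
  rw [inner_galerkinProj hw]
  split_ifs
  · exact le_rfl
  · simp

lemma inner_sub_galerkinProj (hw : IsStokesEigenbasis L w lam) (n : ℕ) (u : L2 L) (j : ℕ) :
    ⟪u - galerkinProj w n u, w j⟫ = if j < n then 0 else ⟪u, w j⟫ := by
  rw [inner_sub_left, inner_galerkinProj hw]
  split_ifs <;> simp

lemma sobSq_sub_galerkinProj_le (hw : IsStokesEigenbasis L w lam) (s : ℝ) (n : ℕ) (u : L2 L) :
    sobSq w lam s (u - galerkinProj w n u) ≤ sobSq w lam s u := by
  refine ENNReal.tsum_le_tsum fun j => ?_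
  rw [inner_sub_galerkinProj hw]
  split_ifs
  · simp
  · exact le_rfl

lemma tendsto_sobSq_sub_galerkinProj (hw : IsStokesEigenbasis L w lam) {s : ℝ} {u : L2 L}
    (h : sobSq w lam s u ≠ ⊤) :
    Tendsto (fun n => sobSq w lam s (u - galerkinProj w n u)) atTop (𝓝 0) := by
  refine (ENNReal.tendsto_sum_nat_add _ h).congr fun n => ?_
  conv_rhs => rw [sobSq, ← Summable.sum_add_tsum_nat_add' (k := n) ENNReal.summable]
  rw [Finset.sum_eq_zero, zero_add]
  · exact tsum_congr fun i => by rw [inner_sub_galerkinProj hw, if_neg (by omega)]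
  · intro j hj
    rw [inner_sub_galerkinProj hw, if_pos (Finset.mem_range.1 hj)]
    simp

lemma lintegral_sobSq_le_of_le (hw : IsStokesEigenbasis L w lam) {s r : ℝ} (hsr : s ≤ r)
    {μ : Measure ℝ} (F : ℝ → L2 L) : ∫⁻ t, sobSq w lam s (F t) ∂μ
      ≤ ENNReal.ofReal (lam 0 ^ (s - r)) * ∫⁻ t, sobSq w lam r (F t) ∂μ := by
  rw [← lintegral_const_mul' _ _ ENNReal.ofReal_ne_top]
  exact lintegral_mono fun t => sobSq_le_of_le hw hsr (F t)

lemma lintegral_sobSq_ne_top_of_le (hw : IsStokesEigenbasis L w lam) {s r : ℝ} (hsr : s ≤ r)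
    {μ : Measure ℝ} {F : ℝ → L2 L} (h : ∫⁻ t, sobSq w lam r (F t) ∂μ ≠ ⊤) :
    ∫⁻ t, sobSq w lam s (F t) ∂μ ≠ ⊤ :=
  ne_top_of_le_ne_top (ENNReal.mul_ne_top ENNReal.ofReal_ne_top h)
    (lintegral_sobSq_le_of_le hw hsr F)

/-- The tails of a function of time with finite norm in a Bochner–Sobolev space tend to zero. -/
lemma tendsto_lintegral_sobSq_sub_galerkinProj (hw : IsStokesEigenbasis L w lam) {s p : ℝ}
    (hp : 0 < p) {μ : Measure ℝ} {F : ℝ → L2 L}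
    (hF : ∀ j, AEMeasurable (fun t => ⟪F t, w j⟫) μ) (h : ∫⁻ t, sobSq w lam s (F t) ^ p ∂μ ≠ ⊤) :
    Tendsto (fun n => ∫⁻ t, sobSq w lam s (F t - galerkinProj w n (F t)) ^ p ∂μ) atTop (𝓝 0) := by
  rw [← lintegral_zero (μ := μ)]
  refine tendsto_lintegral_of_dominated_convergence' (fun t => sobSq w lam s (F t) ^ p)
    (fun n => ?_) (fun n => Eventually.of_forall fun t => ?_) h ?_
  · refine (aemeasurable_sobSq_of_inner (fun j => ?_) s).pow_const p
    simp only [inner_sub_galerkinProj hw]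
    split_ifs
    · exact aemeasurable_const
    · exact hF j
  · exact ENNReal.rpow_le_rpow (sobSq_sub_galerkinProj_le hw s n (F t)) hp.le
  · filter_upwards [ae_lt_top' ((aemeasurable_sobSq_of_inner hF s).pow_const p) h] with t ht
    have h1 := tendsto_sobSq_sub_galerkinProj hw
      ((ENNReal.rpow_lt_top_iff_of_pos hp).1 ht).ne
    have h2 := (ENNReal.continuous_rpow_const (y := p)).tendsto 0 |>.comp h1
    rwa [ENNReal.zero_rpow_of_pos hp] at h2

/-! ### Convergence of the Galerkin approximations -/

/-- The forcing in the equation for `φ = v - Pₙu` is controlled by `φ` and the tail `u - Pₙu`. -/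
lemma exists_sobSq_B_sub_B_le (hL : 0 < L) (hw : IsStokesEigenbasis L w lam) {m : ℕ} (hm : 3 ≤ m)
    {M : ℝ≥0∞} (hM : M ≠ ⊤) : ∃ K : ℝ≥0∞, K ≠ ⊤ ∧ ∀ (n : ℕ) (u v : L2 L), MemV L 2 u →
      MemV L 2 v → sobSq w lam m u ≤ M → sobSq w lam m (v - galerkinProj w n u) ≤ 1 →
      sobSq w lam (m - 1) (B L u u - B L v v) ≤
        K * (sobSq w lam m (v - galerkinProj w n u) + sobSq w lam m (u - galerkinProj w n u)) := by
  have hm' : (3 : ℝ) ≤ m := by exact_mod_cast hm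
  -- the product estimate with `σ = s = m - 1` needs `m - 1 > 3 / 2`
  obtain ⟨C, hC, hB⟩ := exists_sobSq_B_le hL hw (s := m - 1) (σ := m - 1) (by linarith) le_rfl
    (by linarith)
  rw [sub_add_cancel] at hB
  set a := ENNReal.ofReal (lam 0 ^ ((m : ℝ) - 1 - m)) with ha
  refine ⟨2 * (C * (a * 2 * (2 * (1 + M))) + C * (a * M * 2)), by finiteness,
    fun n u v hu hv hu1 he => ?_⟩
  set e := sobSq w lam m (v - galerkinProj w n u) with he'
  set r := sobSq w lam m (u - galerkinProj w n u) with hr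
  have hd : sobSq w lam m (v - u) ≤ 2 * (e + r) := by
    rw [show v - u = (v - galerkinProj w n u) - (u - galerkinProj w n u) by abel]
    exact sobSq_sub_le hw m _ _
  have hv1 : sobSq w lam m v ≤ 2 * (1 + M) := by
    rw [show v = (v - galerkinProj w n u) + galerkinProj w n u by abel]
    exact (sobSq_add_le hw m _ _).trans
      (by gcongr; exact (sobSq_galerkinProj_le hw m n u).trans hu1)
  have hlow : ∀ x, sobSq w lam (m - 1) x ≤ a * sobSq w lam m x := fun x =>
    sobSq_le_of_le hw (by linarith) x
  have hvu := hv.sub hL hu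
  rw [← neg_sub (B L v v), sobSq_neg, B_sub_B hL hu hv]
  calc _ ≤ 2 * (sobSq w lam (m - 1) (B L (v - u) v) + sobSq w lam (m - 1) (B L u (v - u))) :=
        sobSq_add_le hw _ _ _
    _ ≤ 2 * (C * (a * (2 * (e + r)) * (2 * (1 + M))) + C * (a * M * (2 * (e + r)))) := by
        gcongr
        · refine (hB _ _ hvu hv).trans ?_
          gcongr
          exact (hlow _).trans (by gcongr)
        · refine (hB _ _ hu hvu).trans ?_
          gcongr
          exact (hlow _).trans (by gcongr)
    _ = _ := by ring

lemma IsPrimitive.sub {y z h k : ℝ → ℝ} (hy : IsPrimitive T y h)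
    (hz : IsPrimitive T z k) : IsPrimitive T (fun t => y t - z t) fun t => h t - k t where
  intervalIntegrable := hy.1.sub hz.1
  eq_integral t ht := by
    rw [hy.2 t ht, hz.2 t ht, intervalIntegral.integral_sub (hy.mono ht).1 (hz.mono ht).1]
    ring

/-- The difference between a Galerkin approximation and `Pₙu` tends to zero in
`L^∞ V^m ∩ L² V^{m+1}`. The approximation has to solve the Galerkin system only as long as the
difference is at most one, which covers truncated systems. -/
theorem IsStrongSolution.exists_galerkin_bound (hL : 0 < L) (hν : 0 < ν) (hT : 0 ≤ T)
    (hw : IsStokesEigenbasis L w lam) {m : ℕ} (hm : 3 ≤ m) {u₀ : L2 L} (hu₀ : MemV L m u₀)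
    {f u : ℝ → L2 L} (hf : MemLpV L T 2 (m - 1) f) (hu : IsStrongSolution L ν T u₀ f u) :
    ∃ δ : ℕ → ℝ, Tendsto δ atTop (𝓝 0) ∧ ∀ n, δ n < 1 → ∀ (v : ℝ → L2 L) (h : ℕ → ℝ → ℝ),
      (∀ t ∈ Icc 0 T, galerkinProj w n (v t) = v t) → v 0 = galerkinProj w n u₀ →
      (∀ j < n, IsPrimitive T (fun t => ⟪v t, w j⟫) (h j)) →
      (∀ᵐ t ∂volume.restrict (Ioc 0 T), sobSq w lam m (v t - galerkinProj w n (u t)) ≤ 1 →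
        ∀ j < n, h j t + ν * lam j * ⟪v t, w j⟫ = ⟪f t - B L (v t) (v t), w j⟫) →
      ∀ t ∈ Icc 0 T, sobSq w lam m (v t - galerkinProj w n (u t))
        + ENNReal.ofReal ν * ∫⁻ s in Ioc 0 t, sobSq w lam (m + 1) (v s - galerkinProj w n (u s))
        ≤ ENNReal.ofReal (δ n) := by
  obtain ⟨⟨M, hM, hle⟩, hint⟩ := hu.regularity hL hν hT hw (by omega) hu₀ hf
  obtain ⟨u', hu', heq⟩ := hu.equation
  obtain ⟨K, hK, hKle⟩ := exists_sobSq_B_sub_B_le hL hw hm hM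
  have hint' := lintegral_sobSq_ne_top_of_le hw (by linarith : (m : ℝ) ≤ m + 1) hint.ne
  have hD : ∀ n, ∫⁻ t in Ioc 0 T, sobSq w lam m (u t - galerkinProj w n (u t)) ≠ ⊤ := fun n =>
    ne_top_of_le_ne_top hint' (lintegral_mono fun t => sobSq_sub_galerkinProj_le hw m n (u t))
  refine ⟨fun n => K.toReal / ν *
    (∫⁻ t in Ioc 0 T, sobSq w lam m (u t - galerkinProj w n (u t))).toReal *
      (Real.exp (K.toReal / ν * T) * (1 + K.toReal / ν * T)), ?_, ?_⟩
  · have h1 := tendsto_lintegral_sobSq_sub_galerkinProj hw (s := m) one_pos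
      (fun j => aemeasurable_inner hu.memLp_two.aestronglyMeasurable (w j))
      (by simpa using hint')
    simp only [ENNReal.rpow_one] at h1
    have h2 := (ENNReal.tendsto_toReal ENNReal.zero_ne_top).comp h1
    simpa using ((h2.const_mul (K.toReal / ν)).mul_const
      (Real.exp (K.toReal / ν * T) * (1 + K.toReal / ν * T)))
  intro n hn v h hv hv0 hprim hsys
  have hy : ∀ j, IsPrimitive T (fun t => ⟪v t - galerkinProj w n (u t), w j⟫)
      (fun t => if j < n then h j t - ⟪u' t, w j⟫ else 0) := by
    intro j
    by_cases hj : j < n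
    · simp only [inner_sub_left, inner_galerkinProj hw, if_pos hj]
      exact (hprim j hj).sub (hu'.isPrimitive hT (w j))
    · simp only [if_neg hj]
      have h0 : ∀ t ∈ Icc 0 T, ⟪v t - galerkinProj w n (u t), w j⟫ = 0 := fun t ht => by
        rw [← hv t ht, inner_sub_left, inner_galerkinProj hw, inner_galerkinProj hw, if_neg hj,
          if_neg hj, sub_zero]
      exact ⟨by simp, fun t ht => by rw [h0 t ht, h0 0 ⟨le_rfl, hT⟩]; simp⟩
  refine diagonal_comparison hT hν hw.pos hy (fun j => ?_) (n := n) (fun j hj t ht => ?_)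
    ENNReal.toReal_nonneg ENNReal.toReal_nonneg (ENNReal.ofReal_toReal (hD n)).ge ?_ hn
  · rw [hv0, hu.initial, sub_self, inner_zero_left]
  · rw [← hv t ht, inner_sub_left, inner_galerkinProj hw, inner_galerkinProj hw,
      if_neg (by omega), if_neg (by omega), sub_zero]
  · filter_upwards [heq, hle, hu.memLp_two.2, hsys, ae_restrict_mem measurableSet_Ioc]
      with t h1 h2 h3 h4 h5 he
    rw [ENNReal.ofReal_toReal hK]
    have hv2 : MemV L 2 (v t) := by
      rw [← hv t (Ioc_subset_Icc_self h5)]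
      exact memV_galerkinProj hL hw n 2 _
    refine le_trans ?_ (hKle n (u t) (v t) h3 hv2 h2 he)
    refine ENNReal.tsum_le_tsum fun j => ?_
    by_cases hj : j < n
    · refine ENNReal.ofReal_le_ofReal (le_of_eq ?_)
      have e1 := h4 he j hj
      have e2 := inner_equation hL hw h3 h1 j
      rw [if_pos hj, inner_sub_left (v t), inner_galerkinProj hw, if_pos hj]
      rw [inner_sub_left] at e1 e2 ⊢
      congr 2
      linarith
    · rw [if_neg hj, ← hv t (Ioc_subset_Icc_self h5), inner_sub_left (galerkinProj w n (v t)),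
        inner_galerkinProj hw, inner_galerkinProj hw, if_neg hj, if_neg hj]
      simp

end

/-! ### Existence of Galerkin approximations -/

section

variable {L ν T : ℝ} {w : ℕ → L2 L} {lam : ℕ → ℝ}

lemma B_sum (hL : 0 < L) {ι : Type*} (S : Finset ι) (x : ι → ℝ) {W : ι → L2 L}
    (hW : ∀ i, MemV L 2 (W i)) : B L (∑ i ∈ S, x i • W i) (∑ i ∈ S, x i • W i)
      = ∑ i ∈ S, ∑ j ∈ S, (x i * x j) • B L (W i) (W j) := by
  let V : ι → V2 hL := fun i => ⟨W i, hW i⟩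
  have h1 : ∑ i ∈ S, x i • W i = ((∑ i ∈ S, x i • V i : V2 hL) : L2 L) := by
    simp [V]
  rw [h1, ← bilin_apply]
  simp only [map_sum, LinearMap.sum_apply, map_smul, LinearMap.smul_apply, bilin_apply, V,
    smul_smul, Finset.smul_sum]
  rw [Finset.sum_comm]
  exact Finset.sum_congr rfl fun i _ => Finset.sum_congr rfl fun j _ => by rw [mul_comm]

lemma sobSq_zero_eq (hw : IsStokesEigenbasis L w lam) {u : L2 L} (hu : u ∈ H L) :
    sobSq w lam 0 u = ‖u‖ₑ ^ (2 : ℝ) := by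
  simp only [sobSq, Real.rpow_zero, one_mul]
  rw [tsum_ofReal_inner_sq hw hu, ENNReal.ofReal_pow (norm_nonneg u), ofReal_norm]
  norm_cast

lemma MemLpV.integrableOn (hL : 0 < L) (hw : IsStokesEigenbasis L w lam) {m : ℕ} {F : ℝ → L2 L}
    (h : MemLpV L T 2 m F) : IntegrableOn F (Ioc 0 T) := by
  obtain ⟨h1, h2, h3⟩ := (memLpV_two_iff hL hw).1 h
  have h4 : MemLp F 2 (volume.restrict (Ioc 0 T)) := by
    refine ⟨h1, ?_⟩
    rw [eLpNorm_lt_top_iff_lintegral_rpow_enorm_lt_top two_ne_zero ENNReal.ofNat_ne_top]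
    rw [ENNReal.toReal_ofNat, ← lintegral_congr_ae (h2.mono fun t ht => sobSq_zero_eq hw ht)]
    exact (lintegral_sobSq_ne_top_of_le hw (Nat.cast_nonneg m) h3.ne).lt_top
  exact h4.integrable one_le_two

lemma inner_sum_smul (hw : IsStokesEigenbasis L w lam) {n : ℕ} (c : Fin n → ℝ) (i : ℕ) :
    ⟪∑ j, c j • w j, w i⟫ = if h : i < n then c ⟨i, h⟩ else 0 := by
  have h : ∀ j, ⟪w j, w i⟫ = if j = i then 1 else 0 :=
    fun j => orthonormal_iff_ite.1 hw.orthonormal j i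
  simp only [sum_inner, real_inner_smul_left, h]
  split_ifs with hi
  · rw [Finset.sum_eq_single ⟨i, hi⟩]
    · simp
    · intro j _ hj
      rw [if_neg fun h => hj (Fin.ext h), mul_zero]
    · simp
  · refine Finset.sum_eq_zero fun j _ => ?_
    rw [if_neg (by have := j.2; omega), mul_zero]

lemma sum_smul_mem (hw : IsStokesEigenbasis L w lam) {n : ℕ} (c : Fin n → ℝ) :
    ∑ j, c j • w j ∈ H L :=
  (H L).sum_mem fun j _ => (H L).smul_mem _ (hw.memV j).1

lemma galerkinProj_sum_smul (hw : IsStokesEigenbasis L w lam) {n : ℕ} (c : Fin n → ℝ) :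
    galerkinProj w n (∑ j, c j • w j) = ∑ j, c j • w j := by
  refine ext_of_inner_eigenbasis hw (galerkinProj_mem hw n _) (sum_smul_mem hw c) fun i => ?_
  rw [inner_galerkinProj hw, inner_sum_smul hw]
  split_ifs <;> rfl

/-- The right-hand side of the Galerkin system in coordinates, without the force. -/
def galerkinField (ν : ℝ) (w : ℕ → L2 L) (lam : ℕ → ℝ) (n : ℕ) (x : Fin n → ℝ) (j : Fin n) : ℝ :=
  -(ν * lam j * x j) - ∑ a, ∑ b, x a * x b * ⟪B L (w a) (w b), w j⟫

lemma contDiff_galerkinField (n : ℕ) : ContDiff ℝ 1 (galerkinField (L := L) ν w lam n) := by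
  rw [contDiff_pi]
  intro j
  unfold galerkinField
  fun_prop

lemma galerkinField_eq (hL : 0 < L) (hw : IsStokesEigenbasis L w lam) {n : ℕ} (x : Fin n → ℝ)
    (j : Fin n) : galerkinField ν w lam n x j
      = -(ν * lam j * x j) - ⟪B L (∑ j, x j • w j) (∑ j, x j • w j), w j⟫ := by
  rw [B_sum hL Finset.univ x fun j => hw.memV j]
  simp [galerkinField, sum_inner, real_inner_smul_left]

/-- As long as a combination of eigenfunctions is within distance one of `Pₙu` in `V^m`, its
coordinates are bounded in terms of `‖u‖`. -/
lemma abs_le_of_sobSq_sub_le_one (hw : IsStokesEigenbasis L w lam) {m : ℝ} (hm : 0 ≤ m) {n : ℕ}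
    {x : Fin n → ℝ} {u : L2 L}
    (h : sobSq w lam m (∑ j, x j • w j - galerkinProj w n u) ≤ 1) (j : Fin n) :
    |x j| ≤ √(lam 0 ^ m)⁻¹ + ‖u‖ := by
  have h1 := (ENNReal.le_tsum (j : ℕ)).trans h
  rw [inner_sub_left, inner_sum_smul hw, inner_galerkinProj hw, dif_pos j.2, if_pos j.2,
    ENNReal.ofReal_le_one] at h1
  have h0 : 0 < lam 0 ^ m := Real.rpow_pos_of_pos (hw.pos 0) m
  have h2 : lam 0 ^ m ≤ lam j ^ m :=
    Real.rpow_le_rpow (hw.pos 0).le (hw.mono (Nat.zero_le _)) hm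
  have h3 : |x j - ⟪u, w j⟫| ≤ √(lam 0 ^ m)⁻¹ := by
    refine Real.abs_le_sqrt ?_
    rw [← one_div, le_div_iff₀ h0, mul_comm]
    exact (mul_le_mul_of_nonneg_right h2 (sq_nonneg _)).trans h1
  have h4 : |⟪u, w j⟫| ≤ ‖u‖ := by
    simpa [hw.orthonormal.1 j] using abs_real_inner_le_norm u (w j)
  calc |x j| = |(x j - ⟪u, w j⟫) + ⟪u, w j⟫| := by rw [sub_add_cancel]
    _ ≤ _ := (abs_add_le _ _).trans (add_le_add h3 h4)

/-- Existence of a Galerkin approximation, from the bounds that the comparison with `Pₙu` gives for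
solutions of a truncated system. -/
theorem exists_isGalerkinSolution (hL : 0 < L) (hT : 0 ≤ T)
    (hw : IsStokesEigenbasis L w lam) {m : ℝ} (hm : 0 ≤ m) {u₀ : L2 L} {f u : ℝ → L2 L}
    (hf : IntegrableOn f (Ioc 0 T)) (hu : ContinuousOn u (Icc 0 T)) {n : ℕ}
    (hbound : ∀ (v : ℝ → L2 L) (h : ℕ → ℝ → ℝ),
      (∀ t ∈ Icc 0 T, galerkinProj w n (v t) = v t) → v 0 = galerkinProj w n u₀ →
      (∀ j < n, IsPrimitive T (fun t => ⟪v t, w j⟫) (h j)) →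
      (∀ᵐ t ∂volume.restrict (Ioc 0 T), sobSq w lam m (v t - galerkinProj w n (u t)) ≤ 1 →
        ∀ j < n, h j t + ν * lam j * ⟪v t, w j⟫ = ⟪f t - B L (v t) (v t), w j⟫) →
      ∀ t ∈ Icc 0 T, sobSq w lam m (v t - galerkinProj w n (u t)) ≤ 1) :
    ∃ v, IsGalerkinSolution L ν T w n u₀ f v := by
  obtain ⟨R₀, hR₀⟩ := isCompact_Icc.exists_bound_of_continuousOn hu
  have hR₀0 : 0 ≤ R₀ := (norm_nonneg _).trans (hR₀ 0 ⟨le_rfl, hT⟩)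
  -- the bound for the coordinates of `v` while `‖v - Pₙu‖_m ≤ 1`
  set R := √(lam 0 ^ m)⁻¹ + R₀ with hR
  have hR0 : 0 ≤ R := by positivity
  have hfj : ∀ v, IntervalIntegrable (fun t => ⟪f t, v⟫) volume 0 T := fun v =>
    (intervalIntegrable_iff_integrableOn_Ioc_of_le hT).2 (hf.inner_const v)
  set F : ℝ → Fin n → ℝ := fun t j => ⟪u₀, w j⟫ + ∫ s in (0 : ℝ)..t, ⟪f s, w j⟫ with hF
  have hFc : ContinuousOn F (Icc 0 T) := continuousOn_pi.2 fun j => by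
    refine IsPrimitive.continuousOn hT (h := fun t => ⟪f t, w j⟫) ⟨hfj _, fun t _ => ?_⟩
    simp [hF]
  set G := galerkinField (L := L) ν w lam n with hG
  have hGd : ContDiff ℝ 1 G := contDiff_galerkinField n
  obtain ⟨x, hxc, hx⟩ := exists_truncated_solution hT hR0 hGd hFc
  set g : ℝ → Fin n → ℝ := fun s => G fun j => max (-R) (min R (x s j)) with hg
  have hgc : ContinuousOn g (Icc 0 T) := hGd.continuous.comp_continuousOn
    (continuousOn_pi.2 fun j => continuousOn_const.sup
      (continuousOn_const.inf (continuousOn_pi.1 hxc j)))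
  set h : ℕ → ℝ → ℝ := fun j t => if hj : j < n then ⟪f t, w j⟫ + g t ⟨j, hj⟩ else 0 with hh
  have hprim : ∀ j : Fin n, IsPrimitive T (fun t => x t j) (h j) := by
    intro j
    have hgj : ContinuousOn (fun t => g t j) (Icc 0 T) := continuousOn_pi.1 hgc j
    have e1 : h j = fun t => ⟪f t, w j⟫ + g t j := by simp [hh]
    have hgi : IntervalIntegrable (fun t => g t j) volume 0 T :=
      ContinuousOn.intervalIntegrable (by rwa [uIcc_of_le hT])
    refine ⟨by rw [e1]; exact (hfj _).add hgi, fun t ht => ?_⟩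
    have hsub : uIcc 0 t ⊆ uIcc 0 T := by
      rw [uIcc_of_le ht.1, uIcc_of_le hT]; exact Icc_subset_Icc_right ht.2
    have hgit : IntervalIntegrable g volume 0 t :=
      ContinuousOn.intervalIntegrable (hgc.mono (by rwa [uIcc_of_le hT] at hsub))
    have e2 : (∫ s in (0 : ℝ)..t, g s) j = ∫ s in (0 : ℝ)..t, g s j :=
      ((ContinuousLinearMap.proj (R := ℝ) (φ := fun _ : Fin n => ℝ) j).intervalIntegral_comp_comm
        hgit).symm
    have e3 := congrFun (hx t ht) j
    have e4 := congrFun (hx 0 ⟨le_rfl, hT⟩) j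
    simp only [Pi.add_apply, hF, intervalIntegral.integral_same, add_zero, Pi.zero_apply] at e3 e4
    rw [e3, e4, e1, intervalIntegral.integral_add ((hfj _).mono_set hsub) (hgi.mono_set hsub), e2]
    ring
  set v : ℝ → L2 L := fun t => ∑ j, x t j • w j with hv
  have hvj : ∀ t (j : Fin n), ⟪v t, w j⟫ = x t j := fun t j => by
    rw [hv, inner_sum_smul hw, dif_pos j.2]
  have hv0 : v 0 = galerkinProj w n u₀ := by
    refine ext_of_inner_eigenbasis hw (sum_smul_mem hw _) (galerkinProj_mem hw n _) fun j => ?_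
    rw [inner_sum_smul hw, inner_galerkinProj hw]
    split_ifs with hj
    · have e4 := congrFun (hx 0 ⟨le_rfl, hT⟩) ⟨j, hj⟩
      simpa [hF] using e4
    · rfl
  -- where `v` is close to `Pₙu` the truncation is inactive
  have hinactive : ∀ t ∈ Icc 0 T, sobSq w lam m (v t - galerkinProj w n (u t)) ≤ 1 →
      ∀ j < n, h j t + ν * lam j * ⟪v t, w j⟫ = ⟪f t - B L (v t) (v t), w j⟫ := by
    intro t ht hle j hj
    have hcl : (fun j => max (-R) (min R (x t j))) = x t := by
      funext i
      have h1 : |x t i| ≤ R := (abs_le_of_sobSq_sub_le_one hw hm hle i).trans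
        (by rw [hR]; gcongr; exact hR₀ t ht)
      rw [abs_le] at h1
      rw [min_eq_right h1.2, max_eq_right h1.1]
    have e1 : h j t = ⟪f t, w j⟫ + galerkinField ν w lam n (x t) ⟨j, hj⟩ := by
      simp only [hh, dif_pos hj, hg, hcl, hG]
    rw [e1, galerkinField_eq hL hw, hvj t ⟨j, hj⟩, inner_sub_left]
    ring
  have hclose := hbound v h (fun t _ => galerkinProj_sum_smul hw (x t)) hv0
    (fun j hj => by
      have := hprim ⟨j, hj⟩
      simpa only [← hvj] using this)
    (by filter_upwards [ae_restrict_mem measurableSet_Ioc] with t ht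
        exact hinactive t (Ioc_subset_Icc_self ht))
  refine ⟨v, fun t _ => galerkinProj_sum_smul hw (x t), hv0, fun t => ∑ j : Fin n, h j t • w j,
    ⟨?_, fun t ht => ?_⟩, ?_⟩
  · have h1 := IntervalIntegrable.sum Finset.univ (μ := volume) (a := 0) (b := T)
      (f := fun (j : Fin n) t => h j t • w j) fun j _ =>
      ⟨(hprim j).1.1.smul_const (w j), (hprim j).1.2.smul_const (w j)⟩
    simpa only [Finset.sum_fn] using h1
  · have e1 : ∀ j : Fin n, IntervalIntegrable (fun s => h j s • w j) volume 0 t := fun j =>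
      ⟨((hprim j).mono ht).1.1.smul_const (w j), ((hprim j).mono ht).1.2.smul_const (w j)⟩
    rw [intervalIntegral.integral_finsetSum fun j _ => e1 j]
    simp only [intervalIntegral.integral_smul_const]
    rw [hv, ← Finset.sum_add_distrib]
    refine Finset.sum_congr rfl fun j _ => ?_
    rw [(hprim j).2 t ht, add_smul]
  · filter_upwards [ae_restrict_mem measurableSet_Ioc] with t ht
    have hv2 : MemV L 2 (v t) := by
      rw [show v t = galerkinProj w n (v t) from (galerkinProj_sum_smul hw (x t)).symm]
      exact memV_galerkinProj hL hw n 2 _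
    refine ext_of_inner_eigenbasis hw ((H L).add_mem ((H L).add_mem
      (sum_smul_mem hw fun j => h j t) ((H L).smul_mem _ (stokes_mem _))) (galerkinProj_mem hw n _))
      (galerkinProj_mem hw n _) fun j => ?_
    rw [inner_add_left, inner_add_left, real_inner_smul_left, hw.inner_stokes_eq hL hv2,
      inner_galerkinProj hw, inner_galerkinProj hw, inner_sum_smul hw fun j => h j t]
    split_ifs with hj
    · have e1 := hinactive t (Ioc_subset_Icc_self ht) (hclose t (Ioc_subset_Icc_self ht)) j hj
      rw [inner_sub_left] at e1
      linarith
    · rw [hv, inner_sum_smul hw, dif_neg hj]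
      simp

end

/-! ### Regularity of Galerkin approximations -/

section

variable {L ν T : ℝ} {w : ℕ → L2 L} {lam : ℕ → ℝ}

lemma exists_sobSq_B_le_natCast (hL : 0 < L) (hw : IsStokesEigenbasis L w lam) {k : ℕ}
    (hk : 2 ≤ k) : ∃ C : ℝ≥0∞, C ≠ ⊤ ∧ ∀ u v, MemV L 2 u → MemV L 2 v →
      sobSq w lam k (B L u v) ≤ C * (sobSq w lam k u * sobSq w lam (k + 1) v) := by
  have hk' : (2 : ℝ) ≤ k := by exact_mod_cast hk
  exact exists_sobSq_B_le hL hw (by linarith) le_rfl (by linarith)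

/-- The inverse inequality: on the span of `w 0, …, w (n - 1)` all Sobolev norms are controlled by the
`L²` norm. -/
lemma sobSq_le_of_galerkinProj_eq (hw : IsStokesEigenbasis L w lam) {s : ℝ} (hs : 0 ≤ s) {n : ℕ}
    {x : L2 L} (hx : galerkinProj w n x = x) :
    sobSq w lam s x ≤ ENNReal.ofReal (lam n ^ s * ‖x‖ ^ 2) := by
  have h0 : 0 ≤ lam n ^ s := Real.rpow_nonneg (hw.pos n).le s
  have hxH : x ∈ H L := hx ▸ galerkinProj_mem hw n x
  rw [ENNReal.ofReal_mul h0, ← tsum_ofReal_inner_sq hw hxH, ← ENNReal.tsum_mul_left]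
  refine ENNReal.tsum_le_tsum fun j => ?_
  rw [← ENNReal.ofReal_mul h0]
  refine ENNReal.ofReal_le_ofReal ?_
  by_cases hj : j < n
  · exact mul_le_mul_of_nonneg_right
      (Real.rpow_le_rpow (hw.pos j).le (hw.mono hj.le) hs) (sq_nonneg _)
  · rw [← hx, inner_galerkinProj hw, if_neg hj]
    simp

lemma vNorm_le_of_galerkinProj_eq (hL : 0 < L) (hw : IsStokesEigenbasis L w lam) (m : ℕ) {n : ℕ}
    {x : L2 L} (hx : galerkinProj w n x = x) :
    vNorm L m x ≤ √(lam n ^ (m : ℝ)) * ‖x‖ := by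
  have h0 : 0 ≤ lam n ^ (m : ℝ) := Real.rpow_nonneg (hw.pos n).le _
  have hxH : x ∈ H L := hx ▸ galerkinProj_mem hw n x
  rw [vNorm_eq hL hw m hxH, ← Real.sqrt_sq (norm_nonneg x), ← Real.sqrt_mul h0]
  refine Real.sqrt_le_sqrt (ENNReal.toReal_le_of_le_ofReal (by positivity) ?_)
  exact sobSq_le_of_galerkinProj_eq hw (Nat.cast_nonneg m) hx

section

variable {n : ℕ} {u₀ : L2 L} {f v : ℝ → L2 L}

lemma IsGalerkinSolution.continuousOn (hT : 0 ≤ T) (hv : IsGalerkinSolution L ν T w n u₀ f v) :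
    ContinuousOn v (Icc 0 T) := by
  obtain ⟨v', hv', -⟩ := hv.equation
  exact hv'.continuousOn hT

lemma IsGalerkinSolution.aestronglyMeasurable (hT : 0 ≤ T)
    (hv : IsGalerkinSolution L ν T w n u₀ f v) :
    AEStronglyMeasurable v (volume.restrict (Ioc 0 T)) :=
  ((hv.continuousOn hT).integrableOn_Icc.mono_set Ioc_subset_Icc_self).1

lemma IsGalerkinSolution.memV (hL : 0 < L) (hw : IsStokesEigenbasis L w lam)
    (hv : IsGalerkinSolution L ν T w n u₀ f v) (k : ℕ) {t : ℝ} (ht : t ∈ Icc 0 T) :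
    MemV L k (v t) :=
  hv.mem t ht ▸ memV_galerkinProj hL hw n k (v t)

lemma IsGalerkinSolution.exists_sobSq_le (hT : 0 ≤ T) (hw : IsStokesEigenbasis L w lam)
    (hv : IsGalerkinSolution L ν T w n u₀ f v) {s : ℝ} (hs : 0 ≤ s) :
    ∃ Z : ℝ≥0∞, Z ≠ ⊤ ∧ ∀ t ∈ Icc 0 T, sobSq w lam s (v t) ≤ Z := by
  obtain ⟨R, hR⟩ := isCompact_Icc.exists_bound_of_continuousOn (hv.continuousOn hT)
  have h0 : 0 ≤ lam n ^ s := Real.rpow_nonneg (hw.pos n).le s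
  refine ⟨ENNReal.ofReal (lam n ^ s * R ^ 2), ENNReal.ofReal_ne_top, fun t ht => ?_⟩
  refine (sobSq_le_of_galerkinProj_eq hw hs (hv.mem t ht)).trans (ENNReal.ofReal_le_ofReal ?_)
  have := hR t ht
  gcongr

lemma IsGalerkinSolution.exists_sobSq_B_le (hL : 0 < L) (hT : 0 ≤ T)
    (hw : IsStokesEigenbasis L w lam) (hv : IsGalerkinSolution L ν T w n u₀ f v) {k : ℕ}
    (hk : 2 ≤ k) : ∃ Z : ℝ≥0∞, Z ≠ ⊤ ∧ ∀ t ∈ Icc 0 T, sobSq w lam k (B L (v t) (v t)) ≤ Z := by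
  obtain ⟨C, hC, hB⟩ := exists_sobSq_B_le_natCast hL hw hk
  obtain ⟨Y, hY, hYle⟩ := hv.exists_sobSq_le hT hw (s := k) (Nat.cast_nonneg k)
  obtain ⟨Z, hZ, hZle⟩ := hv.exists_sobSq_le hT hw (s := k + 1) (by positivity)
  refine ⟨C * (Y * Z), by finiteness, fun t ht => ?_⟩
  refine (hB _ _ (hv.memV hL hw 2 ht) (hv.memV hL hw 2 ht)).trans ?_
  gcongr
  · exact hYle t ht
  · exact hZle t ht

lemma IsGalerkinSolution.aestronglyMeasurable_B (hL : 0 < L) (hT : 0 ≤ T)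
    (hw : IsStokesEigenbasis L w lam) (hv : IsGalerkinSolution L ν T w n u₀ f v) :
    AEStronglyMeasurable (fun t => B L (v t) (v t)) (volume.restrict (Ioc 0 T)) := by
  have hm : ∀ j, AEStronglyMeasurable (fun t => ⟪v t, w j⟫) (volume.restrict (Ioc 0 T)) :=
    fun j => (hv.aestronglyMeasurable hT).inner aestronglyMeasurable_const
  have h1 : AEStronglyMeasurable (fun t => ∑ i ∈ Finset.range n, ∑ j ∈ Finset.range n,
      (⟪v t, w i⟫ * ⟪v t, w j⟫) • B L (w i) (w j)) (volume.restrict (Ioc 0 T)) :=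
    Finset.aestronglyMeasurable_fun_sum _ fun i _ =>
      Finset.aestronglyMeasurable_fun_sum _ fun j _ => ((hm i).mul (hm j)).smul_const _
  refine h1.congr ?_
  filter_upwards [ae_restrict_mem measurableSet_Ioc] with t ht
  rw [← B_sum hL (Finset.range n) (fun j => ⟪v t, w j⟫) hw.memV]
  have h2 := hv.mem t (Ioc_subset_Icc_self ht)
  rw [galerkinProj] at h2
  rw [h2]

lemma IsGalerkinSolution.memC0V (hL : 0 < L) (hT : 0 ≤ T) (hw : IsStokesEigenbasis L w lam)
    (hv : IsGalerkinSolution L ν T w n u₀ f v) (m : ℕ) : MemC0V L T m v := by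
  refine ⟨fun t ht => hv.memV hL hw m ht, fun t ht => ?_⟩
  have h1 : Tendsto (fun s => √(lam n ^ (m : ℝ)) * ‖v s - v t‖) (𝓝[Icc 0 T] t) (𝓝 0) := by
    have h2 := (hv.continuousOn hT t ht).sub_const (v t) |>.norm.const_mul (√(lam n ^ (m : ℝ)))
    simpa [ContinuousWithinAt] using h2
  refine squeeze_zero' (Eventually.of_forall fun s => vNorm_nonneg m _) ?_ h1
  filter_upwards [self_mem_nhdsWithin] with s hs
  refine vNorm_le_of_galerkinProj_eq hL hw m ?_
  rw [galerkinProj_sub, hv.mem s hs, hv.mem t ht]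

lemma IsGalerkinSolution.memLpV_two (hL : 0 < L) (hT : 0 ≤ T) (hw : IsStokesEigenbasis L w lam)
    (hv : IsGalerkinSolution L ν T w n u₀ f v) (m : ℕ) : MemLpV L T 2 m v := by
  obtain ⟨Z, hZ, hZle⟩ := hv.exists_sobSq_le hT hw (s := m) (Nat.cast_nonneg m)
  refine (memLpV_two_iff hL hw).2 ⟨hv.aestronglyMeasurable hT, ?_, ?_⟩
  · filter_upwards [ae_restrict_mem measurableSet_Ioc] with t ht
    exact (hv.memV hL hw 2 (Ioc_subset_Icc_self ht)).1
  · refine (setLIntegral_mono measurable_const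
      fun t ht => hZle t (Ioc_subset_Icc_self ht)).trans_lt ?_
    rw [setLIntegral_const, Real.volume_Ioc]
    finiteness

/-- The residual of a Galerkin approximation is `Pₙf + (1 - Pₙ) B(v, v)`. -/
lemma galerkin_residual_eq {v₁ v₂ b g : L2 L}
    (h : v₁ + v₂ + galerkinProj w n b = galerkinProj w n g) :
    v₁ + v₂ + b = galerkinProj w n g + (b - galerkinProj w n b) := by
  rw [← h]; abel

variable {v' : ℝ → L2 L}

lemma IsGalerkinSolution.aestronglyMeasurable_residual (hL : 0 < L) (hT : 0 ≤ T)
    (hw : IsStokesEigenbasis L w lam) (hv : IsGalerkinSolution L ν T w n u₀ f v)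
    (hf : AEStronglyMeasurable f (volume.restrict (Ioc 0 T)))
    (heq : ∀ᵐ t ∂volume.restrict (Ioc 0 T),
      v' t + ν • stokes L (v t) + galerkinProj w n (B L (v t) (v t)) = galerkinProj w n (f t)) :
    AEStronglyMeasurable (fun t => v' t + ν • stokes L (v t) + B L (v t) (v t))
      (volume.restrict (Ioc 0 T)) := by
  have hB := hv.aestronglyMeasurable_B hL hT hw
  have hP := (continuous_galerkinProj (w := w) n)
  refine ((hP.comp_aestronglyMeasurable hf).add
    (hB.sub (hP.comp_aestronglyMeasurable hB))).congr ?_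
  filter_upwards [heq] with t ht
  exact (galerkin_residual_eq ht).symm

lemma residual_mem (hw : IsStokesEigenbasis L w lam)
    (heq : ∀ᵐ t ∂volume.restrict (Ioc 0 T),
      v' t + ν • stokes L (v t) + galerkinProj w n (B L (v t) (v t)) = galerkinProj w n (f t)) :
    ∀ᵐ t ∂volume.restrict (Ioc 0 T), v' t + ν • stokes L (v t) + B L (v t) (v t) ∈ H L := by
  filter_upwards [heq] with t ht
  rw [galerkin_residual_eq ht]
  exact (H L).add_mem (galerkinProj_mem hw n _) ((H L).sub_mem (B_mem _ _) (galerkinProj_mem hw n _))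

lemma IsGalerkinSolution.memLpV_two_residual (hL : 0 < L) (hT : 0 ≤ T)
    (hw : IsStokesEigenbasis L w lam) (hv : IsGalerkinSolution L ν T w n u₀ f v) {k : ℕ}
    (hk : 2 ≤ k) (hf : MemLpV L T 2 k f)
    (heq : ∀ᵐ t ∂volume.restrict (Ioc 0 T),
      v' t + ν • stokes L (v t) + galerkinProj w n (B L (v t) (v t)) = galerkinProj w n (f t)) :
    MemLpV L T 2 k (fun t => v' t + ν • stokes L (v t) + B L (v t) (v t)) := by
  obtain ⟨hf1, -, hf3⟩ := (memLpV_two_iff hL hw).1 hf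
  obtain ⟨Z, hZ, hZle⟩ := hv.exists_sobSq_B_le hL hT hw hk
  refine (memLpV_two_iff hL hw).2
    ⟨hv.aestronglyMeasurable_residual hL hT hw hf1 heq, residual_mem hw heq, ?_⟩
  calc _ ≤ ∫⁻ t in Ioc 0 T, 2 * (sobSq w lam k (f t) + Z) := by
        refine lintegral_mono_ae ?_
        filter_upwards [heq, ae_restrict_mem measurableSet_Ioc] with t ht htm
        rw [galerkin_residual_eq ht]
        refine (sobSq_add_le hw k _ _).trans ?_
        gcongr
        · exact sobSq_galerkinProj_le hw k n _
        · exact (sobSq_sub_galerkinProj_le hw k n _).trans (hZle t (Ioc_subset_Icc_self htm))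
    _ = 2 * ((∫⁻ t in Ioc 0 T, sobSq w lam k (f t)) + Z * ENNReal.ofReal T) := by
        rw [lintegral_const_mul' _ _ ENNReal.ofNat_ne_top,
          lintegral_add_left' (aemeasurable_sobSq hf1 _), setLIntegral_const, Real.volume_Ioc,
          sub_zero]
    _ < ⊤ := by finiteness

lemma IsGalerkinSolution.memLpV_one_residual (hL : 0 < L) (hT : 0 ≤ T)
    (hw : IsStokesEigenbasis L w lam) (hv : IsGalerkinSolution L ν T w n u₀ f v) {k : ℕ}
    (hk : 2 ≤ k) (hf : MemLpV L T 1 k f)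
    (heq : ∀ᵐ t ∂volume.restrict (Ioc 0 T),
      v' t + ν • stokes L (v t) + galerkinProj w n (B L (v t) (v t)) = galerkinProj w n (f t)) :
    MemLpV L T 1 k (fun t => v' t + ν • stokes L (v t) + B L (v t) (v t)) := by
  obtain ⟨hf1, -, hf3⟩ := (memLpV_one_iff hL hw).1 hf
  obtain ⟨Z, hZ, hZle⟩ := hv.exists_sobSq_B_le hL hT hw hk
  refine (memLpV_one_iff hL hw).2
    ⟨hv.aestronglyMeasurable_residual hL hT hw hf1 heq, residual_mem hw heq, ?_⟩
  calc _ ≤ ∫⁻ t in Ioc 0 T, 2 * (sobSq w lam k (f t) ^ (1 / 2 : ℝ) + Z ^ (1 / 2 : ℝ)) := by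
        refine lintegral_mono_ae ?_
        filter_upwards [heq, ae_restrict_mem measurableSet_Ioc] with t ht htm
        rw [galerkin_residual_eq ht]
        refine (sqrt_sobSq_add_le hw k _ _).trans ?_
        gcongr
        · exact sobSq_galerkinProj_le hw k n _
        · exact (sobSq_sub_galerkinProj_le hw k n _).trans (hZle t (Ioc_subset_Icc_self htm))
    _ = 2 * ((∫⁻ t in Ioc 0 T, sobSq w lam k (f t) ^ (1 / 2 : ℝ))
          + Z ^ (1 / 2 : ℝ) * ENNReal.ofReal T) := by
        rw [lintegral_const_mul' _ _ ENNReal.ofNat_ne_top,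
          lintegral_add_left' ((aemeasurable_sobSq hf1 _).pow_const _), setLIntegral_const,
          Real.volume_Ioc, sub_zero]
    _ < ⊤ := by finiteness

end

end

/-! ### Convergence of the residual -/

section

variable {L ν T : ℝ} {w : ℕ → L2 L} {lam : ℕ → ℝ}

lemma sqrt_le_one_add (x : ℝ≥0∞) : x ^ (1 / 2 : ℝ) ≤ 1 + x := by
  rcases le_total x 1 with h | h
  · exact (ENNReal.rpow_le_one h (by norm_num)).trans le_self_add
  · calc x ^ (1 / 2 : ℝ) ≤ x ^ (1 : ℝ) := ENNReal.rpow_le_rpow_of_exponent_le h (by norm_num)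
      _ = x := ENNReal.rpow_one x
      _ ≤ 1 + x := le_add_self

lemma lintegral_sqrt_mul_sqrt_le {α : Type*} [MeasurableSpace α] {μ : Measure α} {F G : α → ℝ≥0∞}
    (hF : AEMeasurable F μ) (hG : AEMeasurable G μ) :
    ∫⁻ t, F t ^ (1 / 2 : ℝ) * G t ^ (1 / 2 : ℝ) ∂μ
      ≤ (∫⁻ t, F t ∂μ) ^ (1 / 2 : ℝ) * (∫⁻ t, G t ∂μ) ^ (1 / 2 : ℝ) := by
  have h := ENNReal.lintegral_mul_le_Lp_mul_Lq μ Real.HolderConjugate.two_two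
    (hF.pow_const (1 / 2 : ℝ)) (hG.pow_const (1 / 2 : ℝ))
  have e : ∀ x : ℝ≥0∞, (x ^ (1 / 2 : ℝ)) ^ (2 : ℝ) = x := fun x => by
    rw [← ENNReal.rpow_mul]; norm_num
  simpa only [Pi.mul_apply, e] using h

/-- The product estimate for norms; the norm of `u` is taken in `V^{k+1}` although `V^k` would do,
which makes the time integral a pairing in `L² V^{k+1}`. -/
lemma exists_sqrt_sobSq_B_le (hL : 0 < L) (hw : IsStokesEigenbasis L w lam) {k : ℕ}
    (hk : 2 ≤ k) : ∃ C : ℝ≥0∞, C ≠ ⊤ ∧ ∀ u v, MemV L 2 u → MemV L 2 v →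
      sobSq w lam k (B L u v) ^ (1 / 2 : ℝ) ≤
        C * (sobSq w lam (k + 1) u ^ (1 / 2 : ℝ) * sobSq w lam (k + 1) v ^ (1 / 2 : ℝ)) := by
  obtain ⟨C, hC, hB⟩ := exists_sobSq_B_le_natCast hL hw hk
  set a := ENNReal.ofReal (lam 0 ^ ((k : ℝ) - (k + 1)))
  refine ⟨(C * a) ^ (1 / 2 : ℝ), by finiteness, fun u v hu hv => ?_⟩
  have h2 : (0 : ℝ) ≤ 1 / 2 := by norm_num
  rw [← ENNReal.mul_rpow_of_nonneg _ _ h2, ← ENNReal.mul_rpow_of_nonneg _ _ h2]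
  refine ENNReal.rpow_le_rpow ((hB u v hu hv).trans ?_) h2
  rw [mul_assoc, ← mul_assoc a]
  gcongr
  exact sobSq_le_of_le hw (by linarith) u

lemma exists_sqrt_sobSq_B_sub_B_le (hL : 0 < L) (hw : IsStokesEigenbasis L w lam) {k : ℕ}
    (hk : 2 ≤ k) : ∃ C : ℝ≥0∞, C ≠ ⊤ ∧ ∀ u v, MemV L 2 u → MemV L 2 v →
      sobSq w lam k (B L v v - B L u u) ^ (1 / 2 : ℝ) ≤
        C * (sobSq w lam (k + 1) (v - u) ^ (1 / 2 : ℝ) * sobSq w lam (k + 1) v ^ (1 / 2 : ℝ)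
          + sobSq w lam (k + 1) u ^ (1 / 2 : ℝ) * sobSq w lam (k + 1) (v - u) ^ (1 / 2 : ℝ)) := by
  obtain ⟨C, hC, hB⟩ := exists_sqrt_sobSq_B_le hL hw hk
  refine ⟨2 * C, by finiteness, fun u v hu hv => ?_⟩
  rw [B_sub_B hL hu hv, mul_assoc, mul_add C]
  refine (sqrt_sobSq_add_le hw k _ _).trans ?_
  have hd := hv.sub hL hu
  gcongr
  · exact hB _ _ hd hv
  · exact hB _ _ hu hd

/-- The residual of a Galerkin approximation is controlled by the tails of `f` and `B(u, u)` and
the distance to `u` in `L² V^{k+1}`. -/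
lemma exists_lintegral_residual_le (hL : 0 < L) (hw : IsStokesEigenbasis L w lam)
    {k : ℕ} (hk : 2 ≤ k) : ∃ C : ℝ≥0∞, C ≠ ⊤ ∧ ∀ {μ : Measure ℝ} {f u v r : ℝ → L2 L} {n : ℕ},
      AEStronglyMeasurable f μ → AEStronglyMeasurable u μ → AEStronglyMeasurable v μ →
      (∀ᵐ t ∂μ, MemV L 2 (u t)) → (∀ᵐ t ∂μ, MemV L 2 (v t)) →
      (∀ᵐ t ∂μ, r t
        = galerkinProj w n (f t) + (B L (v t) (v t) - galerkinProj w n (B L (v t) (v t)))) →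
      ∫⁻ t, sobSq w lam k (r t - f t) ^ (1 / 2 : ℝ) ∂μ ≤
        2 * (∫⁻ t, sobSq w lam k (f t - galerkinProj w n (f t)) ^ (1 / 2 : ℝ) ∂μ)
        + 4 * C * ((∫⁻ t, sobSq w lam (k + 1) (v t - u t) ∂μ) ^ (1 / 2 : ℝ)
              * (∫⁻ t, sobSq w lam (k + 1) (v t) ∂μ) ^ (1 / 2 : ℝ)
            + (∫⁻ t, sobSq w lam (k + 1) (u t) ∂μ) ^ (1 / 2 : ℝ)
              * (∫⁻ t, sobSq w lam (k + 1) (v t - u t) ∂μ) ^ (1 / 2 : ℝ))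
        + 4 * ∫⁻ t, sobSq w lam k
            (B L (u t) (u t) - galerkinProj w n (B L (u t) (u t))) ^ (1 / 2 : ℝ) ∂μ := by
  obtain ⟨C, hC, hB⟩ := exists_sqrt_sobSq_B_sub_B_le hL hw hk
  refine ⟨C, hC, fun {μ f u v r n} hf hu hv hu2 hv2 hr => ?_⟩
  have h2 : (0 : ℝ) ≤ 1 / 2 := by norm_num
  have hd := hv.sub hu
  have mf : AEMeasurable (fun t => sobSq w lam k (f t - galerkinProj w n (f t)) ^ (1 / 2 : ℝ)) μ :=
    (aemeasurable_sobSq (hf.sub ((continuous_galerkinProj n).comp_aestronglyMeasurable hf))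
      k).pow_const _
  have md := aemeasurable_sobSq (w := w) (lam := lam) hd (k + 1)
  have mu := aemeasurable_sobSq (w := w) (lam := lam) hu (k + 1)
  have mv := aemeasurable_sobSq (w := w) (lam := lam) hv (k + 1)
  have m1 : AEMeasurable (fun t => sobSq w lam (k + 1) (v t - u t) ^ (1 / 2 : ℝ)
      * sobSq w lam (k + 1) (v t) ^ (1 / 2 : ℝ)) μ := (md.pow_const _).mul (mv.pow_const _)
  have m2 : AEMeasurable (fun t => sobSq w lam (k + 1) (u t) ^ (1 / 2 : ℝ)
      * sobSq w lam (k + 1) (v t - u t) ^ (1 / 2 : ℝ)) μ := (mu.pow_const _).mul (md.pow_const _)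
  have m12 : AEMeasurable (fun t => 4 * C * (sobSq w lam (k + 1) (v t - u t) ^ (1 / 2 : ℝ)
      * sobSq w lam (k + 1) (v t) ^ (1 / 2 : ℝ) + sobSq w lam (k + 1) (u t) ^ (1 / 2 : ℝ)
      * sobSq w lam (k + 1) (v t - u t) ^ (1 / 2 : ℝ))) μ := (m1.add m2).const_mul _
  have mf2 := mf.const_mul 2
  calc _ ≤ ∫⁻ t, (2 * sobSq w lam k (f t - galerkinProj w n (f t)) ^ (1 / 2 : ℝ)
          + 4 * C * (sobSq w lam (k + 1) (v t - u t) ^ (1 / 2 : ℝ)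
              * sobSq w lam (k + 1) (v t) ^ (1 / 2 : ℝ)
            + sobSq w lam (k + 1) (u t) ^ (1 / 2 : ℝ)
              * sobSq w lam (k + 1) (v t - u t) ^ (1 / 2 : ℝ))
          + 4 * sobSq w lam k
            (B L (u t) (u t) - galerkinProj w n (B L (u t) (u t))) ^ (1 / 2 : ℝ)) ∂μ := by
        refine lintegral_mono_ae ?_
        filter_upwards [hu2, hv2, hr] with t h3 h4 h5
        set b := B L (v t) (v t) - B L (u t) (u t) with hb
        -- `r - f = -Qₙ f + Qₙ (B(v, v) - B(u, u)) + Qₙ B(u, u)`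
        have e1 : r t - f t = -(f t - galerkinProj w n (f t)) + ((b - galerkinProj w n b)
            + (B L (u t) (u t) - galerkinProj w n (B L (u t) (u t)))) := by
          rw [h5, hb, galerkinProj_sub]; abel
        rw [e1]
        refine (sqrt_sobSq_add_le hw k _ _).trans ?_
        rw [sobSq_neg, mul_add, add_assoc]
        gcongr
        calc _ ≤ 2 * (2 * (sobSq w lam k (b - galerkinProj w n b) ^ (1 / 2 : ℝ)
              + sobSq w lam k
                (B L (u t) (u t) - galerkinProj w n (B L (u t) (u t))) ^ (1 / 2 : ℝ))) := by
              gcongr; exact sqrt_sobSq_add_le hw k _ _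
          _ = 4 * sobSq w lam k (b - galerkinProj w n b) ^ (1 / 2 : ℝ)
              + 4 * sobSq w lam k
                (B L (u t) (u t) - galerkinProj w n (B L (u t) (u t))) ^ (1 / 2 : ℝ) := by ring
          _ ≤ _ := by
              rw [mul_assoc]
              gcongr
              exact (ENNReal.rpow_le_rpow (sobSq_sub_galerkinProj_le hw k n b) h2).trans
                (hB _ _ h3 h4)
    _ = 2 * (∫⁻ t, sobSq w lam k (f t - galerkinProj w n (f t)) ^ (1 / 2 : ℝ) ∂μ)
        + 4 * C * ((∫⁻ t, sobSq w lam (k + 1) (v t - u t) ^ (1 / 2 : ℝ)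
              * sobSq w lam (k + 1) (v t) ^ (1 / 2 : ℝ) ∂μ)
            + ∫⁻ t, sobSq w lam (k + 1) (u t) ^ (1 / 2 : ℝ)
              * sobSq w lam (k + 1) (v t - u t) ^ (1 / 2 : ℝ) ∂μ)
        + 4 * ∫⁻ t, sobSq w lam k
            (B L (u t) (u t) - galerkinProj w n (B L (u t) (u t))) ^ (1 / 2 : ℝ) ∂μ := by
        rw [lintegral_add_left' (by exact mf2.add m12), lintegral_add_left' mf2, lintegral_const_mul' _ _ ENNReal.ofNat_ne_top,
          lintegral_const_mul' _ _ (by finiteness), lintegral_const_mul' _ _ ENNReal.ofNat_ne_top,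
          lintegral_add_left' m1]
    _ ≤ _ := by
        gcongr
        · exact lintegral_sqrt_mul_sqrt_le md mv
        · exact lintegral_sqrt_mul_sqrt_le mu md

lemma ofReal_integral_vNorm_le (hL : 0 < L) (hw : IsStokesEigenbasis L w lam) (hT : 0 ≤ T) {k : ℕ}
    {F : ℝ → L2 L} (hF : ∀ᵐ t ∂volume.restrict (Ioc 0 T), MemV L k (F t)) :
    ENNReal.ofReal (∫ t in (0 : ℝ)..T, vNorm L k (F t))
      ≤ ∫⁻ t in Ioc 0 T, sobSq w lam k (F t) ^ (1 / 2 : ℝ) := by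
  rw [intervalIntegral.integral_of_le hT,
    ← lintegral_congr_ae (hF.mono fun t ht => enorm_vNorm hL hw ht)]
  refine le_trans ?_ (enorm_integral_le_lintegral_enorm _)
  rw [Real.enorm_eq_ofReal_abs]
  exact ENNReal.ofReal_le_ofReal (le_abs_self _)

/-- A bound in `L² V^{k+1}` controls the integral in the exponent of the test. -/
lemma integral_vNorm_add_vNorm_le (hL : 0 < L) (hw : IsStokesEigenbasis L w lam) (hT : 0 ≤ T)
    {k : ℕ} {F : ℝ → L2 L} (hF : ∀ᵐ t ∂volume.restrict (Ioc 0 T), MemV L (k + 1) (F t))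
    {V : ℝ≥0∞} (hV : V ≠ ⊤) (hle : ∫⁻ t in Ioc 0 T, sobSq w lam (k + 1) (F t) ≤ V) :
    ∫ t in (0 : ℝ)..T, (vNorm L k (F t) + vNorm L (k + 1) (F t))
      ≤ ((ENNReal.ofReal (lam 0 ^ ((k : ℝ) - (k + 1))) ^ (1 / 2 : ℝ) + 1)
          * (ENNReal.ofReal T + V)).toReal := by
  set a := ENNReal.ofReal (lam 0 ^ ((k : ℝ) - (k + 1))) ^ (1 / 2 : ℝ) with ha
  rw [← ENNReal.ofReal_le_iff_le_toReal (by finiteness), intervalIntegral.integral_of_le hT]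
  have h1 : ENNReal.ofReal (∫ t in Ioc 0 T, (vNorm L k (F t) + vNorm L (k + 1) (F t)))
      ≤ ∫⁻ t in Ioc 0 T, ‖vNorm L k (F t) + vNorm L (k + 1) (F t)‖ₑ := by
    refine le_trans ?_ (enorm_integral_le_lintegral_enorm _)
    rw [Real.enorm_eq_ofReal_abs]
    exact ENNReal.ofReal_le_ofReal (le_abs_self _)
  refine h1.trans ?_
  calc _ ≤ ∫⁻ t in Ioc 0 T, (a + 1) * (1 + sobSq w lam (k + 1) (F t)) := by
        refine lintegral_mono_ae ?_
        filter_upwards [hF] with t ht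
        have htk : MemV L k (F t) := (memV_iff hL hw k).2 ⟨ht.1,
          (sobSq_le_of_le hw (by push_cast; linarith) (F t)).trans_lt
            (ENNReal.mul_lt_top ENNReal.ofReal_lt_top ((memV_iff hL hw (k + 1)).1 ht).2)⟩
        refine (enorm_add_le _ _).trans ?_
        rw [enorm_vNorm hL hw htk, enorm_vNorm hL hw ht]
        push_cast
        calc _ ≤ a * sobSq w lam (k + 1) (F t) ^ (1 / 2 : ℝ)
              + 1 * sobSq w lam (k + 1) (F t) ^ (1 / 2 : ℝ) := by
              rw [one_mul, ha, ← ENNReal.mul_rpow_of_nonneg _ _ (by norm_num)]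
              gcongr
              exact sobSq_le_of_le hw (by linarith) (F t)
          _ ≤ _ := by
              rw [← add_mul]
              gcongr
              exact sqrt_le_one_add _
    _ = (a + 1) * (ENNReal.ofReal T + ∫⁻ t in Ioc 0 T, sobSq w lam (k + 1) (F t)) := by
        rw [lintegral_const_mul' _ _ (by finiteness), lintegral_add_left measurable_const,
          setLIntegral_const, Real.volume_Ioc, sub_zero, one_mul]
    _ ≤ _ := by gcongr

/-- The equation itself shows that `B(u, u)` is measurable in time. -/
lemma IsStrongSolution.aemeasurable_inner_B (hL : 0 < L) (hT : 0 ≤ T)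
    (hw : IsStokesEigenbasis L w lam) {u₀ : L2 L} {f u : ℝ → L2 L}
    (hf : AEStronglyMeasurable f (volume.restrict (Ioc 0 T)))
    (hu : IsStrongSolution L ν T u₀ f u) (j : ℕ) :
    AEMeasurable (fun t => ⟪B L (u t) (u t), w j⟫) (volume.restrict (Ioc 0 T)) := by
  obtain ⟨u', hu', heq⟩ := hu.equation
  have hu'm := ((intervalIntegrable_iff_integrableOn_Ioc_of_le hT).1 hu'.1).1
  refine ((aemeasurable_inner hf (w j)).sub ((aemeasurable_inner hu'm (w j)).add
    ((aemeasurable_inner hu.memLp_two.1 (w j)).const_mul (ν * lam j)))).congr ?_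
  filter_upwards [heq, hu.memLp_two.2] with t h1 h2
  have := inner_equation hL hw h2 h1 j
  rw [inner_sub_left] at this
  simp only [Pi.sub_apply, Pi.add_apply]
  linarith

end

end NavierStokes

end

theorem mainTheorem4 (L ν T : ℝ) (hL : 0 < L) (hν : 0 < ν) (hT : 0 < T)
    (m : ℕ) (hm : 3 ≤ m) (c : ℝ) (hc : 0 < c)
    (w : ℕ → L2 L) (lam : ℕ → ℝ) (hw : IsStokesEigenbasis L w lam)
    (u₀ : L2 L) (hu₀ : MemV L m u₀)
    (f : ℝ → L2 L) (hf₁ : MemLpV L T 1 m f) (hf₂ : MemLpV L T 2 (m - 1) f)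
    (u : ℝ → L2 L) (hu : IsStrongSolution L ν T u₀ f u) :
    ∃ N : ℕ, ∀ n ≥ N,
      (∃ v : ℝ → L2 L, IsGalerkinSolution L ν T w n u₀ f v) ∧
      ∀ v : ℝ → L2 L, IsGalerkinSolution L ν T w n u₀ f v → PassesTest L ν T m c u₀ f v := by
  obtain ⟨-, hU⟩ := hu.regularity hL hν hT.le hw (by omega) hu₀ hf₂
  obtain ⟨δ, hδ, hbound⟩ := hu.exists_galerkin_bound hL hν hT.le hw hm hu₀ hf₂
  obtain ⟨C, hC, hres⟩ := exists_lintegral_residual_le hL hw (k := m) (by omega)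
  obtain ⟨Cu, hCu, hBu⟩ := exists_sqrt_sobSq_B_le hL hw (k := m) (by omega)
  have hum := hu.memLp_two.aestronglyMeasurable
  set U := ∫⁻ t in Ioc 0 T, sobSq w lam (m + 1) (u t) with hUdef
  set α : ℕ → ℝ≥0∞ := fun n => sobSq w lam m (u₀ - galerkinProj w n u₀) ^ (1 / 2 : ℝ) with hα
  set β : ℕ → ℝ≥0∞ := fun n =>
    ∫⁻ t in Ioc 0 T, sobSq w lam m (f t - galerkinProj w n (f t)) ^ (1 / 2 : ℝ) with hβ
  set γ : ℕ → ℝ≥0∞ := fun n => ∫⁻ t in Ioc 0 T, sobSq w lam m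
    (B L (u t) (u t) - galerkinProj w n (B L (u t) (u t))) ^ (1 / 2 : ℝ) with hγ
  set τ : ℕ → ℝ≥0∞ := fun n =>
    ∫⁻ t in Ioc 0 T, sobSq w lam (m + 1) (u t - galerkinProj w n (u t)) with hτ
  -- `ε n` will bound `∫ ‖v - u‖²_{m+1}`, and `V` will bound `∫ ‖v‖²_{m+1}`
  set ε : ℕ → ℝ≥0∞ := fun n => 2 * (ENNReal.ofReal ν⁻¹ * ENNReal.ofReal (δ n) + τ n) with hε
  set V : ℝ≥0∞ := 2 * (ENNReal.ofReal ν⁻¹ + U) with hV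
  have hVtop : V ≠ ⊤ := by finiteness
  -- `η n` will bound the left-hand side of the test
  set η : ℕ → ℝ≥0∞ := fun n => α n + (2 * β n
    + 4 * C * (ε n ^ (1 / 2 : ℝ) * V ^ (1 / 2 : ℝ) + U ^ (1 / 2 : ℝ) * ε n ^ (1 / 2 : ℝ))
    + 4 * γ n) with hη
  have hpos : (0 : ℝ) < 1 / 2 := by norm_num
  have hsqrt0 : ∀ {a : ℕ → ℝ≥0∞}, Tendsto a atTop (𝓝 0) →
      Tendsto (fun n => a n ^ (1 / 2 : ℝ)) atTop (𝓝 0) := fun {a} ha => by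
    have h := (ENNReal.continuous_rpow_const (y := 1 / 2)).tendsto 0 |>.comp ha
    rwa [ENNReal.zero_rpow_of_pos hpos] at h
  have hα0 : Tendsto α atTop (𝓝 0) :=
    hsqrt0 (tendsto_sobSq_sub_galerkinProj hw ((memV_iff hL hw m).1 hu₀).2.ne)
  have hβ0 : Tendsto β atTop (𝓝 0) := tendsto_lintegral_sobSq_sub_galerkinProj hw hpos
    (fun j => aemeasurable_inner hf₁.1 (w j)) ((memLpV_one_iff hL hw).1 hf₁).2.2.ne
  have hγ0 : Tendsto γ atTop (𝓝 0) := by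
    refine tendsto_lintegral_sobSq_sub_galerkinProj hw hpos
      (hu.aemeasurable_inner_B hL hT.le hw hf₁.1) ?_
    refine ne_top_of_le_ne_top (b := Cu * U) (by finiteness) ?_
    rw [hUdef, ← lintegral_const_mul' _ _ hCu]
    refine lintegral_mono_ae ?_
    filter_upwards [hu.memLp_two.2] with t ht
    refine (hBu _ _ ht ht).trans (le_of_eq ?_)
    rw [← ENNReal.rpow_add_of_nonneg _ _ hpos.le hpos.le, add_halves, ENNReal.rpow_one]
  have hτ0 : Tendsto τ atTop (𝓝 0) := by
    simpa only [ENNReal.rpow_one] using tendsto_lintegral_sobSq_sub_galerkinProj hw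
      (s := (m : ℝ) + 1) one_pos (fun j => aemeasurable_inner hum (w j))
      (by simpa only [ENNReal.rpow_one] using hU.ne)
  have hε0 : Tendsto ε atTop (𝓝 0) := by
    have h1 := ENNReal.tendsto_ofReal hδ
    rw [ENNReal.ofReal_zero] at h1
    have h2 := ENNReal.Tendsto.const_mul (a := ENNReal.ofReal ν⁻¹) h1 (Or.inr ENNReal.ofReal_ne_top)
    have h3 := ENNReal.Tendsto.const_mul (a := 2) (h2.add hτ0) (Or.inr ENNReal.ofNat_ne_top)
    simpa using h3
  have hη0 : Tendsto η atTop (𝓝 0) := by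
    have h1 := ENNReal.Tendsto.const_mul (a := 2) hβ0 (Or.inr ENNReal.ofNat_ne_top)
    have h2 := ENNReal.Tendsto.const_mul (a := 4) hγ0 (Or.inr ENNReal.ofNat_ne_top)
    have h3 := ENNReal.Tendsto.mul_const (b := V ^ (1 / 2 : ℝ)) (hsqrt0 hε0)
      (Or.inr (by finiteness))
    have h4 := ENNReal.Tendsto.const_mul (a := U ^ (1 / 2 : ℝ)) (hsqrt0 hε0)
      (Or.inr (by finiteness))
    have h5 := ENNReal.Tendsto.const_mul (a := 4 * C) (h3.add h4) (Or.inr (by finiteness))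
    simpa [hη] using hα0.add ((h1.add h5).add h2)
  -- `K₀` will bound the integral in the exponent, and `κ` the right-hand side from below
  set K₀ := ((ENNReal.ofReal (lam 0 ^ ((m : ℝ) - (m + 1))) ^ (1 / 2 : ℝ) + 1)
    * (ENNReal.ofReal T + V)).toReal with hK₀
  set κ := 1 / (c * T) * Real.exp (-c * K₀) with hκ
  have hκ0 : 0 < κ := by positivity
  obtain ⟨N, hN⟩ := eventually_atTop.1 ((hδ.eventually_lt_const one_pos).and
    (hη0.eventually_lt_const (ENNReal.ofReal_pos.2 hκ0)))
  refine ⟨N, fun n hn => ?_⟩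
  obtain ⟨hδn, hηn⟩ := hN n hn
  have hδle : ENNReal.ofReal (δ n) ≤ 1 := ENNReal.ofReal_le_one.2 hδn.le
  obtain ⟨u', hu', -⟩ := hu.equation
  refine ⟨exists_isGalerkinSolution hL hT.le hw (m := m) (Nat.cast_nonneg m)
    (hf₂.integrableOn hL hw) (hu'.continuousOn hT.le) fun v h h1 h2 h3 h4 t ht =>
    le_self_add.trans ((hbound n hδn v h h1 h2 h3 h4 t ht).trans hδle), fun v hv => ?_⟩
  obtain ⟨v', hv', heq⟩ := hv.equation
  have hvm := hv.aestronglyMeasurable hT.le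
  have hvV : ∀ k, ∀ᵐ t ∂volume.restrict (Ioc 0 T), MemV L k (v t) := fun k => by
    filter_upwards [ae_restrict_mem measurableSet_Ioc] with t ht
    exact hv.memV hL hw k (Ioc_subset_Icc_self ht)
  have hR₁ := hv.memLpV_one_residual hL hT.le hw (by omega) hf₁ heq
  have hR₂ := hv.memLpV_two_residual hL hT.le hw (by omega) hf₂ heq
  -- the comparison with `Pₙu`, applied to the Galerkin solution itself
  have hφ : ∫⁻ t in Ioc 0 T, sobSq w lam (m + 1) (v t - galerkinProj w n (u t))
      ≤ ENNReal.ofReal ν⁻¹ * ENNReal.ofReal (δ n) := by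
    have h1 := hbound n hδn v (fun j t => ⟪v' t, w j⟫) hv.mem hv.initial
      (fun j _ => hv'.isPrimitive hT.le (w j)) (by
        filter_upwards [heq, hvV 2] with t h1 h2 _ j hj
        rw [inner_equation hL hw h2 h1, inner_sub_left, inner_sub_left, inner_galerkinProj hw,
          inner_galerkinProj hw, if_pos hj, if_pos hj]) T ⟨hT.le, le_rfl⟩
    have h2 := mul_le_mul_right (le_add_self.trans h1) (ENNReal.ofReal ν⁻¹)
    rwa [← mul_assoc, ← ENNReal.ofReal_mul (inv_nonneg.2 hν.le), inv_mul_cancel₀ hν.ne',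
      ENNReal.ofReal_one, one_mul] at h2
  have hφm : AEMeasurable (fun t => sobSq w lam (m + 1) (v t - galerkinProj w n (u t)))
      (volume.restrict (Ioc 0 T)) := aemeasurable_sobSq
    (hvm.sub ((continuous_galerkinProj n).comp_aestronglyMeasurable hum)) _
  have hE : ∫⁻ t in Ioc 0 T, sobSq w lam (m + 1) (v t - u t) ≤ ε n := by
    calc _ ≤ ∫⁻ t in Ioc 0 T, 2 * (sobSq w lam (m + 1) (v t - galerkinProj w n (u t))
            + sobSq w lam (m + 1) (u t - galerkinProj w n (u t))) :=
          lintegral_mono fun t => by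
            rw [← sub_sub_sub_cancel_right (v t) (u t) (galerkinProj w n (u t))]
            exact sobSq_sub_le hw _ _ _
      _ ≤ ε n := by
          rw [lintegral_const_mul' _ _ ENNReal.ofNat_ne_top, lintegral_add_left' hφm]
          simp only [hε, hτ]
          gcongr
  have hVle : ∫⁻ t in Ioc 0 T, sobSq w lam (m + 1) (v t) ≤ V := by
    calc _ ≤ ∫⁻ t in Ioc 0 T, 2 * (sobSq w lam (m + 1) (v t - galerkinProj w n (u t))
            + sobSq w lam (m + 1) (u t)) :=
          lintegral_mono fun t => by
            have h1 := sobSq_add_le hw (m + 1) (v t - galerkinProj w n (u t))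
              (galerkinProj w n (u t))
            rw [sub_add_cancel] at h1
            refine h1.trans ?_
            gcongr
            exact sobSq_galerkinProj_le hw _ n (u t)
      _ ≤ V := by
          rw [lintegral_const_mul' _ _ ENNReal.ofNat_ne_top, lintegral_add_left' hφm, hV, hUdef]
          gcongr
          exact hφ.trans (mul_le_of_le_one_right' hδle)
  refine ⟨hv.memC0V hL hT.le hw m, hv.memLpV_two hL hT.le hw (m + 1), v', hv', hR₁, hR₂, ?_⟩
  have h0 : ENNReal.ofReal (vNorm L m (v 0 - u₀)) = α n := by
    rw [ofReal_vNorm hL hw ((hv.memV hL hw m ⟨le_rfl, hT.le⟩).sub hL hu₀), hv.initial,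
      ← neg_sub, sobSq_neg]
  have hI : ENNReal.ofReal (∫ s in (0 : ℝ)..T,
      vNorm L m (v' s + ν • stokes L (v s) + B L (v s) (v s) - f s))
      ≤ 2 * β n + 4 * C * (ε n ^ (1 / 2 : ℝ) * V ^ (1 / 2 : ℝ) + U ^ (1 / 2 : ℝ)
        * ε n ^ (1 / 2 : ℝ)) + 4 * γ n := by
    refine (ofReal_integral_vNorm_le hL hw hT.le ?_).trans ((hres hf₁.1 hum hvm hu.memLp_two.2
      (hvV 2) (n := n) (heq.mono fun t ht => galerkin_residual_eq ht)).trans ?_)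
    · filter_upwards [hR₁.2, hf₁.2] with t h1 h2
      exact h1.sub hL h2
    · gcongr
  have hlt : vNorm L m (v 0 - u₀) + ∫ s in (0 : ℝ)..T,
      vNorm L m (v' s + ν • stokes L (v s) + B L (v s) (v s) - f s) < κ := by
    refine (ENNReal.ofReal_lt_ofReal_iff hκ0).1 (lt_of_le_of_lt ?_ hηn)
    refine ENNReal.ofReal_add_le.trans ?_
    rw [h0]
    exact add_le_add le_rfl hI
  refine hlt.trans_le ?_
  have hK := integral_vNorm_add_vNorm_le hL hw hT.le (hvV (m + 1)) hVtop hVle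
  rw [hκ]
  refine mul_le_mul_of_nonneg_left (Real.exp_le_exp.2 ?_) (by positivity)
  nlinarith
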